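/- Let $X$ be an integral projective scheme of dimension $n\ge 1$ over an arbitrary field $k$, with function field $k(X)$. For a Cartier divisor $D$ on $X$ let $L(X,D)=\{0\}\cup\{f\in k(X)^{\times}: (f)+D \text{ is effective}\}$, and define the volume $$\mathrm{vol}(D)=n!\,\limsup_{m\to\infty}\frac{\dim_k L(X,mD)}{m^n}\in[0,\infty].$$ Call $D$ big if $\mathrm{vol}(D)>0$. Then $\mathrm{vol}^{1/n}$ is concave on big divisors: for any two Cartier divisors $D_1,D_2$ on $X$ with $\mathrm{vol}(D_1)>0$ and $\mathrm{vol}(D_2)>0$, $$\mathrm{vol}(D_1+D_2)^{1/n}\ \ge\ \mathrm{vol}(D_1)^{1/n}+\mathrm{vol}(D_2)^{1/n},$$ and more generally, for all integers $p,q\ge 0$, $$\mathrm{vol}(pD_1+qD_2)^{1/n}\ \ge\ p\,\mathrm{vol}(D_1)^{1/n}+q\,\mathrm{vol}(D_2)^{1/n}.$$ -/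

import Mathlib

open AlgebraicGeometry CategoryTheory

universe u

noncomputable section

namespace BigDivisor

attribute [local instance] MvPolynomial.gradedAlgebra

/-- Projective space `ℙ^N` over a field `k`, as `Proj k[x₀, …, x_N]`. -/
abbrev projSpace (k : Type u) [Field k] (N : ℕ) : Scheme.{u} :=
  Proj (MvPolynomial.homogeneousSubmodule (Fin (N + 1)) k)

/-- The structure morphism `ℙ^N ⟶ Spec k`. -/
def projSpaceToSpec (k : Type u) [Field k] (N : ℕ) :
    projSpace k N ⟶ Spec (CommRingCat.of k) :=
  Proj.toSpecZero (MvPolynomial.homogeneousSubmodule (Fin (N + 1)) k) ≫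
    Spec.map (CommRingCat.ofHom
      (algebraMap k (MvPolynomial.homogeneousSubmodule (Fin (N + 1)) k 0)))

/-- A `k`-scheme `π : X ⟶ Spec k` is projective if it is isomorphic over `k` to a closed
subscheme of some `ℙ^N`. -/
def IsProjectiveOver {k : Type u} [Field k] {X : Scheme.{u}}
    (π : X ⟶ Spec (CommRingCat.of k)) : Prop :=
  ∃ (N : ℕ) (i : X ⟶ projSpace k N), IsClosedImmersion i ∧ i ≫ projSpaceToSpec k N = π

section Cartier

variable (X : Scheme.{u}) [IsIntegral X]

/-- The image of `𝒪_{X,x}ˣ` in `k(X)ˣ`. -/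
def localUnits (x : X) : Subgroup (X.functionField)ˣ :=
  (Units.map (algebraMap (X.presheaf.stalk x) X.functionField).toMonoidHom).range

/-- Global sections of the sheaf `𝒦ˣ/𝒪ˣ` on an integral scheme (where `𝒦` is the constant sheaf
`k(X)`): families of germs in `k(X)ˣ/𝒪_{X,x}ˣ` which, locally on `X`, come from one rational
function. -/
def cartierSubgroup : Subgroup (∀ x : X, (X.functionField)ˣ ⧸ localUnits X x) where
  carrier := {D | ∀ x : X, ∃ U : X.Opens, x ∈ U ∧ ∃ d : (X.functionField)ˣ,
    ∀ y ∈ U, D y = QuotientGroup.mk d}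
  one_mem' := fun _ => ⟨⊤, trivial, 1, fun _ _ => rfl⟩
  mul_mem' := by
    intro D E hD hE x
    obtain ⟨U, hxU, d, hd⟩ := hD x
    obtain ⟨V, hxV, e, he⟩ := hE x
    refine ⟨U ⊓ V, ⟨hxU, hxV⟩, d * e, fun y hy => ?_⟩
    rw [Pi.mul_apply, hd y hy.1, he y hy.2]
    rfl
  inv_mem' := by
    intro D hD x
    obtain ⟨U, hxU, d, hd⟩ := hD x
    refine ⟨U, hxU, d⁻¹, fun y hy => ?_⟩
    rw [Pi.inv_apply, hd y hy]
    rfl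

/-- The group of (integral) Cartier divisors on `X`, written additively. -/
abbrev CartierDivisor : Type u := Additive (cartierSubgroup X)

variable {X}

/-- The rational function `d` is a local equation of `D` at `x`. -/
def IsLocalEquation (D : CartierDivisor X) (x : X) (d : (X.functionField)ˣ) : Prop :=
  (D.toMul : ∀ x : X, (X.functionField)ˣ ⧸ localUnits X x) x = QuotientGroup.mk d

end Cartier

section Volume

variable {k : Type u} [Field k] {X : Scheme.{u}} [IsIntegral X]

/-- The constants: `k → Γ(X, 𝒪_X)`, induced by `π : X ⟶ Spec k`. -/
def constants (π : X ⟶ Spec (CommRingCat.of k)) : k →+* Γ(X, ⊤) :=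
  ((Scheme.ΓSpecIso (CommRingCat.of k)).inv ≫ π.appTop).hom

/-- The `k`-algebra structure of the function field of a `k`-scheme. -/
abbrev functionFieldAlgebra (π : X ⟶ Spec (CommRingCat.of k)) : Algebra k X.functionField :=
  ((X.presheaf.germ ⊤ (genericPoint X) trivial).hom.comp (constants π)).toAlgebra

/-- `L(X, D) = {f ∈ k(X) : f = 0 or (f) + D ≥ 0}`: the rational functions `f` such that, at every
point `x`, `f * d` is regular for a local equation `d` of `D` at `x`. -/
def sections (π : X ⟶ Spec (CommRingCat.of k)) (D : CartierDivisor X) :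
    @Submodule k X.functionField _ _ (functionFieldAlgebra π).toModule :=
  letI := functionFieldAlgebra π
  { carrier := {f | ∀ (x : X) (d : (X.functionField)ˣ), IsLocalEquation D x d →
      f * d ∈ (algebraMap (X.presheaf.stalk x) X.functionField).range}
    zero_mem' := fun x d _ => by rw [zero_mul]; exact zero_mem _
    add_mem' := fun hf hg x d hd => by rw [add_mul]; exact add_mem (hf x d hd) (hg x d hd)
    smul_mem' := fun c f hf x d hd => by
      rw [Algebra.smul_def, mul_assoc]
      refine mul_mem ⟨X.presheaf.germ ⊤ x trivial (constants π c), ?_⟩ (hf x d hd)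
      have : Nonempty (⊤ : X.Opens) := ⟨⟨genericPoint X, trivial⟩⟩
      exact Scheme.algebraMap_germ_eq_germToFunctionField X (U := ⊤) (x := x) trivial (constants π c) }

/-- `dim_k L(X, D)`, as an element of `ℕ ∪ {∞}`. -/
def dimSections (π : X ⟶ Spec (CommRingCat.of k)) (D : CartierDivisor X) : ℕ∞ :=
  letI := functionFieldAlgebra π
  Cardinal.toENat (Module.rank k (sections π D))

/-- The volume `n! · limsup_m dim_k L(X, mD) / m ^ n ∈ [0, ∞]` of a Cartier divisor on an
`n`-dimensional variety. -/
def vol (π : X ⟶ Spec (CommRingCat.of k)) (n : ℕ) (D : CartierDivisor X) : ENNReal :=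
  (n.factorial : ENNReal) *
    Filter.limsup (fun m : ℕ => (dimSections π (m • D) : ENNReal) / (m : ENNReal) ^ n) Filter.atTop

end Volume

end BigDivisor

end

/-! ### Powers of a finite-dimensional space of coordinates and their saturation. -/

section

namespace BigDivisor

section CommonDenominators
variable {k K : Type*} [Field k] [Field K] [Algebra k K] {Y : Submodule k K}

/-! The heart is a Brunn-Minkowski inequality for subspaces of a field. If `K / k` is finitely
generated of transcendence degree `t`, one fixed finite-dimensional `E` satisfies `dim (E V W) ^
(1/t) ≥ dim V ^ (1/t) + dim W ^ (1/t)` for all nonzero finite-dimensional `V`, `W` (`LinearBM`,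
`linearBM_of_algebraicIndependent`; for `t = 0` the bound is the maximum of the dimensions). The
proof is by induction on `t`. A discrete place of `K` with residue field of transcendence degree `t
- 1` filters `V` and `W` by order of vanishing. The residue field controls products of graded
pieces, Cauchy-Davenport in `ℤ` controls their indices, and the one-variable inequality
`bmFun_succ_sum_le` combines the two (`DiscretePlace.linearBM_succ`).

Next come growth bounds. With `Y` the span of the homogeneous coordinates, multiplication by `h ^ m`
for a fixed `h ≠ 0` carries `L(X, mD)` into the saturation of `Y ^ (e * m)`
(`Coordinates.exists_mul_pow_mem_satPow`). The linear inequality itself shows that saturated powers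
grow no faster than powers (`exists_finrank_le_of_le_satPow`). Hence the section ring of `D` grows
like `O(m ^ r)`, where `r` is the transcendence degree of its field of ratios. Positive volume
forces `n ≤ r`, and an inequality for `r`-th roots implies the one for `n`-th roots because `t ↦ t ^
(r / n)` is superadditive. So `r` need not be compared with `dim X` from above, and neither Okounkov
bodies nor a rational point is needed.

Finally, inside a single section ring the `n`-th root of the dimension is superadditive up to a
fixed shift of degree, so its limsup is bounded by the liminf along multiples of any positive degree
carrying a nonzero section (`limsup_div_le_liminf_div`). Applying the linear inequality to `L(pmD₁)`
and `L(qmD₂)`, whose product lies in `L(m(pD₁ + qD₂))`, along common multiples gives the theorem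
(`LinearSeries.mul_limsup_add_mul_limsup_le`). -/

lemma pow_le_pow_of_one_mem (h1 : (1 : K) ∈ Y) {a b : ℕ} (h : a ≤ b) : Y ^ a ≤ Y ^ b :=
  pow_le_pow_right₀ (Submodule.one_le.mpr h1) h

/-- Homogenization: clearing denominators turns a polynomial in the quotients into a form of degree
`M`. Padding with further factors `t` raises `M`, which lets sums be brought to a common degree. -/
lemma exists_mul_pow_mem_of_mem_adjoin {ι : Type*} {y : ι → K} (hy : ∀ j, y j ∈ Y) {t : K}
    (ht : t ∈ Y) (ht0 : t ≠ 0) {f : K} (hf : f ∈ Algebra.adjoin k (Set.range fun j => y j / t)) :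
    ∃ M, f * t ^ M ∈ Y ^ M := by
  have hmono : ∀ {f : K} {M M' : ℕ}, M ≤ M' → f * t ^ M ∈ Y ^ M → f * t ^ M' ∈ Y ^ M' := by
    intro f M M' hM h
    obtain ⟨c, rfl⟩ := Nat.exists_eq_add_of_le hM
    rw [pow_add, pow_add, ← mul_assoc]
    exact Submodule.mul_mem_mul h (Submodule.pow_mem_pow _ ht c)
  induction hf using Algebra.adjoin_induction with
  | mem x hx =>
    obtain ⟨j, rfl⟩ := hx
    exact ⟨1, by simpa [div_mul_cancel₀ _ ht0] using hy j⟩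
  | algebraMap r => exact ⟨0, by simp [Algebra.algebraMap_eq_smul_one]⟩
  | add x z _ _ hx hz =>
    obtain ⟨M, hM⟩ := hx
    obtain ⟨M', hM'⟩ := hz
    exact ⟨max M M', by
      rw [add_mul]
      exact add_mem (hmono (le_max_left _ _) hM) (hmono (le_max_right _ _) hM')⟩
  | mul x z _ _ hx hz =>
    obtain ⟨M, hM⟩ := hx
    obtain ⟨N, hN⟩ := hz
    exact ⟨M + N, by
      rw [pow_add, pow_add, mul_mul_mul_comm]
      exact Submodule.mul_mem_mul hM hN⟩

/-- Every element of `K` is a quotient of two elements of a power of `Y`. -/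
def IsFractionGenerating (Y : Submodule k K) : Prop :=
  ∀ f : K, ∃ c, ∃ a ∈ Y ^ c, ∃ b ∈ Y ^ c, b ≠ 0 ∧ f = a / b

lemma IsFractionGenerating.exists_common_denominator (hY : IsFractionGenerating Y) (s : Finset K) :
    ∃ c, ∃ h ∈ Y ^ c, h ≠ 0 ∧ ∀ e ∈ s, h * e ∈ Y ^ c := by
  classical
  induction s using Finset.induction_on with
  | empty => exact ⟨0, 1, by simp, one_ne_zero, by simp⟩
  | insert e s _ ih =>
    obtain ⟨c, h, hc, h0, hs⟩ := ih
    obtain ⟨c', a, ha, b, hb, hb0, rfl⟩ := hY e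
    refine ⟨c + c', h * b, pow_add Y c c' ▸ Submodule.mul_mem_mul hc hb, mul_ne_zero h0 hb0, ?_⟩
    intro x hx
    rw [pow_add]
    obtain rfl | hx := Finset.mem_insert.mp hx
    · rw [mul_assoc, mul_div_cancel₀ _ hb0]
      exact Submodule.mul_mem_mul hc ha
    · rw [mul_right_comm]
      exact Submodule.mul_mem_mul (hs x hx) hb

/-- Elements `f` such that `f * Y ^ M ≤ Y ^ (a + M)` for all large `M`. -/
def satPow (Y : Submodule k K) (a : ℕ) : Submodule k K where
  carrier := {f | ∃ M₀, ∀ M ≥ M₀, ∀ g ∈ Y ^ M, f * g ∈ Y ^ (a + M)}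
  zero_mem' := ⟨0, fun M _ g _ => by simp⟩
  add_mem' := by
    rintro f f' ⟨M, hM⟩ ⟨M', hM'⟩
    refine ⟨max M M', fun m hm g hg => ?_⟩
    rw [add_mul]
    exact add_mem (hM m (le_trans (le_max_left _ _) hm) g hg)
      (hM' m (le_trans (le_max_right _ _) hm) g hg)
  smul_mem' := by
    rintro c f ⟨M, hM⟩
    refine ⟨M, fun m hm g hg => ?_⟩
    rw [smul_mul_assoc]
    exact Submodule.smul_mem _ _ (hM m hm g hg)

lemma mul_mem_satPow {a b : ℕ} {f g : K} (hf : f ∈ satPow Y a) (hg : g ∈ satPow Y b) :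
    f * g ∈ satPow Y (a + b) := by
  obtain ⟨M, hM⟩ := hf
  obtain ⟨M', hM'⟩ := hg
  refine ⟨max M M', fun m hm e he => ?_⟩
  rw [mul_assoc, add_assoc]
  exact hM _ (by omega) _ (hM' m (by omega) e he)

lemma pow_le_satPow (a : ℕ) : Y ^ a ≤ satPow Y a := fun f hf =>
  ⟨0, fun M _ g hg => by rw [pow_add]; exact Submodule.mul_mem_mul hf hg⟩

lemma prod_pow_mem_pow_sum {ι : Type*} {y : ι → K} (hy : ∀ i, y i ∈ Y) (s : Finset ι) (d : ι → ℕ) :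
    ∏ i ∈ s, y i ^ d i ∈ Y ^ ∑ i ∈ s, d i := by
  classical
  induction s using Finset.induction_on with
  | empty => simp
  | insert i s hi ih =>
    rw [Finset.prod_insert hi, Finset.sum_insert hi, pow_add]
    exact Submodule.mul_mem_mul (Submodule.pow_mem_pow _ (hy i) _) ih

open Pointwise in
lemma span_range_pow_le {ι : Type*} [Fintype ι] (y : ι → K) (m : ℕ) :
    Submodule.span k (Set.range y) ^ m ≤
      Submodule.span k {z | ∃ d : ι → ℕ, ∑ i, d i = m ∧ z = ∏ i, y i ^ d i} := by
  classical
  rw [Submodule.span_pow]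
  refine Submodule.span_mono ?_
  induction m with
  | zero =>
    rintro z hz
    exact ⟨0, by simp, by simpa using hz⟩
  | succ m ih =>
    rintro z hz
    rw [pow_succ] at hz
    obtain ⟨z', hz', _, ⟨j, rfl⟩, rfl⟩ := hz
    obtain ⟨d, hd, rfl⟩ := ih hz'
    refine ⟨d + Pi.single j 1, by simp [Finset.sum_add_distrib, hd], ?_⟩
    simp only [Pi.add_apply, pow_add, Finset.prod_mul_distrib]
    congr 1
    rw [Finset.prod_eq_single j] <;> simp +contextual

/-- Pigeonhole: a monomial of large degree contains some `y i` to a power at least `M i`, and that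
factor absorbs `f`. -/
lemma mem_satPow_of_forall {ι : Type*} [Fintype ι] {y : ι → K}
    (hY : Y = Submodule.span k (Set.range y)) {a : ℕ} {f : K}
    (hf : ∀ i, y i ≠ 0 → ∃ M, f * y i ^ M ∈ Y ^ (a + M)) : f ∈ satPow Y a := by
  classical
  choose! M hM using hf
  have hyY : ∀ i, y i ∈ Y := fun i => hY ▸ Submodule.subset_span ⟨i, rfl⟩
  -- Beyond this degree some exponent is strictly larger than `M i`, hence nonzero, so the monomial
  -- vanishes when `y i = 0`.
  refine ⟨∑ i, M i + 1, fun m hm g hg => ?_⟩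
  have hm' := span_range_pow_le y m (hY ▸ hg)
  clear hg
  induction hm' using Submodule.span_induction with
  | zero => simp
  | add x z _ _ hx hz => rw [mul_add]; exact add_mem hx hz
  | smul c x _ hx => rw [mul_smul_comm]; exact Submodule.smul_mem _ _ hx
  | mem x hx =>
    obtain ⟨d, hd, rfl⟩ := hx
    obtain ⟨i, hi⟩ : ∃ i, M i < d i := by
      by_contra! h
      have := Finset.sum_le_sum (s := Finset.univ) fun i _ => h i
      omega
    by_cases h0 : y i = 0
    · rw [Finset.prod_eq_zero (Finset.mem_univ i) (by rw [h0, zero_pow (by omega)]), mul_zero]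
      exact zero_mem _
    have hd' : d = Pi.single i (M i) + (d - Pi.single i (M i)) := by
      funext j
      by_cases hj : j = i
      · subst hj
        simp only [Pi.add_apply, Pi.sub_apply, Pi.single_eq_same]
        omega
      · simp [hj]
    generalize d - Pi.single i (M i) = e at hd'
    have hsum : m = M i + ∑ j, e j := by
      rw [← hd, hd']
      simp [Finset.sum_add_distrib]
    have hprod : ∏ j, y j ^ d j = y i ^ M i * ∏ j, y j ^ e j := by
      rw [hd']
      simp only [Pi.add_apply, pow_add, Finset.prod_mul_distrib]
      congr 1
      rw [Finset.prod_eq_single i] <;> simp +contextual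
    rw [hprod, hsum, ← mul_assoc, ← add_assoc, pow_add]
    exact Submodule.mul_mem_mul (hM i h0) (prod_pow_mem_pow_sum hyY _ _)

end CommonDenominators

end BigDivisor

end

/-! ### Standard charts of a projective scheme. -/

noncomputable section

open AlgebraicGeometry CategoryTheory

namespace BigDivisor

attribute [local instance] MvPolynomial.gradedAlgebra

section Away
variable {k : Type u} [Field k] {N : ℕ}
open MvPolynomial HomogeneousLocalization

/-- The constants of the degree zero part of a localization of the polynomial ring. -/
def homLocConst (k : Type u) [Field k] (N : ℕ) (S : Submonoid (MvPolynomial (Fin (N + 1)) k)) :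
    k →+* HomogeneousLocalization (homogeneousSubmodule (Fin (N + 1)) k) S :=
  (fromZeroRingHom _ S).comp (algebraMap k (homogeneousSubmodule (Fin (N + 1)) k 0))

lemma X_mem_homogeneousSubmodule (i : Fin (N + 1)) :
    (X i : MvPolynomial (Fin (N + 1)) k) ∈ homogeneousSubmodule (Fin (N + 1)) k 1 :=
  isHomogeneous_X k i

/-- The affine coordinate `x_j / x_i`. -/
def affCoord (i j : Fin (N + 1)) :
    Away (homogeneousSubmodule (Fin (N + 1)) k) (X i : MvPolynomial (Fin (N + 1)) k) :=
  Away.mk _ (X_mem_homogeneousSubmodule i) 1 (X j) (X_mem_homogeneousSubmodule j)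

lemma eval₂_mul_of_isHomogeneous {R : Type*} [CommRing R] (φ : k →+* R) (t : R)
    (g : Fin (N + 1) → R) (n : ℕ) (a : MvPolynomial (Fin (N + 1)) k) (ha : a.IsHomogeneous n) :
    eval₂ φ (fun j => t * g j) a = t ^ n * eval₂ φ g a := by
  rw [eval₂_eq', eval₂_eq', Finset.mul_sum]
  refine Finset.sum_congr rfl fun d hd => ?_
  have hdeg : ∑ i, d i = n := by
    have := ha (mem_support_iff.mp hd)
    rwa [Finsupp.weight_apply, Finsupp.sum_fintype _ _ (by simp), Finset.sum_congr rfl] at this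
    simp
  simp_rw [mul_pow]
  rw [Finset.prod_mul_distrib, Finset.prod_pow_eq_pow_sum, hdeg]
  ring

/-- Dehomogenization, verified in the localization after multiplying by `X i ^ n`. It shows that the
coordinate ring of a chart is generated by the affine coordinates over `k`. -/
lemma away_mk_eq_eval₂ (i : Fin (N + 1)) (n : ℕ) (a : MvPolynomial (Fin (N + 1)) k)
    (ha : a ∈ homogeneousSubmodule (Fin (N + 1)) k (n • 1)) :
    Away.mk _ (X_mem_homogeneousSubmodule i) n a ha =
      eval₂ (homLocConst k N _) (affCoord i) a := by
  have hinj := HomogeneousLocalization.val_injective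
    (𝒜 := homogeneousSubmodule (Fin (N + 1)) k) (Submonoid.powers (X i : MvPolynomial (Fin (N + 1)) k))
  apply hinj
  have h1 : ((eval₂ (homLocConst k N _) (affCoord i) a :
      Away (homogeneousSubmodule (Fin (N + 1)) k) (X i : MvPolynomial (Fin (N + 1)) k))).val =
      eval₂ ((algebraMap (MvPolynomial (Fin (N + 1)) k) (Localization.Away (X i : MvPolynomial (Fin (N + 1)) k))).comp C)
        (fun j => (affCoord i j).val) a := by
    change algebraMap (Away (homogeneousSubmodule (Fin (N + 1)) k) (X i : MvPolynomial (Fin (N + 1)) k))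
      (Localization.Away (X i : MvPolynomial (Fin (N + 1)) k)) _ = _
    rw [hom_eval₂]
    rfl
  rw [h1, Away.val_mk]
  have h2 := eval₂_mul_of_isHomogeneous
    ((algebraMap (MvPolynomial (Fin (N + 1)) k) (Localization.Away (X i : MvPolynomial (Fin (N + 1)) k))).comp C)
    (algebraMap (MvPolynomial (Fin (N + 1)) k) (Localization.Away (X i : MvPolynomial (Fin (N + 1)) k)) (X i))
    (fun j => (affCoord i j).val) n a (by simpa using ha)
  have h3 : ∀ j, algebraMap (MvPolynomial (Fin (N + 1)) k) (Localization.Away (X i : MvPolynomial (Fin (N + 1)) k)) (X i) *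
      (affCoord i j).val = algebraMap (MvPolynomial (Fin (N + 1)) k) _ (X j) := by
    intro j
    rw [affCoord, Away.val_mk, Localization.mk_eq_mk', mul_comm]
    simp
  simp_rw [h3] at h2
  rw [Localization.mk_eq_mk', IsLocalization.mk'_eq_iff_eq_mul]
  rw [mul_comm]
  convert h2 using 1
  · symm
    rw [← hom_eval₂, eval₂_eta]
  · simp
end Away

section Charts
variable {k : Type u} [Field k] {N : ℕ} {X : Scheme.{u}} (ι : X ⟶ projSpace k N)
open HomogeneousLocalization

/-- The standard open subset of a projective variety where the `i`-th coordinate is nonzero. -/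
def chart (i : Fin (N + 1)) : X.Opens :=
  ι ⁻¹ᵁ Proj.basicOpen (MvPolynomial.homogeneousSubmodule (Fin (N + 1)) k) (MvPolynomial.X i)

lemma exists_mem_chart (x : X) : ∃ i, x ∈ chart ι i := by
  have h := Proj.iSup_basicOpen_eq_top' (MvPolynomial.homogeneousSubmodule (Fin (N + 1)) k)
    (fun i : Fin (N + 1) => (MvPolynomial.X i : MvPolynomial (Fin (N + 1)) k))
    (fun i => ⟨1, X_mem_homogeneousSubmodule i⟩) ?_
  · have : ι x ∈ (⊤ : (projSpace k N).Opens) := trivial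
    rw [← h, TopologicalSpace.Opens.mem_iSup] at this
    exact this
  · rw [eq_top_iff]
    intro p _
    induction p using MvPolynomial.induction_on with
    | C a =>
      exact Subalgebra.algebraMap_mem _
        (algebraMap k (MvPolynomial.homogeneousSubmodule (Fin (N + 1)) k 0) a)
    | add p q hp hq => exact add_mem (hp trivial) (hq trivial)
    | mul_X p i hp => exact mul_mem (hp trivial) (Algebra.subset_adjoin ⟨i, rfl⟩)

/-- Regular functions on a chart coming from degree zero fractions of polynomials. -/
def awayToChart (f : MvPolynomial (Fin (N + 1)) k) :
    Away (MvPolynomial.homogeneousSubmodule (Fin (N + 1)) k) f →+*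
      Γ(X, ι ⁻¹ᵁ Proj.basicOpen (MvPolynomial.homogeneousSubmodule (Fin (N + 1)) k) f) :=
  (Proj.awayToSection _ f ≫ ι.app _).hom

lemma awayToChart_surjective [IsClosedImmersion ι] (i : Fin (N + 1)) :
    Function.Surjective (awayToChart ι (MvPolynomial.X i)) := by
  have h1 := ι.app_surjective _ (Proj.isAffineOpen_basicOpen
    (MvPolynomial.homogeneousSubmodule (Fin (N + 1)) k) (MvPolynomial.X i)
    (X_mem_homogeneousSubmodule i) one_pos)
  have h2 := (ConcreteCategory.bijective_of_isIso (Proj.basicOpenIsoAway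
    (MvPolynomial.homogeneousSubmodule (Fin (N + 1)) k) (MvPolynomial.X i)
    (X_mem_homogeneousSubmodule i) one_pos).hom).2
  exact h1.comp h2

lemma germ_awayToChart_awayMap (f g h : MvPolynomial (Fin (N + 1)) k)
    (hg : g ∈ MvPolynomial.homogeneousSubmodule (Fin (N + 1)) k 1) (hh : h = f * g) (x : X)
    (hf : x ∈ ι ⁻¹ᵁ Proj.basicOpen (MvPolynomial.homogeneousSubmodule (Fin (N + 1)) k) f)
    (hx : x ∈ ι ⁻¹ᵁ Proj.basicOpen (MvPolynomial.homogeneousSubmodule (Fin (N + 1)) k) h)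
    (a : Away (MvPolynomial.homogeneousSubmodule (Fin (N + 1)) k) f) :
    X.presheaf.germ _ x hx (awayToChart ι h (awayMap _ hg hh a)) =
      X.presheaf.germ _ x hf (awayToChart ι f a) := by
  have h1 := ConcreteCategory.congr_hom (Proj.awayMap_awayToSection
    (MvPolynomial.homogeneousSubmodule (Fin (N + 1)) k) hg hh) a
  have h2 := ConcreteCategory.congr_hom (ι.naturality
    (homOfLE (Proj.basicOpen_mono (MvPolynomial.homogeneousSubmodule (Fin (N + 1)) k) _ _
      ⟨_, hh⟩)).op) (Proj.awayToSection _ f a)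
  have h3 := (congrArg (ι.app _) h1).trans h2
  exact (congrArg (X.presheaf.germ _ x hx) h3).trans (X.presheaf.germ_res_apply _ _ _ _)

/-- The transition relation between two charts, checked on their overlap; it makes ratios of
coordinates in the function field independent of the chart. -/
lemma awayMap_affCoord_mul (i j l : Fin (N + 1)) :
    awayMap (MvPolynomial.homogeneousSubmodule (Fin (N + 1)) k) (X_mem_homogeneousSubmodule j)
        (rfl : MvPolynomial.X i * MvPolynomial.X j = _) (affCoord i l) *
      awayMap (MvPolynomial.homogeneousSubmodule (Fin (N + 1)) k) (X_mem_homogeneousSubmodule i)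
        (mul_comm (MvPolynomial.X i) (MvPolynomial.X j)) (affCoord j i) =
      awayMap (MvPolynomial.homogeneousSubmodule (Fin (N + 1)) k) (X_mem_homogeneousSubmodule i)
        (mul_comm (MvPolynomial.X i) (MvPolynomial.X j)) (affCoord j l) := by
  apply HomogeneousLocalization.val_injective
  rw [affCoord, affCoord, affCoord, awayMap_mk, awayMap_mk, awayMap_mk, HomogeneousLocalization.val_mul,
    Away.val_mk, Away.val_mk, Away.val_mk, Localization.mk_mul, Localization.mk_eq_mk_iff,
    Localization.r_iff_exists]
  refine ⟨1, ?_⟩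
  simp
  ring

/-- If the fraction `X j / X i` is a unit in the local ring at `p`, it is a unit in the full
localization at the prime `p`, which forces `X j` to lie outside that prime. -/
lemma mem_basicOpen_of_mem_basicOpen_awayToSection (i j : Fin (N + 1)) (p : projSpace k N)
    (hp : p ∈ (projSpace k N).basicOpen
      (Proj.awayToSection (MvPolynomial.homogeneousSubmodule (Fin (N + 1)) k)
        (MvPolynomial.X i) (affCoord i j))) :
    p ∈ Proj.basicOpen (MvPolynomial.homogeneousSubmodule (Fin (N + 1)) k) (MvPolynomial.X j) := by
  have hpi := Scheme.basicOpen_le _ _ hp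
  rw [Scheme.mem_basicOpen _ _ _ hpi] at hp
  have h2 := hp.map (Proj.stalkIso (MvPolynomial.homogeneousSubmodule (Fin (N + 1)) k) p).hom.hom
  have h3 := congrArg HomogeneousLocalization.val (Proj.stalkIso'_germ
    (MvPolynomial.homogeneousSubmodule (Fin (N + 1)) k) _ p hpi
    (Proj.awayToSection (MvPolynomial.homogeneousSubmodule (Fin (N + 1)) k)
        (MvPolynomial.X i) (affCoord i j)))
  have h4 := h3.trans (ProjectiveSpectrum.Proj.awayToSection_apply _ (MvPolynomial.X i) (affCoord i j) ⟨p, hpi⟩)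
  have hprime : p.asHomogeneousIdeal.toIdeal.IsPrime := p.isPrime
  have h5 := h2.map (algebraMap (AtPrime (MvPolynomial.homogeneousSubmodule (Fin (N + 1)) k)
    p.asHomogeneousIdeal.toIdeal) (Localization.AtPrime p.asHomogeneousIdeal.toIdeal))
  have h6 := (congrArg IsUnit h4).mp h5
  rw [affCoord, Away.val_mk, Localization.mk_eq_mk', IsLocalization.map_mk'] at h6
  exact (IsLocalization.AtPrime.isUnit_mk'_iff
    (Localization.AtPrime p.asHomogeneousIdeal.toIdeal) p.asHomogeneousIdeal.toIdeal _ _).mp h6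

/-- The `k`-structure coming from `π` agrees with the constants of the graded ring, so that
generation by affine coordinates is over the same `k` as in `functionFieldAlgebra`. -/
lemma constants_res (f : MvPolynomial (Fin (N + 1)) k)
    (hf : f ∈ MvPolynomial.homogeneousSubmodule (Fin (N + 1)) k 1) (c : k) (x : X)
    (hx : x ∈ ι ⁻¹ᵁ Proj.basicOpen (MvPolynomial.homogeneousSubmodule (Fin (N + 1)) k) f) :
    X.presheaf.germ ⊤ x trivial (constants (ι ≫ projSpaceToSpec k N) c) =
      X.presheaf.germ _ x hx (awayToChart ι f (homLocConst k N _ c)) := by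
  have h1 : (Proj.basicOpen (MvPolynomial.homogeneousSubmodule (Fin (N + 1)) k) f).ι ≫
      projSpaceToSpec k N =
      Proj.basicOpenToSpec _ f ≫ Spec.map (CommRingCat.ofHom (homLocConst k N _)) := by
    have h := Proj.awayι_toSpecZero (MvPolynomial.homogeneousSubmodule (Fin (N + 1)) k) f hf one_pos
    rw [Proj.awayι, Category.assoc, Iso.inv_comp_eq, Proj.basicOpenIsoSpec_hom] at h
    rw [projSpaceToSpec, reassoc_of% h, homLocConst, CommRingCat.ofHom_comp, Spec.map_comp]
  have h2 : (Scheme.ΓSpecIso (CommRingCat.of k)).inv ≫ (projSpaceToSpec k N).appTop ≫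
      (projSpace k N).presheaf.map (homOfLE le_top).op =
      CommRingCat.ofHom (homLocConst k N _) ≫ Proj.awayToSection _ f := by
    have h := congrArg (fun g => (Scheme.ΓSpecIso (CommRingCat.of k)).inv ≫ g.appTop) h1
    have h' : (Proj.basicOpenToSpec (MvPolynomial.homogeneousSubmodule (Fin (N + 1)) k) f).appTop = _ :=
      Proj.basicOpenToSpec_app_top (MvPolynomial.homogeneousSubmodule (Fin (N + 1)) k) f
    simp only [Scheme.Hom.comp_appTop] at h
    rw [h', ← Scheme.ΓSpecIso_inv_naturality_assoc, Iso.inv_hom_id_assoc] at h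
    rw [← cancel_mono (Scheme.Opens.topIso _).inv]
    simp only [Category.assoc]
    rw [← h]
    simp only [Scheme.Opens.topIso_inv, Scheme.Opens.ι_appTop]
    rfl
  have h3 := ConcreteCategory.congr_hom h2 c
  have h4 := ConcreteCategory.congr_hom (ι.naturality (homOfLE (le_top :
    Proj.basicOpen (MvPolynomial.homogeneousSubmodule (Fin (N + 1)) k) f ≤ ⊤)).op)
      ((projSpaceToSpec k N).appTop ((Scheme.ΓSpecIso (CommRingCat.of k)).inv c))
  have h5 := (congrArg (ι.app _) h3).symm.trans h4
  rw [← X.presheaf.germ_res_apply (homOfLE le_top) x hx]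
  refine congrArg (X.presheaf.germ _ x hx) (Eq.trans ?_ h5.symm)
  simp [constants]
  rfl

end Charts

end BigDivisor

end

/-! ### Homogeneous coordinates in the function field. -/

noncomputable section

open AlgebraicGeometry CategoryTheory

namespace BigDivisor

attribute [local instance] MvPolynomial.gradedAlgebra

/-- A domain is the intersection of its localizations at primes, and on an affine open these
localizations are the stalks. -/
lemma exists_section_of_forall_mem_range {X : Scheme.{u}} [IsIntegral X] {U : X.Opens}
    (hU : IsAffineOpen U) (hη : genericPoint X ∈ U) (f : X.functionField)
    (hf : ∀ x ∈ U, f ∈ (algebraMap (X.presheaf.stalk x) X.functionField).range) :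
    ∃ s : Γ(X, U), X.presheaf.germ U (genericPoint X) hη s = f := by
  have : Nonempty U := ⟨⟨_, hη⟩⟩
  have := functionField_isFractionRing_of_isAffineOpen X U hU
  have h1 : f ∈ (⊥ : Subalgebra Γ(X, U) X.functionField) := by
    rw [← PrimeSpectrum.iInf_localization_eq_bot, Algebra.mem_iInf]
    intro v
    let x := hU.fromSpec v
    have hx : x ∈ U := by
      have := hU.range_fromSpec
      have h : x ∈ Set.range hU.fromSpec := ⟨v, rfl⟩
      rwa [this] at h
    obtain ⟨t, ht⟩ := hf x hx
    let _ := TopCat.Presheaf.algebra_section_stalk X.presheaf (⟨x, hx⟩ : U)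
    have hloc : IsLocalization.AtPrime (X.presheaf.stalk x) v.asIdeal := hU.isLocalization_stalk' v hx
    obtain ⟨⟨a, s⟩, has⟩ := IsLocalization.surj v.asIdeal.primeCompl t
    have := functionField_isScalarTower X U ⟨x, hx⟩
    have h2 := congrArg (algebraMap (X.presheaf.stalk x) X.functionField) has
    rw [map_mul, ht, ← IsScalarTower.algebraMap_apply Γ(X, U) (X.presheaf.stalk x) X.functionField,
      ← IsScalarTower.algebraMap_apply Γ(X, U) (X.presheaf.stalk x) X.functionField] at h2
    have hs : algebraMap Γ(X, U) X.functionField s ≠ 0 := by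
      rw [Ne, IsFractionRing.to_map_eq_zero_iff]
      intro h
      exact s.2 (h ▸ zero_mem _)
    refine ⟨a, s, s.2, ?_⟩
    rw [← h2, mul_assoc, mul_inv_cancel₀ hs, mul_one]
  obtain ⟨s, hs⟩ := Algebra.mem_bot.mp h1
  exact ⟨s, hs⟩

/-- Homogeneous coordinates in the function field of a projective variety, relative to a chart:
on the charts `U i` covering `X` the functions `y j / y i` are regular and generate the ring of
regular functions. -/
structure Coordinates {k : Type u} [Field k] {X : Scheme.{u}} [IsIntegral X]
    (π : X ⟶ Spec (CommRingCat.of k)) (N : ℕ) where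
  /-- the coordinate functions -/
  y : Fin (N + 1) → X.functionField
  /-- the charts -/
  U : Fin (N + 1) → X.Opens
  compactSpace : CompactSpace X
  exists_eq_one : ∃ i, y i = 1
  exists_mem : ∀ x, ∃ i, x ∈ U i
  ne_zero_of_mem : ∀ i, ∀ x ∈ U i, y i ≠ 0
  regular : ∀ i, ∀ x ∈ U i, ∀ j, y j / y i ∈ (algebraMap (X.presheaf.stalk x) X.functionField).range
  mem_adjoin : letI := functionFieldAlgebra π
    ∀ i, y i ≠ 0 → ∀ f : X.functionField,
      (∀ x ∈ U i, f ∈ (algebraMap (X.presheaf.stalk x) X.functionField).range) →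
      f ∈ Algebra.adjoin k (Set.range fun j => y j / y i)
  exists_div : letI := functionFieldAlgebra π
    ∀ i, y i ≠ 0 → ∀ f : X.functionField, ∃ a ∈ Algebra.adjoin k (Set.range fun j => y j / y i),
      ∃ b ∈ Algebra.adjoin k (Set.range fun j => y j / y i), b ≠ 0 ∧ f = a / b

section
variable {k : Type u} [Field k] {N : ℕ} {X : Scheme.{u}} [IsIntegral X] (ι : X ⟶ projSpace k N)

lemma genericPoint_mem_of_mem {U : X.Opens} {x : X} (hx : x ∈ U) : genericPoint X ∈ U :=
  ((genericPoint_spec X).mem_open_set_iff U.isOpen).mpr ⟨x, trivial, hx⟩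

/-- The image of `x_j / x_i` in the function field (zero if the chart is empty). -/
def chartCoord (i j : Fin (N + 1)) (hi : genericPoint X ∈ chart ι i) : X.functionField :=
  X.presheaf.germ _ _ hi (awayToChart ι (MvPolynomial.X i) (affCoord i j))

lemma chartCoord_mul (i j l : Fin (N + 1)) (hi : genericPoint X ∈ chart ι i)
    (hj : genericPoint X ∈ chart ι j) :
    chartCoord ι i l hi * chartCoord ι j i hj = chartCoord ι j l hj := by
  have hij : genericPoint X ∈ ι ⁻¹ᵁ Proj.basicOpen
      (MvPolynomial.homogeneousSubmodule (Fin (N + 1)) k) (MvPolynomial.X i * MvPolynomial.X j) := by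
    rw [Proj.basicOpen_mul]
    exact ⟨hi, hj⟩
  have h := awayMap_affCoord_mul (k := k) i j l
  have h' := congrArg (fun a => X.presheaf.germ _ _ hij (awayToChart ι _ a)) h
  simp only [map_mul] at h'
  rw [germ_awayToChart_awayMap ι _ _ _ _ _ _ hi, germ_awayToChart_awayMap ι _ _ _ _ _ _ hj,
    germ_awayToChart_awayMap ι _ _ _ _ _ _ hj] at h'
  exact h'

lemma chartCoord_self (i : Fin (N + 1)) (hi : genericPoint X ∈ chart ι i) :
    chartCoord ι i i hi = 1 := by
  have h : (affCoord i i : HomogeneousLocalization.Away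
      (MvPolynomial.homogeneousSubmodule (Fin (N + 1)) k) (MvPolynomial.X i)) = 1 := by
    apply HomogeneousLocalization.val_injective
    rw [affCoord, HomogeneousLocalization.Away.val_mk, HomogeneousLocalization.val_one,
      ← Localization.mk_one, Localization.mk_eq_mk_iff, Localization.r_iff_exists]
    exact ⟨1, by simp⟩
  rw [chartCoord, h, map_one]
  exact map_one (X.presheaf.germ _ _ hi).hom

lemma genericPoint_mem_chart_of_ne_zero (i j : Fin (N + 1)) (hi : genericPoint X ∈ chart ι i)
    (h : chartCoord ι i j hi ≠ 0) : genericPoint X ∈ chart ι j := by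
  refine mem_basicOpen_of_mem_basicOpen_awayToSection i j (ι (genericPoint X)) ?_
  have h1 : genericPoint X ∈ X.basicOpen (ι.app _ (Proj.awayToSection
      (MvPolynomial.homogeneousSubmodule (Fin (N + 1)) k) (MvPolynomial.X i) (affCoord i j))) := by
    exact (Scheme.mem_basicOpen _ _ _ hi).mpr (isUnit_iff_ne_zero.mpr h)
  rwa [← Scheme.preimage_basicOpen] at h1

lemma germ_awayToChart_mem_adjoin (i : Fin (N + 1)) (hi : genericPoint X ∈ chart ι i)
    (a : HomogeneousLocalization.Away
      (MvPolynomial.homogeneousSubmodule (Fin (N + 1)) k) (MvPolynomial.X i)) :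
    letI := functionFieldAlgebra (ι ≫ projSpaceToSpec k N)
    X.presheaf.germ _ _ hi (awayToChart ι (MvPolynomial.X i) a) ∈
      Algebra.adjoin k (Set.range fun j => chartCoord ι i j hi) := by
  let _ := functionFieldAlgebra (ι ≫ projSpaceToSpec k N)
  obtain ⟨n, b, hb, rfl⟩ := HomogeneousLocalization.Away.mk_surjective _
    (X_mem_homogeneousSubmodule i) a
  rw [away_mk_eq_eval₂]
  have h1 : X.presheaf.germ _ _ hi (awayToChart ι (MvPolynomial.X i)
      (MvPolynomial.eval₂ (homLocConst k N _) (affCoord i) b)) =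
      MvPolynomial.aeval (fun j => chartCoord ι i j hi) b := by
    change ((X.presheaf.germ _ _ hi).hom.comp (awayToChart ι (MvPolynomial.X i))) _ = _
    rw [MvPolynomial.hom_eval₂, MvPolynomial.aeval_def]
    congr 1
    ext c
    exact (constants_res ι (MvPolynomial.X i) (X_mem_homogeneousSubmodule i) c _ hi).symm
  rw [h1, Algebra.adjoin_range_eq_range_aeval]
  exact ⟨b, rfl⟩

/-- The coordinates are `x_j / x_{i₀}`, where `i₀` is a chart containing the generic point. Since
the immersion is closed, every regular function on a chart is the restriction of a function on the
chart of projective space, hence a polynomial in the affine coordinates. -/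
theorem exists_coordinates {π : X ⟶ Spec (CommRingCat.of k)} (hπ : IsProjectiveOver π) :
    ∃ N, Nonempty (Coordinates π N) := by
  obtain ⟨N, ι, hι, rfl⟩ := hπ
  obtain ⟨i₀, hi₀⟩ := exists_mem_chart ι (genericPoint X)
  have hdiv : ∀ i j (hi : genericPoint X ∈ chart ι i),
      chartCoord ι i₀ j hi₀ / chartCoord ι i₀ i hi₀ = chartCoord ι i j hi := by
    intro i j hi
    have h1 := chartCoord_mul ι i i₀ j hi hi₀
    have h2 := chartCoord_mul ι i i₀ i₀ hi hi₀
    rw [chartCoord_self] at h2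
    rw [div_eq_iff (right_ne_zero_of_mul_eq_one h2), h1]
  have hmem : ∀ i, chartCoord ι i₀ i hi₀ ≠ 0 → genericPoint X ∈ chart ι i := fun i hi =>
    genericPoint_mem_chart_of_ne_zero ι i₀ i hi₀ hi
  have haff : ∀ i, IsAffineOpen (chart ι i) := fun i =>
    (Proj.isAffineOpen_basicOpen (MvPolynomial.homogeneousSubmodule (Fin (N + 1)) k)
      (MvPolynomial.X i) (X_mem_homogeneousSubmodule i) one_pos).preimage ι
  have hsec : letI := functionFieldAlgebra (ι ≫ projSpaceToSpec k N)
      ∀ i (hi : genericPoint X ∈ chart ι i) (s : Γ(X, chart ι i)),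
      X.presheaf.germ _ _ hi s ∈
        Algebra.adjoin k (Set.range fun j => chartCoord ι i₀ j hi₀ / chartCoord ι i₀ i hi₀) := by
    intro i hi s
    obtain ⟨a, rfl⟩ := awayToChart_surjective ι i s
    simp_rw [hdiv i _ hi]
    exact germ_awayToChart_mem_adjoin ι i hi a
  refine ⟨N, ⟨{
    y := fun j => chartCoord ι i₀ j hi₀
    U := chart ι
    compactSpace := ⟨?_⟩
    exists_eq_one := ⟨i₀, chartCoord_self ι i₀ hi₀⟩
    exists_mem := exists_mem_chart ι
    ne_zero_of_mem := fun i x hx => ?_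
    regular := fun i x hx j => ?_
    mem_adjoin := fun i hi f hf => ?_
    exists_div := fun i hi f => ?_ }⟩⟩
  · have h : (Set.univ : Set X) = ⋃ i, (chart ι i : Set X) :=
      (Set.eq_univ_of_forall fun x => Set.mem_iUnion.mpr (exists_mem_chart ι x)).symm
    rw [h]
    exact isCompact_iUnion fun i => (haff i).isCompact
  · have h2 := chartCoord_mul ι i i₀ i₀ (genericPoint_mem_of_mem hx) hi₀
    rw [chartCoord_self] at h2
    exact right_ne_zero_of_mul_eq_one h2
  · rw [hdiv i j (genericPoint_mem_of_mem hx)]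
    have : Nonempty (chart ι i) := ⟨⟨x, hx⟩⟩
    exact ⟨_, Scheme.algebraMap_germ_eq_germToFunctionField X hx _⟩
  · obtain ⟨s, rfl⟩ := exists_section_of_forall_mem_range (haff i) (hmem i hi) f hf
    exact hsec i (hmem i hi) s
  · have : Nonempty (chart ι i) := ⟨⟨_, hmem i hi⟩⟩
    have := functionField_isFractionRing_of_isAffineOpen X _ (haff i)
    obtain ⟨a, b, hb, rfl⟩ := IsFractionRing.div_surjective (A := Γ(X, chart ι i)) f
    refine ⟨_, hsec i (hmem i hi) a, _, hsec i (hmem i hi) b, ?_, rfl⟩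
    exact IsFractionRing.to_map_ne_zero_of_mem_nonZeroDivisors hb

end

end BigDivisor

end

/-! ### Sections of divisors and their embedding in saturated powers. -/

noncomputable section

open AlgebraicGeometry CategoryTheory

namespace BigDivisor

section
variable {k : Type u} [Field k] {X : Scheme.{u}} [IsIntegral X]

lemma exists_isLocalEquation (D : CartierDivisor X) (x : X) : ∃ d, IsLocalEquation D x d := by
  obtain ⟨U, hU, d, hd⟩ := D.toMul.2 x
  exact ⟨d, hd x hU⟩

lemma IsLocalEquation.add {D E : CartierDivisor X} {x : X} {d e : (X.functionField)ˣ}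
    (hd : IsLocalEquation D x d) (he : IsLocalEquation E x e) :
    IsLocalEquation (D + E) x (d * e) := by
  unfold IsLocalEquation at *
  rw [QuotientGroup.mk_mul, ← hd, ← he]
  rfl

lemma isLocalEquation_zero (x : X) : IsLocalEquation (0 : CartierDivisor X) x 1 := rfl

lemma IsLocalEquation.nsmul {D : CartierDivisor X} {x : X} {d : (X.functionField)ˣ}
    (hd : IsLocalEquation D x d) (m : ℕ) : IsLocalEquation (m • D) x (d ^ m) := by
  induction m with
  | zero => simpa using isLocalEquation_zero x
  | succ m ih =>
    rw [succ_nsmul, pow_succ]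
    exact ih.add hd

lemma IsLocalEquation.mul_mem_range_iff {D : CartierDivisor X} {x : X} {d e : (X.functionField)ˣ}
    (hd : IsLocalEquation D x d) (he : IsLocalEquation D x e) (f : X.functionField)
    (hf : f * d ∈ (algebraMap (X.presheaf.stalk x) X.functionField).range) :
    f * e ∈ (algebraMap (X.presheaf.stalk x) X.functionField).range := by
  have h := hd.symm.trans he
  rw [QuotientGroup.eq] at h
  obtain ⟨v, hv⟩ := h
  have : (e : X.functionField) = d * algebraMap (X.presheaf.stalk x) X.functionField v := by
    have h1 : e = d * (d⁻¹ * e) := by group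
    rw [h1, ← hv]
    rfl
  rw [this, ← mul_assoc]
  exact mul_mem hf ⟨v, rfl⟩

variable (π : X ⟶ Spec (CommRingCat.of k))

lemma mem_sections_iff {D : CartierDivisor X} {f : X.functionField} :
    f ∈ sections π D ↔ ∀ x d, IsLocalEquation D x d →
      f * d ∈ (algebraMap (X.presheaf.stalk x) X.functionField).range := Iff.rfl

lemma mul_mem_sections {D E : CartierDivisor X} {f g : X.functionField} (hf : f ∈ sections π D)
    (hg : g ∈ sections π E) : f * g ∈ sections π (D + E) := by
  rw [mem_sections_iff] at *
  intro x e he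
  obtain ⟨d₁, h₁⟩ := exists_isLocalEquation D x
  obtain ⟨d₂, h₂⟩ := exists_isLocalEquation E x
  refine (h₁.add h₂).mul_mem_range_iff he _ ?_
  rw [Units.val_mul, mul_mul_mul_comm]
  exact mul_mem (hf x d₁ h₁) (hg x d₂ h₂)

lemma one_mem_sections_zero : (1 : X.functionField) ∈ sections π (0 : CartierDivisor X) := by
  rw [mem_sections_iff]
  intro x d hd
  refine (isLocalEquation_zero x).mul_mem_range_iff hd _ ?_
  exact ⟨1, by simp⟩

end

namespace Coordinates
variable {k : Type u} [Field k] {X : Scheme.{u}} [IsIntegral X]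
  {π : X ⟶ Spec (CommRingCat.of k)} {N : ℕ} (c : Coordinates π N)

/-- The linear span of the coordinates. -/
def span : @Submodule k X.functionField _ _ (functionFieldAlgebra π).toModule :=
  letI := functionFieldAlgebra π
  Submodule.span k (Set.range c.y)

lemma y_mem (i : Fin (N + 1)) : c.y i ∈ c.span := by
  let _ := functionFieldAlgebra π
  exact Submodule.subset_span ⟨i, rfl⟩

lemma one_mem : (1 : X.functionField) ∈ c.span := by
  obtain ⟨i, hi⟩ := c.exists_eq_one
  exact hi ▸ c.y_mem i

lemma isFractionGenerating : letI := functionFieldAlgebra π; IsFractionGenerating c.span := by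
  let _ := functionFieldAlgebra π
  intro f
  obtain ⟨i, hi⟩ := c.exists_eq_one
  have hi0 : c.y i ≠ 0 := by rw [hi]; exact one_ne_zero
  obtain ⟨a, ha, b, hb, hb0, rfl⟩ := c.exists_div i hi0 f
  obtain ⟨M, hM⟩ := exists_mul_pow_mem_of_mem_adjoin c.y_mem (c.y_mem i) hi0 ha
  obtain ⟨M', hM'⟩ := exists_mul_pow_mem_of_mem_adjoin c.y_mem (c.y_mem i) hi0 hb
  rw [hi, one_pow, mul_one] at hM hM'
  exact ⟨max M M', a, pow_le_pow_of_one_mem c.one_mem (le_max_left _ _) hM, b,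
    pow_le_pow_of_one_mem c.one_mem (le_max_right _ _) hM', hb0, rfl⟩

lemma div_pow_mem_range {i : Fin (N + 1)} {x : X} (hx : x ∈ c.U i) {e : ℕ} {g : X.functionField} :
    letI := functionFieldAlgebra π
    g ∈ c.span ^ e → g / c.y i ^ e ∈ (algebraMap (X.presheaf.stalk x) X.functionField).range := by
  let _ := functionFieldAlgebra π
  intro hg
  have hg' := span_range_pow_le c.y e hg
  clear hg
  induction hg' using Submodule.span_induction with
  | zero => rw [zero_div]; exact zero_mem _
  | add a b _ _ ha hb => rw [add_div]; exact add_mem ha hb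
  | smul r a _ ha =>
    rw [smul_div_assoc, Algebra.smul_def]
    refine mul_mem ⟨X.presheaf.germ ⊤ x trivial (constants π r), ?_⟩ ha
    have : Nonempty (⊤ : X.Opens) := ⟨⟨genericPoint X, trivial⟩⟩
    exact Scheme.algebraMap_germ_eq_germToFunctionField X (U := ⊤) (x := x) trivial (constants π r)
  | mem a ha =>
    obtain ⟨d, hd, rfl⟩ := ha
    rw [← hd, ← Finset.prod_pow_eq_pow_sum, ← Finset.prod_div_distrib]
    refine prod_mem fun j _ => ?_
    rw [← div_pow]
    exact pow_mem (c.regular i x hx j) _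

/-- This replaces an embedding of `𝒪(D)` in `𝒪(e)`. By compactness finitely many local equations `d`
of `D` suffice; a common denominator `h` of their inverses makes `h * d⁻¹` a form of degree `e`. On
the chart of `y i` the function `f h ^ m / y i ^ (e * m) = (f d ^ m) (h d⁻¹ / y i ^ e) ^ m` is then
regular, hence a polynomial in the `y j / y i`. -/
lemma exists_mul_pow_mem_satPow (D : CartierDivisor X) :
    letI := functionFieldAlgebra π
    ∃ e, ∃ h : X.functionField, h ≠ 0 ∧
      ∀ m : ℕ, ∀ f ∈ sections π (m • D), f * h ^ m ∈ satPow c.span (e * m) := by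
  let _ := functionFieldAlgebra π
  have := c.compactSpace
  choose V hV d hd using D.toMul.2
  obtain ⟨t, ht⟩ := isCompact_univ.elim_finite_subcover (fun x => (V x : Set X))
    (fun x => (V x).isOpen) (fun x _ => Set.mem_iUnion.mpr ⟨x, hV x⟩)
  classical
  obtain ⟨e, h, he, h0, hs⟩ := c.isFractionGenerating.exists_common_denominator
    (t.image fun x => (((d x)⁻¹ : (X.functionField)ˣ) : X.functionField))
  refine ⟨e, h, h0, fun m f hf => ?_⟩
  refine mem_satPow_of_forall (y := c.y) rfl fun i hi => ?_
  have key : f * h ^ m / c.y i ^ (e * m) ∈ Algebra.adjoin k (Set.range fun j => c.y j / c.y i) := by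
    refine c.mem_adjoin i hi _ fun x hx => ?_
    obtain ⟨z, hz, hxz⟩ := Set.mem_iUnion₂.mp (ht (Set.mem_univ x))
    have hloc : IsLocalEquation D x (d z) := hd z x hxz
    have h1 := mem_sections_iff π |>.mp hf x _ (hloc.nsmul m)
    have h2 := c.div_pow_mem_range hx (hs _ (Finset.mem_image_of_mem _ hz))
    have h3 := mul_mem h1 (pow_mem h2 m)
    convert h3 using 1
    have : (d z : X.functionField) ≠ 0 := (d z).ne_zero
    rw [Units.val_pow_eq_pow_val, Units.val_inv_eq_inv_val, div_pow, mul_pow, inv_pow, pow_mul]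
    have h5 := pow_ne_zero m this
    generalize (d z : X.functionField) ^ m = w at h5 ⊢
    field_simp
  obtain ⟨M, hM⟩ := exists_mul_pow_mem_of_mem_adjoin c.y_mem (c.y_mem i) hi key
  refine ⟨M, ?_⟩
  have h4 := Submodule.mul_mem_mul (Submodule.pow_mem_pow _ (c.y_mem i) (e * m)) hM
  rw [← pow_add] at h4
  rwa [← mul_assoc, mul_div_cancel₀ _ (pow_ne_zero _ hi)] at h4

end Coordinates

end BigDivisor

end

/-! ### A one-variable discrete Borell-Brascamp-Lieb inequality. -/

section

namespace BigDivisor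

/-- The function `(a ^ (1 / d) + b ^ (1 / d)) ^ d`, with value `max a b` for `d = 0`. -/
noncomputable def bmFun : ℕ → ℝ → ℝ → ℝ
  | 0, a, b => max a b
  | d + 1, a, b => (a ^ (1 / ((d : ℝ) + 1)) + b ^ (1 / ((d : ℝ) + 1))) ^ (d + 1)

lemma bmFun_mono (d : ℕ) {a a' b b' : ℝ} (ha : 0 ≤ a) (hb : 0 ≤ b) (haa : a ≤ a') (hbb : b ≤ b') :
    bmFun d a b ≤ bmFun d a' b' := by
  cases d with
  | zero => exact max_le_max haa hbb
  | succ d => simp only [bmFun]; gcongr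

lemma bmFun_pos (d : ℕ) {a b : ℝ} (ha : 0 < a) (hb : 0 < b) : 0 < bmFun d a b := by
  cases d with
  | zero => exact lt_max_of_lt_left ha
  | succ d => simp only [bmFun]; positivity

lemma bmFun_smul (d : ℕ) {s a b : ℝ} (hs : 0 ≤ s) (ha : 0 ≤ a) (hb : 0 ≤ b) :
    bmFun d (s * a) (s * b) = s * bmFun d a b := by
  cases d with
  | zero => exact (mul_max_of_nonneg _ _ hs).symm
  | succ d =>
    simp only [bmFun]
    rw [Real.mul_rpow hs ha, Real.mul_rpow hs hb, ← mul_add, mul_pow, ← Real.rpow_natCast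
      (s ^ (1 / ((d : ℝ) + 1))), ← Real.rpow_mul hs]
    congr 1
    push_cast
    rw [one_div_mul_cancel (by positivity), Real.rpow_one]

/-- For `d > 0` this is Hölder's inequality for two-term sums with exponents `(d + 1) / d` and `d +
1`, raised to the power `d + 1`. In the application `x`, `y` are the maxima of two functions and
`A`, `B` their sums. -/
lemma bmFun_succ_le (d : ℕ) {x y A B : ℝ} (hx : 0 < x) (hy : 0 < y) (hA : 0 ≤ A) (hB : 0 ≤ B) :
    bmFun (d + 1) A B ≤ bmFun d x y * (A / x + B / y) := by
  cases d with
  | zero =>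
    simp only [bmFun]
    have h1 : A ≤ max x y * (A / x) := by
      calc A = x * (A / x) := by field_simp
        _ ≤ _ := by gcongr; exact le_max_left _ _
    have h2 : B ≤ max x y * (B / y) := by
      calc B = y * (B / y) := by field_simp
        _ ≤ _ := by gcongr; exact le_max_right _ _
    norm_num
    linarith
  | succ d =>
    have hd : (0 : ℝ) < d + 1 := by positivity
    have hd2 : (0 : ℝ) < d + 1 + 1 := by positivity
    have hpq : Real.HolderConjugate (((d : ℝ) + 1 + 1) / (d + 1)) (d + 1 + 1) := by
      rw [Real.holderConjugate_iff]
      constructor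
      · rw [one_lt_div hd]; linarith
      · field_simp
    have H := Real.inner_le_Lp_mul_Lq_of_nonneg (Finset.univ : Finset (Fin 2)) hpq
      (f := ![x ^ (1 / ((d : ℝ) + 1 + 1)), y ^ (1 / ((d : ℝ) + 1 + 1))])
      (g := ![(A / x) ^ (1 / ((d : ℝ) + 1 + 1)), (B / y) ^ (1 / ((d : ℝ) + 1 + 1))])
      (by intro i _; fin_cases i <;> simp <;> positivity)
      (by intro i _; fin_cases i <;> simp <;> positivity)
    simp only [Fin.sum_univ_two, Matrix.cons_val_zero, Matrix.cons_val_one] at H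
    have e1 : ∀ z w : ℝ, 0 < z → 0 ≤ w → z ^ (1 / ((d : ℝ) + 1 + 1)) * (w / z) ^ (1 / ((d : ℝ) + 1 + 1)) =
        w ^ (1 / ((d : ℝ) + 1 + 1)) := by
      intro z w hz hw
      rw [← Real.mul_rpow hz.le (by positivity), mul_div_cancel₀ _ hz.ne']
    have e2 : ∀ z : ℝ, 0 < z → (z ^ (1 / ((d : ℝ) + 1 + 1))) ^ (((d : ℝ) + 1 + 1) / (d + 1)) =
        z ^ (1 / ((d : ℝ) + 1)) := by
      intro z hz
      rw [← Real.rpow_mul hz.le]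
      congr 1
      field_simp
    have e3 : ∀ z : ℝ, 0 ≤ z → (z ^ (1 / ((d : ℝ) + 1 + 1))) ^ ((d : ℝ) + 1 + 1) = z := by
      intro z hz
      rw [← Real.rpow_mul hz, one_div_mul_cancel hd2.ne', Real.rpow_one]
    rw [e1 _ _ hx hA, e1 _ _ hy hB, e2 _ hx, e2 _ hy, e3 _ (by positivity), e3 _ (by positivity)] at H
    simp only [bmFun]
    push_cast
    have hS : 0 ≤ x ^ (1 / ((d : ℝ) + 1)) + y ^ (1 / ((d : ℝ) + 1)) := by positivity
    have hT : 0 ≤ A / x + B / y := by positivity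
    calc _ ≤ ((x ^ (1 / ((d : ℝ) + 1)) + y ^ (1 / ((d : ℝ) + 1))) ^ (1 / (((d : ℝ) + 1 + 1) / (d + 1))) *
          (A / x + B / y) ^ (1 / ((d : ℝ) + 1 + 1))) ^ (d + 1 + 1) := by gcongr
      _ = _ := by
        rw [mul_pow, ← Real.rpow_natCast, ← Real.rpow_natCast (_ ^ (1 / ((d : ℝ) + 1 + 1))),
          ← Real.rpow_mul hS, ← Real.rpow_mul hT, ← Real.rpow_natCast _ (d + 1)]
        congr 2
        · push_cast; field_simp
        · push_cast; 
          rw [one_div_mul_cancel hd2.ne', Real.rpow_one]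

open MeasureTheory in
-- Layer-cake formula: the positive part of `min (u i) 1` is the length of the set of levels `σ` in
-- `(0, 1]` with `σ ≤ u i`.
lemma sum_ofReal_min_one {s : Finset ℤ} {u : ℤ → ℝ} :
    ∑ i ∈ s, ENNReal.ofReal (min (u i) 1) =
      ∫⁻ σ in Set.Ioc (0 : ℝ) 1, ((s.filter fun i => σ ≤ u i).card : ENNReal) := by
  have h : ∀ i, ENNReal.ofReal (min (u i) 1) =
      ∫⁻ σ in Set.Ioc (0 : ℝ) 1, (Set.Iic (u i)).indicator 1 σ := by
    intro i
    rw [lintegral_indicator_one measurableSet_Iic, Measure.restrict_apply measurableSet_Iic,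
      Set.inter_comm, Set.Ioc_inter_Iic, Real.volume_Ioc, sub_zero, min_comm]
  simp_rw [h]
  rw [← lintegral_finsetSum _ fun i _ => measurable_one.indicator measurableSet_Iic]
  refine lintegral_congr fun σ => ?_
  rw [Finset.card_filter]
  push_cast
  exact Finset.sum_congr rfl fun i _ => by simp [Set.indicator_apply]

open Pointwise in
-- Cauchy-Davenport in `ℤ` applied twice: adding `{0, 1}` to `A + B` recovers the `1` lost in `|A +
-- B| ≥ |A| + |B| - 1`.
lemma card_add_card_le_of_subset {A B C : Finset ℤ} (hA : A.Nonempty) (hB : B.Nonempty)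
    (h : ∀ i ∈ A, ∀ j ∈ B, i + j ∈ C ∧ i + j + 1 ∈ C) : A.card + B.card ≤ C.card := by
  have h1 := cauchy_davenport_add_of_linearOrder_isCancelAdd hA hB
  have h2 := cauchy_davenport_add_of_linearOrder_isCancelAdd (hA.add hB)
    (⟨0, by simp⟩ : ({0, 1} : Finset ℤ).Nonempty)
  have h3 : (A + B + {0, 1} : Finset ℤ) ⊆ C := by
    intro x hx
    obtain ⟨y, hy, e, he, rfl⟩ := Finset.mem_add.mp hx
    obtain ⟨i, hi, j, hj, rfl⟩ := Finset.mem_add.mp hy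
    rcases Finset.mem_insert.mp he with rfl | he
    · simpa using (h i hi j hj).1
    · rw [Finset.mem_singleton] at he
      subst he
      exact (h i hi j hj).2
  have h4 := Finset.card_le_card h3
  have h5 : ({0, 1} : Finset ℤ).card = 2 := rfl
  have := hA.card_pos
  have := hB.card_pos
  omega

/-- A one-variable discrete inequality of Borell-Brascamp-Lieb type. -/
theorem bmFun_succ_sum_le (d : ℕ) {s t u : Finset ℤ} {a b c : ℤ → ℝ} (ha : ∀ i, 0 ≤ a i)
    (hb : ∀ i, 0 ≤ b i) (hc : ∀ i, 0 ≤ c i) (ha0 : ∃ i ∈ s, 0 < a i) (hb0 : ∃ i ∈ t, 0 < b i)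
    (h : ∀ i ∈ s, ∀ j ∈ t, 0 < a i → 0 < b j → i + j ∈ u ∧ i + j + 1 ∈ u ∧
      bmFun d (a i) (b j) ≤ c (i + j) ∧ bmFun d (a i) (b j) ≤ c (i + j + 1)) :
    bmFun (d + 1) (∑ i ∈ s, a i) (∑ i ∈ t, b i) ≤ ∑ i ∈ u, c i := by
  obtain ⟨i₁, hi₁, hpos₁⟩ := ha0
  obtain ⟨j₁, hj₁, hpos₂⟩ := hb0
  -- Normalizing each function by its own maximum makes both superlevel sets nonempty at every
  -- relative level `σ ≤ 1`, as Cauchy-Davenport requires.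
  obtain ⟨i₀, hi₀, hmax₁⟩ := s.exists_max_image a ⟨i₁, hi₁⟩
  obtain ⟨j₀, hj₀, hmax₂⟩ := t.exists_max_image b ⟨j₁, hj₁⟩
  have hx : 0 < a i₀ := hpos₁.trans_le (hmax₁ _ hi₁)
  have hy : 0 < b j₀ := hpos₂.trans_le (hmax₂ _ hj₁)
  have hΦ := bmFun_pos d hx hy
  -- The superlevel sets are compared at equal relative height `σ`; homogeneity of `bmFun` transfers
  -- the hypothesis to that height. Truncating at `1` changes nothing on the left and only loses
  -- mass on the right.
  have key : ∑ i ∈ s, ENNReal.ofReal (min (a i / a i₀) 1) +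
      ∑ i ∈ t, ENNReal.ofReal (min (b i / b j₀) 1) ≤
      ∑ i ∈ u, ENNReal.ofReal (min (c i / bmFun d (a i₀) (b j₀)) 1) := by
    rw [sum_ofReal_min_one, sum_ofReal_min_one, sum_ofReal_min_one]
    refine (MeasureTheory.le_lintegral_add _ _).trans ?_
    refine MeasureTheory.setLIntegral_mono' measurableSet_Ioc fun σ hσ => ?_
    norm_cast
    refine card_add_card_le_of_subset ⟨i₀, ?_⟩ ⟨j₀, ?_⟩ fun i hi j hj => ?_
    · simp [hi₀, div_self hx.ne', hσ.2]
    · simp [hj₀, div_self hy.ne', hσ.2]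
    · simp only [Finset.mem_filter, le_div_iff₀ hx, le_div_iff₀ hy, le_div_iff₀ hΦ] at hi hj ⊢
      obtain ⟨h1, h2, h3, h4⟩ := h i hi.1 j hj.1 ((mul_pos hσ.1 hx).trans_le hi.2)
        ((mul_pos hσ.1 hy).trans_le hj.2)
      have h5 : σ * bmFun d (a i₀) (b j₀) ≤ bmFun d (a i) (b j) := by
        rw [← bmFun_smul d hσ.1.le hx.le hy.le]
        exact bmFun_mono d (mul_pos hσ.1 hx).le (mul_pos hσ.1 hy).le hi.2 hj.2
      exact ⟨⟨h1, h5.trans h3⟩, h2, h5.trans h4⟩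
  have hsum : ∀ (w : Finset ℤ) (f : ℤ → ℝ), (∀ i, 0 ≤ f i) →
      ∑ i ∈ w, ENNReal.ofReal (f i) = ENNReal.ofReal (∑ i ∈ w, f i) := fun w f hf =>
    (ENNReal.ofReal_sum_of_nonneg fun i _ => hf i).symm
  rw [hsum _ _ fun i => le_min (div_nonneg (ha i) hx.le) zero_le_one,
    hsum _ _ fun i => le_min (div_nonneg (hb i) hy.le) zero_le_one,
    hsum _ _ fun i => le_min (div_nonneg (hc i) hΦ.le) zero_le_one,
    ← ENNReal.ofReal_add (Finset.sum_nonneg fun i _ => le_min (div_nonneg (ha i) hx.le) zero_le_one)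
      (Finset.sum_nonneg fun i _ => le_min (div_nonneg (hb i) hy.le) zero_le_one),
    ENNReal.ofReal_le_ofReal_iff
      (Finset.sum_nonneg fun i _ => le_min (div_nonneg (hc i) hΦ.le) zero_le_one)] at key
  have e1 : ∑ i ∈ s, min (a i / a i₀) 1 = (∑ i ∈ s, a i) / a i₀ := by
    rw [Finset.sum_div]
    exact Finset.sum_congr rfl fun i hi => min_eq_left ((div_le_one hx).mpr (hmax₁ i hi))
  have e2 : ∑ i ∈ t, min (b i / b j₀) 1 = (∑ i ∈ t, b i) / b j₀ := by
    rw [Finset.sum_div]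
    exact Finset.sum_congr rfl fun i hi => min_eq_left ((div_le_one hy).mpr (hmax₂ i hi))
  have e3 : ∑ i ∈ u, min (c i / bmFun d (a i₀) (b j₀)) 1 ≤
      (∑ i ∈ u, c i) / bmFun d (a i₀) (b j₀) := by
    rw [Finset.sum_div]
    exact Finset.sum_le_sum fun i _ => min_le_left _ _
  rw [e1, e2] at key
  calc _ ≤ bmFun d (a i₀) (b j₀) * ((∑ i ∈ s, a i) / a i₀ + (∑ i ∈ t, b i) / b j₀) :=
        bmFun_succ_le d hx hy (Finset.sum_nonneg fun i _ => ha i) (Finset.sum_nonneg fun i _ => hb i)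
    _ ≤ bmFun d (a i₀) (b j₀) * ((∑ i ∈ u, c i) / bmFun d (a i₀) (b j₀)) := by
        gcongr
        exact key.trans e3
    _ = _ := mul_div_cancel₀ _ hΦ.ne'

end BigDivisor

end

/-! ### The linear Brunn-Minkowski property and its lifting along a discrete place. -/

section

namespace BigDivisor

section Products
variable {k K : Type*} [Field k] [CommRing K] [Algebra k K]

instance finiteDimensional_mul (V W : Submodule k K) [hV : FiniteDimensional k V]
    [hW : FiniteDimensional k W] : FiniteDimensional k (V * W : Submodule k K) :=
  Module.Finite.iff_fg.mpr ((Module.Finite.iff_fg.mp hV).mul (Module.Finite.iff_fg.mp hW))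

instance finiteDimensional_pow (V : Submodule k K) [hV : FiniteDimensional k V] (n : ℕ) :
    FiniteDimensional k (V ^ n : Submodule k K) :=
  Module.Finite.iff_fg.mpr ((Module.Finite.iff_fg.mp hV).pow n)

end Products

/-- The linear Brunn-Minkowski property of exponent `d` for a field extension `K / k`. -/
def LinearBM (d : ℕ) (k K : Type*) [Field k] [Field K] [Algebra k K] : Prop :=
  ∃ E : Submodule k K, FiniteDimensional k E ∧ ∀ V W : Submodule k K, FiniteDimensional k V →
    FiniteDimensional k W → V ≠ ⊥ → W ≠ ⊥ →
    bmFun d (Module.finrank k V) (Module.finrank k W) ≤ Module.finrank k (E * V * W : Submodule k K)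

/-- A discrete valuation of `K / k` with residue field `κ` and uniformizer `ϖ`. -/
structure DiscretePlace (k K κ : Type*) [Field k] [Field K] [Field κ] [Algebra k K]
    [Algebra k κ] where
  /-- the valuation ring -/
  O : Subalgebra k K
  /-- the residue map -/
  res : O →ₐ[k] κ
  /-- the uniformizer -/
  ϖ : K
  res_surjective : Function.Surjective res
  ϖ_ne_zero : ϖ ≠ 0
  ϖ_mem : ϖ ∈ O
  res_eq_zero_iff : ∀ z : O, res z = 0 ↔ z * ϖ⁻¹ ∈ O
  exists_zpow : ∀ z : K, z ≠ 0 → ∃ i : ℤ, z * ϖ ^ (-i) ∈ O ∧ z * ϖ ^ (-(i + 1)) ∉ O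

namespace DiscretePlace
variable {k K κ : Type*} [Field k] [Field K] [Field κ] [Algebra k K] [Algebra k κ]
  (P : DiscretePlace k K κ)

/-- The filtration by the order of vanishing. -/
def fil (i : ℤ) : Submodule k K :=
  P.O.toSubmodule.comap (LinearMap.mulRight k (P.ϖ ^ (-i)))

lemma mem_fil {i : ℤ} {z : K} : z ∈ P.fil i ↔ z * P.ϖ ^ (-i) ∈ P.O := Iff.rfl

lemma fil_antitone : Antitone P.fil := by
  refine antitone_int_of_succ_le fun i z hz => ?_
  rw [mem_fil] at *
  have := mul_mem hz P.ϖ_mem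
  rwa [mul_assoc, ← zpow_add_one₀ P.ϖ_ne_zero, neg_add_rev, neg_add_cancel_comm] at this

/-- The leading coefficient of an element of the `i`-th step of the filtration. -/
def lead (i : ℤ) : P.fil i →ₗ[k] κ :=
  P.res.toLinearMap ∘ₗ ((LinearMap.mulRight k (P.ϖ ^ (-i))).restrict (p := P.fil i)
    (q := P.O.toSubmodule) fun _ hz => hz)

lemma lead_apply {i : ℤ} (z : P.fil i) : P.lead i z = P.res ⟨z * P.ϖ ^ (-i), z.2⟩ := rfl

lemma lead_eq_zero_iff {i : ℤ} (z : P.fil i) : P.lead i z = 0 ↔ (z : K) ∈ P.fil (i + 1) := by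
  rw [lead_apply, res_eq_zero_iff, mem_fil, mul_assoc, neg_add, zpow_add₀ P.ϖ_ne_zero, zpow_neg_one]

/-- The graded pieces of a subspace. -/
def gr (i : ℤ) (V : Submodule k K) : Submodule k κ :=
  (V.comap (P.fil i).subtype).map (P.lead i)

lemma mem_gr {i : ℤ} {V : Submodule k K} {e : κ} :
    e ∈ P.gr i V ↔ ∃ z, ∃ hz : z ∈ P.fil i, z ∈ V ∧ P.lead i ⟨z, hz⟩ = e := by
  simp only [gr, Submodule.mem_map, Submodule.mem_comap, Subtype.exists, Submodule.subtype_apply]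

lemma range_lead_comp_inclusion (i : ℤ) (V : Submodule k K) :
    LinearMap.range (P.lead i ∘ₗ Submodule.inclusion (inf_le_right : V ⊓ P.fil i ≤ P.fil i)) =
      P.gr i V := by
  ext e
  rw [mem_gr]
  constructor
  · rintro ⟨⟨z, hz⟩, rfl⟩
    exact ⟨z, hz.2, hz.1, rfl⟩
  · rintro ⟨z, hz, hzV, rfl⟩
    exact ⟨⟨z, hzV, hz⟩, rfl⟩

lemma finiteDimensional_gr (i : ℤ) (V : Submodule k K) [FiniteDimensional k V] :
    FiniteDimensional k (P.gr i V) := by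
  rw [← range_lead_comp_inclusion]
  infer_instance

/-- Rank-nullity for the leading coefficient map, whose kernel is the next step of the filtration.
-/
lemma finrank_inf_fil (V : Submodule k K) [FiniteDimensional k V] (i : ℤ) :
    Module.finrank k (V ⊓ P.fil i : Submodule k K) =
      Module.finrank k (P.gr i V) + Module.finrank k (V ⊓ P.fil (i + 1) : Submodule k K) := by
  let f : (V ⊓ P.fil i : Submodule k K) →ₗ[k] κ :=
    P.lead i ∘ₗ Submodule.inclusion inf_le_right
  have h := LinearMap.finrank_range_add_finrank_ker f
  have h1 : LinearMap.range f = P.gr i V := P.range_lead_comp_inclusion i V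
  have h2 : (LinearMap.ker f).map (V ⊓ P.fil i).subtype = V ⊓ P.fil (i + 1) := by
    ext z
    constructor
    · rintro ⟨⟨z, hz⟩, hz0, rfl⟩
      exact ⟨hz.1, (P.lead_eq_zero_iff ⟨z, hz.2⟩).mp hz0⟩
    · rintro ⟨hzV, hz⟩
      have hz' := P.fil_antitone (by omega : i ≤ i + 1) hz
      exact ⟨⟨z, hzV, hz'⟩, (P.lead_eq_zero_iff ⟨z, hz'⟩).mpr hz, rfl⟩
  rw [h1] at h
  rw [← h, ← h2, Submodule.finrank_map_subtype_eq]

lemma sum_finrank_gr (V : Submodule k K) [FiniteDimensional k V] (a : ℤ) (n : ℕ) :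
    ∑ i ∈ Finset.Ico a (a + n), Module.finrank k (P.gr i V) +
      Module.finrank k (V ⊓ P.fil (a + n) : Submodule k K) =
      Module.finrank k (V ⊓ P.fil a : Submodule k K) := by
  induction n with
  | zero =>
    have h : a + (0 : ℕ) = a := by simp
    rw [h]
    simp
  | succ n ih =>
    have h : Finset.Ico a (a + (n + 1 : ℕ)) = insert (a + n) (Finset.Ico a (a + n)) := by
      ext x
      simp only [Finset.mem_Ico, Finset.mem_insert]
      omega
    rw [h, Finset.sum_insert (by simp), ← ih, P.finrank_inf_fil V (a + n)]
    have h' : a + (n + 1 : ℕ) = a + n + 1 := by push_cast; ring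
    rw [h']
    ring

lemma exists_le_fil (V : Submodule k K) [FiniteDimensional k V] : ∃ a, V ≤ P.fil a := by
  obtain ⟨s, rfl⟩ := Module.Finite.iff_fg.mp (inferInstance : Module.Finite k V)
  have h : ∀ z : K, ∃ i, z ∈ P.fil i := by
    intro z
    by_cases hz : z = 0
    · exact ⟨0, hz ▸ zero_mem _⟩
    · obtain ⟨i, hi, _⟩ := P.exists_zpow z hz
      exact ⟨i, hi⟩
  choose f hf using h
  obtain ⟨a, ha⟩ := (s.image f).bddBelow
  exact ⟨a, Submodule.span_le.mpr fun z hz =>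
    P.fil_antitone (ha (Finset.mem_image_of_mem f hz)) (hf z)⟩

/-- The descending filtration stabilizes on a finite-dimensional space, and a nonzero element of the
stable term would have infinite order of vanishing. -/
lemma exists_inf_fil_eq_bot (V : Submodule k K) [FiniteDimensional k V] (a : ℤ) :
    ∃ n : ℕ, V ⊓ P.fil (a + n) = ⊥ := by
  let f : ℕ →o (Submodule k V)ᵒᵈ :=
    ⟨fun n => OrderDual.toDual ((P.fil (a + n)).comap V.subtype), fun m n h => by
      refine OrderDual.toDual_le_toDual.mpr (Submodule.comap_mono (P.fil_antitone ?_))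
      gcongr⟩
  obtain ⟨n, hn⟩ := IsArtinian.monotone_stabilizes f
  refine ⟨n, (Submodule.eq_bot_iff _).mpr fun z hz => ?_⟩
  by_contra hz0
  obtain ⟨i, hi, hi'⟩ := P.exists_zpow z hz0
  have h1 := hn (max n (i + 1 - a).toNat) (le_max_left _ _)
  have h2 : (⟨z, hz.1⟩ : V) ∈ (P.fil (a + n)).comap V.subtype := hz.2
  have h3 : (P.fil (a + n)).comap V.subtype =
    (P.fil (a + (max n (i + 1 - a).toNat : ℕ))).comap V.subtype := OrderDual.toDual.injective h1
  rw [h3] at h2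
  exact hi' (P.fil_antitone (by omega) h2)

lemma mul_mem_gr {i j : ℤ} {V W : Submodule k K} {x y : κ} (hx : x ∈ P.gr i V)
    (hy : y ∈ P.gr j W) : x * y ∈ P.gr (i + j) (V * W) := by
  rw [mem_gr] at *
  obtain ⟨v, hv, hvV, rfl⟩ := hx
  obtain ⟨w, hw, hwW, rfl⟩ := hy
  have e : v * w * P.ϖ ^ (-(i + j)) = (v * P.ϖ ^ (-i)) * (w * P.ϖ ^ (-j)) := by
    rw [neg_add, zpow_add₀ P.ϖ_ne_zero]
    ring
  refine ⟨v * w, ?_, Submodule.mul_mem_mul hvV hwW, ?_⟩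
  · rw [mem_fil, e]
    exact mul_mem hv hw
  · rw [lead_apply, lead_apply, lead_apply, ← map_mul]
    congr 1
    exact Subtype.ext e

/-- Lifts of generators of `E` are taken both as they are and multiplied by `ϖ`. Having `E` in
degrees `0` and `1` supplies the summand `{0, 1}` of the Cauchy-Davenport step. -/
lemma exists_lift (E : Submodule k κ) [FiniteDimensional k E] :
    ∃ E' : Submodule k K, FiniteDimensional k E' ∧ E ≤ P.gr 0 E' ∧ E ≤ P.gr 1 E' := by
  obtain ⟨s, rfl⟩ := Module.Finite.iff_fg.mp (inferInstance : Module.Finite k E)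
  choose f hf using P.res_surjective
  classical
  refine ⟨Submodule.span k (s.image (fun e => (f e : K)) ∪ s.image (fun e => f e * P.ϖ) : Finset K),
    inferInstance, Submodule.span_le.mpr fun e he => ?_, Submodule.span_le.mpr fun e he => ?_⟩
  · rw [SetLike.mem_coe, mem_gr]
    have h : (f e : K) * P.ϖ ^ (-(0 : ℤ)) = f e := by simp
    refine ⟨f e, ?_, Submodule.subset_span (Finset.mem_union_left _ (Finset.mem_image_of_mem _ he)), ?_⟩
    · rw [mem_fil, h]; exact (f e).2
    · rw [lead_apply]
      simp_rw [h]
      exact hf e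
  · rw [SetLike.mem_coe, mem_gr]
    have h : (f e : K) * P.ϖ * P.ϖ ^ (-(1 : ℤ)) = f e := by
      rw [zpow_neg_one, mul_inv_cancel_right₀ P.ϖ_ne_zero]
    refine ⟨f e * P.ϖ, ?_, Submodule.subset_span (Finset.mem_union_right _ (Finset.mem_image_of_mem _ he)), ?_⟩
    · rw [mem_fil, h]; exact (f e).2
    · rw [lead_apply]
      simp_rw [h]
      exact hf e

/-- The dimension of `V` is the sum of the dimensions of its graded pieces. The product of `E`, the
`i`-th piece of `V` and the `j`-th piece of `W` lies in the pieces of `E' * V * W` of degrees `i +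
j` and `i + j + 1`, so the inequality over `κ` gives the hypotheses of `bmFun_succ_sum_le`. -/
theorem linearBM_succ (P : DiscretePlace k K κ) {d : ℕ} (hκ : LinearBM d k κ) : LinearBM (d + 1) k K := by
  obtain ⟨E, hE, H⟩ := hκ
  obtain ⟨E', hE', h0, h1⟩ := P.exists_lift E
  refine ⟨E', hE', fun V W _ _ hV hW => ?_⟩
  have hsum : ∀ (V : Submodule k K) [FiniteDimensional k V], ∃ (a : ℤ) (n : ℕ),
      Module.finrank k V = ∑ i ∈ Finset.Ico a (a + n), Module.finrank k (P.gr i V) := by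
    intro V _
    obtain ⟨a, ha⟩ := P.exists_le_fil V
    obtain ⟨n, hn⟩ := P.exists_inf_fil_eq_bot V a
    have := P.sum_finrank_gr V a n
    rw [hn, finrank_bot, inf_eq_left.mpr ha, add_zero] at this
    exact ⟨a, n, this.symm⟩
  obtain ⟨a, n, hVs⟩ := hsum V
  obtain ⟨b, m, hWs⟩ := hsum W
  -- Only a lower bound for the dimension is needed, so any finite window containing all the degrees
  -- `i + j` and `i + j + 1` will do.
  have hle : ∑ i ∈ Finset.Ico (a + b) (a + b + (n + m + 1 : ℕ)),
      Module.finrank k (P.gr i (E' * V * W)) ≤ Module.finrank k (E' * V * W : Submodule k K) := by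
    have h1 := P.sum_finrank_gr (E' * V * W) (a + b) (n + m + 1)
    have h2 := Submodule.finrank_mono (inf_le_left : E' * V * W ⊓ P.fil (a + b) ≤ E' * V * W)
    omega
  have hpos : ∀ {V : Submodule k K} [FiniteDimensional k V], V ≠ ⊥ → ∀ (s : Finset ℤ),
      Module.finrank k V = ∑ i ∈ s, Module.finrank k (P.gr i V) →
      ∃ i ∈ s, (0 : ℝ) < Module.finrank k (P.gr i V) := by
    intro V _ hV s hs
    by_contra! hcon
    have : Module.finrank k V = 0 := by
      rw [hs]
      exact Finset.sum_eq_zero fun i hi => by exact_mod_cast le_antisymm (hcon i hi) (by positivity)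
    exact hV (Submodule.finrank_eq_zero.mp this)
  refine le_trans ?_ (Nat.cast_le.mpr hle)
  rw [hVs, hWs]
  push_cast
  refine bmFun_succ_sum_le d (fun _ => by positivity) (fun _ => by positivity)
    (fun _ => by positivity) (hpos hV _ hVs) (hpos hW _ hWs) fun i hi j hj hi0 hj0 => ?_
  have hV0 : P.gr i V ≠ ⊥ := fun h => by rw [h, finrank_bot] at hi0; simp at hi0
  have hW0 : P.gr j W ≠ ⊥ := fun h => by rw [h, finrank_bot] at hj0; simp at hj0
  have key : ∀ l, E ≤ P.gr l E' → E * P.gr i V * P.gr j W ≤ P.gr (l + i + j) (E' * V * W) := by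
    intro l hl
    refine Submodule.mul_le.mpr fun x hx y hy => ?_
    refine P.mul_mem_gr ?_ hy
    revert x
    refine fun x hx => (Submodule.mul_le (P := P.gr (l + i) (E' * V))).mpr (fun x hx y hy => ?_) hx
    exact P.mul_mem_gr (hl hx) hy
  have hfinV := P.finiteDimensional_gr i V
  have hfinW := P.finiteDimensional_gr j W
  have hH := H _ _ hfinV hfinW hV0 hW0
  have hfinP := fun i => P.finiteDimensional_gr i (E' * V * W)
  simp only [Finset.mem_Ico] at hi hj ⊢
  refine ⟨by omega, by omega, hH.trans ?_, hH.trans ?_⟩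
  · have := Submodule.finrank_mono (key 0 h0)
    rw [zero_add] at this
    exact_mod_cast this
  · have := Submodule.finrank_mono (key 1 h1)
    rw [show 1 + i + j = i + j + 1 by ring] at this
    exact_mod_cast this

end DiscretePlace

end BigDivisor

end

/-! ### Discreteness of a valuation trivial on `F` and less than one at `x`, with `K` finite over
`F(x)`. -/

section

open Polynomial

namespace BigDivisor

section Valuation
variable {F K Γ₀ : Type*} [Field F] [Field K] [Algebra F K] [LinearOrderedCommGroupWithZero Γ₀]
  {v : Valuation K Γ₀} (hF : ∀ c : F, c ≠ 0 → v (algebraMap F K c) = 1) {x : K} (hx0 : x ≠ 0)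
  (hx : v x < 1)

include hF in
lemma valuation_algebraMap_le_one (c : F) : v (algebraMap F K c) ≤ 1 := by
  by_cases hc : c = 0
  · simp [hc]
  · exact (hF c hc).le

include hF hx in
lemma valuation_aeval_le_one (p : F[X]) : v (aeval x p) ≤ 1 := by
  rw [aeval_eq_sum_range]
  refine v.map_sum_le fun i _ => ?_
  rw [Algebra.smul_def, map_mul, map_pow]
  exact mul_le_one' (valuation_algebraMap_le_one hF _) (pow_le_one' hx.le _)

include hF hx in
lemma valuation_aeval_sub_lt_one (p : F[X]) :
    v (aeval x p - algebraMap F K (p.coeff 0)) < 1 := by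
  have h : aeval x p - algebraMap F K (p.coeff 0) = aeval x p.divX * x := by
    nth_rewrite 1 [← divX_mul_X_add p]
    simp
  rw [h, map_mul]
  exact (mul_le_of_le_one_left' (valuation_aeval_le_one hF hx _)).trans_lt hx

include hF hx in
lemma valuation_aeval_eq_one {p : F[X]} (hp : p.coeff 0 ≠ 0) : v (aeval x p) = 1 := by
  have h1 := valuation_aeval_sub_lt_one hF hx p
  have h2 := hF _ hp
  rw [← h2] at h1
  have h3 := v.map_add_eq_of_lt_left h1
  rwa [add_sub_cancel, h2] at h3

/-- Every nonzero rational function in `x` is a power of `x` times a quotient of polynomials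
with nonzero constant terms. -/
lemma exists_eq_zpow_mul_div {y : K} (hx0 : x ≠ 0) (hy : y ∈ IntermediateField.adjoin F {x})
    (hy0 : y ≠ 0) : ∃ (n : ℤ) (p q : F[X]), p.coeff 0 ≠ 0 ∧ q.coeff 0 ≠ 0 ∧
      y = x ^ n * (aeval x p / aeval x q) := by
  obtain ⟨r, s, rfl⟩ := (IntermediateField.mem_adjoin_simple_iff F y).mp hy
  have hfac : ∀ r : F[X], aeval x r ≠ 0 → ∃ (n : ℕ) (p : F[X]), p.coeff 0 ≠ 0 ∧
      aeval x r = x ^ n * aeval x p := by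
    intro r hr
    have hr0 : r ≠ 0 := fun h => hr (by rw [h, map_zero])
    obtain ⟨p, hp, hd⟩ := exists_eq_pow_rootMultiplicity_mul_and_not_dvd r hr0 0
    rw [C_0, sub_zero] at hp hd
    rw [X_dvd_iff] at hd
    refine ⟨r.rootMultiplicity 0, p, hd, ?_⟩
    conv_lhs => rw [hp]
    simp
  obtain ⟨n, p, hp, hrp⟩ := hfac r fun h => hy0 (by rw [h, zero_div])
  obtain ⟨m, q, hq, hsq⟩ := hfac s fun h => hy0 (by rw [h, div_zero])
  refine ⟨n - m, p, q, hp, hq, ?_⟩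
  rw [hrp, hsq, zpow_sub₀ hx0, zpow_natCast, zpow_natCast, mul_div_mul_comm]

include hF hx hx0 in
lemma exists_valuation_eq_zpow {y : K} (hy : y ∈ IntermediateField.adjoin F {x})
    (hy0 : y ≠ 0) : ∃ n : ℤ, v y = v x ^ n := by
  obtain ⟨n, p, q, hp, hq, rfl⟩ := exists_eq_zpow_mul_div hx0 hy hy0
  refine ⟨n, ?_⟩
  rw [map_mul, map_div₀, valuation_aeval_eq_one hF hx hp, valuation_aeval_eq_one hF hx hq,
    div_one, mul_one, map_zpow₀]

include hF hx hx0 in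
-- The residue field of `F(x)` at `x` is `F`: a unit is a quotient of polynomials with nonzero
-- constant terms, and its residue is the quotient of these terms.
lemma exists_valuation_sub_lt_one {y : K} (hy : y ∈ IntermediateField.adjoin F {x})
    (hy1 : v y ≤ 1) : ∃ a : F, v (y - algebraMap F K a) < 1 := by
  by_cases hlt : v y < 1
  · exact ⟨0, by simpa using hlt⟩
  have hy2 : v y = 1 := le_antisymm hy1 (not_lt.mp hlt)
  have hy0 : y ≠ 0 := by rintro rfl; simp at hy2
  obtain ⟨n, p, q, hp, hq, rfl⟩ := exists_eq_zpow_mul_div hx0 hy hy0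
  have hvp := valuation_aeval_eq_one hF hx hp
  have hvq := valuation_aeval_eq_one hF hx hq
  rw [map_mul, map_div₀, hvp, hvq, div_one, mul_one, map_zpow₀] at hy2
  have hvx : 0 < v x := (v.pos_iff).mpr hx0
  have hn : n = 0 := by
    rcases lt_trichotomy n 0 with h | h | h
    · exact absurd hy2 (one_lt_zpow_of_neg₀ hvx hx h).ne'
    · exact h
    · exact absurd hy2 (zpow_lt_one₀ hvx hx h).ne
  subst hn
  refine ⟨p.coeff 0 / q.coeff 0, ?_⟩
  have hq0 : aeval x q ≠ 0 := fun h => by rw [h] at hvq; simp at hvq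
  have hc0 : algebraMap F K (q.coeff 0) ≠ 0 := by simpa using hq
  have h1 : x ^ (0 : ℤ) * (aeval x p / aeval x q) - algebraMap F K (p.coeff 0 / q.coeff 0) =
      (aeval x (p * C (q.coeff 0) - C (p.coeff 0) * q) -
        algebraMap F K ((p * C (q.coeff 0) - C (p.coeff 0) * q).coeff 0)) /
        (aeval x q * algebraMap F K (q.coeff 0)) := by
    simp only [map_div₀, map_sub, map_mul, aeval_C, coeff_sub, coeff_mul_C, coeff_C_mul]
    field_simp
    ring
  rw [h1, map_div₀, map_mul, hvq, hF _ hq, mul_one, div_one]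
  exact valuation_aeval_sub_lt_one hF hx _

include hF hx hx0 in
-- In the minimal equation of `z` over `F(x)` two terms must share the largest valuation, since
-- otherwise the sum could not vanish. This makes `v z ^ (j - i)` a power of `v x` with `|j - i|` at
-- most the degree of `K / F(x)`; the factorial gives an exponent independent of `z`.
lemma exists_valuation_pow_eq [FiniteDimensional (IntermediateField.adjoin F {x}) K] {z : K}
    (hz : z ≠ 0) : ∃ n : ℤ,
      v z ^ (Module.finrank (IntermediateField.adjoin F {x}) K).factorial = v x ^ n := by
  classical
  let L := IntermediateField.adjoin F {x}
  let P := minpoly L z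
  have hzint : IsIntegral L z := Algebra.IsIntegral.isIntegral z
  have hP0 : P ≠ 0 := minpoly.ne_zero hzint
  have hsum : ∑ i ∈ P.support, (algebraMap L K (P.coeff i)) * z ^ i = 0 := by
    have := minpoly.aeval L z
    rwa [aeval_def, eval₂_eq_sum] at this
  have hvz : v z ≠ 0 := (v.ne_zero_iff).mpr hz
  have hvx : v x ≠ 0 := (v.ne_zero_iff).mpr hx0
  obtain ⟨j, hj, hmax⟩ := P.support.exists_max_image
    (fun i => v ((algebraMap L K (P.coeff i)) * z ^ i)) (support_nonempty.mpr hP0)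
  have hne : ∀ i ∈ P.support, v ((algebraMap L K (P.coeff i)) * z ^ i) ≠ 0 := by
    intro i hi
    rw [v.ne_zero_iff]
    exact mul_ne_zero (by simpa using mem_support_iff.mp hi) (pow_ne_zero _ hz)
  obtain ⟨i, hi, hij, heq⟩ : ∃ i ∈ P.support, i ≠ j ∧
      v ((algebraMap L K (P.coeff i)) * z ^ i) = v ((algebraMap L K (P.coeff j)) * z ^ j) := by
    by_contra! hcon
    have := v.map_sum_eq_of_lt hj (fun i hi => lt_of_le_of_ne
      (hmax i (Finset.mem_sdiff.mp hi).1) (hcon i (Finset.mem_sdiff.mp hi).1 (by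
        simpa using (Finset.mem_sdiff.mp hi).2)))
    rw [hsum, map_zero] at this
    exact hne j hj this.symm
  have hdeg : ∀ i ∈ P.support, i ≤ Module.finrank L K := fun i hi =>
    (le_natDegree_of_mem_supp i hi).trans (minpoly.natDegree_le z)
  obtain ⟨a, ha⟩ := exists_valuation_eq_zpow hF hx0 hx (P.coeff i).2
    (by simpa using mem_support_iff.mp hi)
  obtain ⟨b, hb⟩ := exists_valuation_eq_zpow hF hx0 hx (P.coeff j).2
    (by simpa using mem_support_iff.mp hj)
  have hab : v x ^ a * v z ^ i = v x ^ b * v z ^ j := by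
    rw [← ha, ← hb, ← map_pow, ← map_pow, ← map_mul, ← map_mul]
    exact heq
  have hab' : v z ^ ((j : ℤ) - i) = v x ^ (a - b) := by
    rw [zpow_sub₀ hvz, zpow_sub₀ hvx, zpow_natCast, zpow_natCast, div_eq_div_iff (pow_ne_zero _ hvz)
      (zpow_ne_zero _ hvx), mul_comm, ← hab]
  have hdvd : (j : ℤ) - i ∣ ((Module.finrank L K).factorial : ℤ) := by
    rw [← Int.natAbs_dvd, Int.natCast_dvd_natCast]
    refine Nat.dvd_factorial (by omega) ?_
    have := hdeg i hi
    have := hdeg j hj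
    omega
  obtain ⟨e, he⟩ := hdvd
  refine ⟨(a - b) * e, ?_⟩
  rw [← zpow_natCast, he, zpow_mul, hab', zpow_mul]

include hF hx hx0 in
/-- The valuation is discrete. -/
lemma exists_uniformizer [FiniteDimensional (IntermediateField.adjoin F {x}) K] :
    ∃ ϖ : K, ϖ ≠ 0 ∧ v ϖ < 1 ∧ ∀ z : K, z ≠ 0 → ∃ i : ℤ, v z = v ϖ ^ i := by
  classical
  have hvx : 0 < v x := (v.pos_iff).mpr hx0
  let D := (Module.finrank (IntermediateField.adjoin F {x}) K).factorial
  have hD : D ≠ 0 := Nat.factorial_ne_zero _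
  have hmono : StrictAnti (fun n : ℤ => v x ^ n) := zpow_right_strictAnti₀ hvx hx
  -- Raising to the power `D` maps the value group into the powers of `v x`. The uniformizer
  -- realizes the least positive exponent that occurs, and division with remainder shows that it
  -- generates; `x` itself gives the exponent `D`.
  have hex : ∃ g : ℕ, 0 < g ∧ ∃ z : K, z ≠ 0 ∧ v z ^ D = v x ^ (g : ℤ) :=
    ⟨D, Nat.pos_of_ne_zero hD, x, hx0, by rw [zpow_natCast]⟩
  obtain ⟨hg, ϖ, hϖ0, hϖ⟩ := Nat.find_spec hex
  have hmin := fun {m} => Nat.find_min hex (m := m)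
  generalize Nat.find hex = g at hg hϖ hmin
  have hvϖ : v ϖ ≠ 0 := (v.ne_zero_iff).mpr hϖ0
  refine ⟨ϖ, hϖ0, ?_, fun z hz => ?_⟩
  · rw [← pow_lt_one_iff hD, hϖ]
    exact zpow_lt_one₀ hvx hx (by exact_mod_cast hg)
  · obtain ⟨n, hn⟩ := exists_valuation_pow_eq (v := v) hF hx0 hx hz
    change v z ^ D = _ at hn
    have hmod := Int.emod_nonneg n (by exact_mod_cast hg.ne' : (g : ℤ) ≠ 0)
    have hlt := Int.emod_lt_of_pos n (by exact_mod_cast hg : (0 : ℤ) < g)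
    have hdiv := Int.emod_add_mul_ediv n g
    have hval : v (z * ϖ ^ (-(n / g))) ^ D = v x ^ (n % g) := by
      rw [map_mul, map_zpow₀, mul_pow, hn, ← zpow_natCast (v ϖ ^ _), ← zpow_mul, mul_comm _ (D : ℤ),
        zpow_mul, zpow_natCast, hϖ, ← zpow_mul, ← zpow_add₀ hvx.ne']
      congr 1
      linarith
    have hr : n % g = 0 := by
      by_contra hne
      refine hmin (m := (n % g).toNat) (by omega) ⟨by omega, z * ϖ ^ (-(n / g)),
        mul_ne_zero hz (zpow_ne_zero _ hϖ0), ?_⟩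
      rw [hval, Int.toNat_of_nonneg hmod]
    refine ⟨n / g, ?_⟩
    rw [hr, zpow_zero, pow_eq_one_iff, or_iff_left hD, map_mul, map_zpow₀, zpow_neg, ← div_eq_mul_inv,
      div_eq_one_iff_eq (zpow_ne_zero _ hvϖ)] at hval
    exact hval

end Valuation

end BigDivisor

end

/-! ### Residue fields and the construction of discrete places. -/

section

open Polynomial

namespace BigDivisor

section Residue
variable {F K : Type*} [Field F] [Field K] [Algebra F K] {B : ValuationSubring K} {x : K}

lemma valuation_algebraMap_eq_one (hB : ∀ c : F, algebraMap F K c ∈ B) (c : F) (hc : c ≠ 0) :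
    B.valuation (algebraMap F K c) = 1 := by
  have h1 := (B.valuation_le_one_iff _).mpr (hB c)
  have h2 := (B.valuation_le_one_iff _).mpr (hB c⁻¹)
  rw [map_inv₀, map_inv₀] at h2
  refine le_antisymm h1 ?_
  by_contra! hlt
  exact absurd h2 (not_le.mpr ((one_lt_inv₀ ((B.valuation.pos_iff).mpr (by simpa using hc))).mpr hlt))

/-- Lifts of independent residue classes are independent over the rational function field. -/
lemma linearIndependent_of_residue [Algebra F (IsLocalRing.ResidueField B)]
    (hB : ∀ c : F, algebraMap F K c ∈ B)
    (hres : ∀ c : F, algebraMap F (IsLocalRing.ResidueField B) c = IsLocalRing.residue B ⟨_, hB c⟩)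
    (hx0 : x ≠ 0) (hx : B.valuation x < 1) {ι : Type*} [Finite ι] (b : ι → B)
    (hb : LinearIndependent F fun i => IsLocalRing.residue B (b i)) :
    LinearIndependent (IntermediateField.adjoin F {x}) fun i => (b i : K) := by
  classical
  have := Fintype.ofFinite ι
  have hF := valuation_algebraMap_eq_one hB
  rw [Fintype.linearIndependent_iff]
  intro c hc
  by_contra! hne
  obtain ⟨i₀, hi₀⟩ := hne
  -- Dividing the relation by its coefficient of largest valuation makes all coefficients integral.
  -- Their residues lie in `F` and the `j`-th one is `1`, contradicting independence of the residue
  -- classes.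
  obtain ⟨j, -, hj⟩ := Finset.univ.exists_max_image (fun i => B.valuation (c i : K))
    ⟨i₀, Finset.mem_univ _⟩
  have hj0 : (c j : K) ≠ 0 := by
    intro h0
    have := hj i₀ (Finset.mem_univ _)
    rw [h0, map_zero, le_zero_iff, map_eq_zero] at this
    exact hi₀ (by exact_mod_cast this)
  have hvj : B.valuation (c j : K) ≠ 0 := (B.valuation.ne_zero_iff).mpr hj0
  have ha : ∀ i, ∃ a : F, B.valuation ((c i : K) / c j - algebraMap F K a) < 1 := fun i =>
    exists_valuation_sub_lt_one hF hx0 hx (div_mem (c i).2 (c j).2) (by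
      rw [map_div₀]
      exact div_le_one_of_le₀ (hj i (Finset.mem_univ _)) zero_le)
  choose a ha using ha
  have hsum : ∑ i, a i • IsLocalRing.residue B (b i) = 0 := by
    have h1 : ∑ i, a i • IsLocalRing.residue B (b i) =
        IsLocalRing.residue B (∑ i, ⟨_, hB (a i)⟩ * b i) := by
      rw [map_sum]
      exact Finset.sum_congr rfl fun i _ => by rw [Algebra.smul_def, hres, map_mul]
    rw [h1, IsLocalRing.residue_eq_zero_iff, ValuationSubring.valuation_lt_one_iff]
    have h2 : ((∑ i, ⟨_, hB (a i)⟩ * b i : B) : K) =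
        -∑ i, ((c i : K) / c j - algebraMap F K (a i)) * b i := by
      have h3 : ∑ i, ((c i : K) / c j) * b i = 0 := by
        have : ∑ i, ((c i : K) / c j) * b i = (∑ i, c i • (b i : K)) / c j := by
          rw [Finset.sum_div]
          exact Finset.sum_congr rfl fun i _ => by
            rw [IntermediateField.smul_def, smul_eq_mul]; ring
        rw [this, hc, zero_div]
      simp only [sub_mul, Finset.sum_sub_distrib, h3, zero_sub, neg_neg]
      push_cast
      rfl
    rw [h2, Valuation.map_neg]
    refine B.valuation.map_sum_lt one_ne_zero fun i _ => ?_
    rw [map_mul]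
    exact (mul_le_of_le_one_right' ((B.valuation_le_one_iff _).mpr (b i).2)).trans_lt (ha i)
  have haj := (Fintype.linearIndependent_iff.mp hb) a hsum j
  have := ha j
  rw [haj, div_self hj0, map_zero, sub_zero, map_one] at this
  exact lt_irrefl _ this

/-- Lifting independent residue classes gives `[κ : F] ≤ [K : F(x)]`. -/
lemma finiteDimensional_residueField [Algebra F (IsLocalRing.ResidueField B)]
    (hB : ∀ c : F, algebraMap F K c ∈ B)
    (hres : ∀ c : F, algebraMap F (IsLocalRing.ResidueField B) c = IsLocalRing.residue B ⟨_, hB c⟩)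
    (hx0 : x ≠ 0) (hx : B.valuation x < 1) [FiniteDimensional (IntermediateField.adjoin F {x}) K] :
    FiniteDimensional F (IsLocalRing.ResidueField B) := by
  refine Module.rank_lt_aleph0_iff.mp (lt_of_le_of_lt (rank_le
    (n := Module.finrank (IntermediateField.adjoin F {x}) K) ?_) (Cardinal.natCast_lt_aleph0))
  intro s hs
  choose b hb using IsLocalRing.residue_surjective (R := B)
  have := linearIndependent_of_residue hB hres hx0 hx (fun i : s => b i) (by simpa [hb] using hs)
  simpa using this.fintype_card_le_finrank

end Residue

section Place
variable {k K : Type*} [Field k] [Field K] [Algebra k K] {B : ValuationSubring K}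

/-- The discrete place given by a discrete valuation ring containing `k`. -/
noncomputable def discretePlaceOfUniformizer [Algebra k (IsLocalRing.ResidueField B)]
    (hB : ∀ c : k, algebraMap k K c ∈ B)
    (hres : ∀ c : k, algebraMap k (IsLocalRing.ResidueField B) c = IsLocalRing.residue B ⟨_, hB c⟩)
    (ϖ : K) (hϖ0 : ϖ ≠ 0) (hϖ : B.valuation ϖ < 1)
    (h : ∀ z : K, z ≠ 0 → ∃ i : ℤ, B.valuation z = B.valuation ϖ ^ i) :
    DiscretePlace k K (IsLocalRing.ResidueField B) where
  O := { B.toSubring with algebraMap_mem' := hB }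
  res :=
    { toFun := fun z => IsLocalRing.residue B ⟨z, z.2⟩
      map_one' := map_one _
      map_mul' := fun x y => map_mul (IsLocalRing.residue B) ⟨x, x.2⟩ ⟨y, y.2⟩
      map_zero' := map_zero _
      map_add' := fun x y => map_add (IsLocalRing.residue B) ⟨x, x.2⟩ ⟨y, y.2⟩
      commutes' := fun c => (hres c).symm }
  ϖ := ϖ
  res_surjective := fun y => by
    obtain ⟨b, rfl⟩ := IsLocalRing.residue_surjective y
    exact ⟨⟨b, b.2⟩, rfl⟩
  ϖ_ne_zero := hϖ0
  ϖ_mem := (B.valuation_le_one_iff _).mp hϖ.le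
  res_eq_zero_iff := fun z => by
    change IsLocalRing.residue B ⟨z, z.2⟩ = 0 ↔ (z : K) * ϖ⁻¹ ∈ B
    rw [IsLocalRing.residue_eq_zero_iff, ValuationSubring.valuation_lt_one_iff,
      ← B.valuation_le_one_iff]
    change B.valuation (z : K) < 1 ↔ _
    have hv : 0 < B.valuation ϖ := (B.valuation.pos_iff).mpr hϖ0
    by_cases hz : (z : K) = 0
    · simp [hz]
    · obtain ⟨i, hi⟩ := h z hz
      rw [map_mul, map_inv₀, hi, ← zpow_sub_one₀ hv.ne', zpow_le_one_iff_right_of_lt_one₀ hv hϖ,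
        zpow_lt_one_iff_right_of_lt_one₀ hv hϖ]
      omega
  exists_zpow := fun z hz => by
    have hv : 0 < B.valuation ϖ := (B.valuation.pos_iff).mpr hϖ0
    obtain ⟨i, hi⟩ := h z hz
    refine ⟨i, ?_, ?_⟩
    · change z * ϖ ^ (-i) ∈ B
      rw [← B.valuation_le_one_iff, map_mul, map_zpow₀, hi, ← zpow_add₀ hv.ne', add_neg_cancel,
        zpow_zero]
    · change z * ϖ ^ (-(i + 1)) ∉ B
      rw [← B.valuation_le_one_iff, map_mul, map_zpow₀, hi, ← zpow_add₀ hv.ne',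
        zpow_le_one_iff_right_of_lt_one₀ hv hϖ]
      omega

/-- Since `x` is transcendental it generates a proper ideal of `F[x]`, and some valuation ring of
`K` contains `F[x]` with `x` among its nonunits. Finiteness of `K` over `F(x)` makes it discrete
with residue field finite over `F`. -/
lemma exists_discretePlace {k F K : Type*} [Field k] [Field F] [Field K] [Algebra k F] [Algebra k K]
    [Algebra F K] [IsScalarTower k F K] {x : K} (hx : Transcendental F x)
    [FiniteDimensional (IntermediateField.adjoin F {x}) K] :
    ∃ (B : ValuationSubring K) (_ : Algebra k (IsLocalRing.ResidueField B))
      (_ : Algebra F (IsLocalRing.ResidueField B))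
      (_ : IsScalarTower k F (IsLocalRing.ResidueField B)),
      FiniteDimensional F (IsLocalRing.ResidueField B) ∧
        Nonempty (DiscretePlace k K (IsLocalRing.ResidueField B)) := by
  have hx0 : x ≠ 0 := fun h => hx (h ▸ isAlgebraic_zero)
  let A := Algebra.adjoin F {x}
  have hxA : x ∈ A.toSubring := Algebra.subset_adjoin rfl
  have hI : Ideal.span {(⟨x, hxA⟩ : A.toSubring)} ≠ ⊤ := by
    rw [Ne, Ideal.span_singleton_eq_top]
    intro hu
    obtain ⟨⟨a, ha⟩, hxa⟩ := hu.exists_right_inv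
    have hxa' : x * a = 1 := congrArg Subtype.val hxa
    obtain ⟨p, rfl⟩ := (Algebra.adjoin_singleton_eq_range_aeval F x ▸ ha :
      a ∈ (aeval x : F[X] →ₐ[F] K).range)
    -- An inverse `p(x)` of `x` would make `x` a root of `X * p - 1`, which is nonzero because its
    -- value at `0` is `-1`.
    refine hx ⟨X * p - 1, fun h => ?_, by simpa [sub_eq_zero] using hxa'⟩
    have := congrArg (eval 0) h
    simp at this
  obtain ⟨B, hAB, hIB⟩ := Ideal.image_subset_nonunits_valuationSubring _ hI
  have hBF : ∀ c : F, algebraMap F K c ∈ B := fun c => hAB (A.algebraMap_mem c)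
  have hBk : ∀ c : k, algebraMap k K c ∈ B := fun c => by
    rw [IsScalarTower.algebraMap_apply k F K]; exact hBF _
  have hvx : B.valuation x < 1 :=
    B.mem_nonunits_iff.mp (hIB ⟨⟨x, hxA⟩, Ideal.subset_span rfl, rfl⟩)
  have hvF := valuation_algebraMap_eq_one hBF
  obtain ⟨ϖ, hϖ0, hϖ, h⟩ := exists_uniformizer hvF hx0 hvx
  let iF : Algebra F (IsLocalRing.ResidueField B) :=
    ((IsLocalRing.residue B).comp ((algebraMap F K).codRestrict B hBF)).toAlgebra
  let ik : Algebra k (IsLocalRing.ResidueField B) :=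
    ((IsLocalRing.residue B).comp ((algebraMap k K).codRestrict B hBk)).toAlgebra
  refine ⟨B, ik, iF, IsScalarTower.of_algebraMap_eq fun c => ?_,
    finiteDimensional_residueField hBF (fun _ => rfl) hx0 hvx,
    ⟨discretePlaceOfUniformizer hBk (fun _ => rfl) ϖ hϖ0 hϖ h⟩⟩
  refine congrArg (IsLocalRing.residue B) (Subtype.ext ?_)
  exact IsScalarTower.algebraMap_apply k F K c

end Place

end BigDivisor

end

/-! ### The linear Brunn-Minkowski inequality, by induction on transcendence degree. -/

section

namespace BigDivisor

lemma finiteDimensional_of_forall_exists_algebraMap_eq {A F K : Type*} [Field A] [Field F] [Field K]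
    [Algebra A K] [Algebra F K] (h : ∀ a : A, ∃ c : F, algebraMap F K c = algebraMap A K a)
    [hK : FiniteDimensional A K] : FiniteDimensional F K := by
  obtain ⟨s, hs⟩ := hK.fg_top
  refine ⟨s, eq_top_iff.mpr fun z _ => ?_⟩
  have hz : z ∈ Submodule.span A (s : Set K) := hs ▸ Submodule.mem_top
  induction hz using Submodule.span_induction with
  | mem x hx => exact Submodule.subset_span hx
  | zero => exact zero_mem _
  | add x y _ _ hx hy => exact add_mem (hx trivial) (hy trivial)
  | smul a x _ hx =>
    obtain ⟨c, hc⟩ := h a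
    rw [Algebra.smul_def, ← hc, ← Algebra.smul_def]
    exact Submodule.smul_mem _ _ (hx trivial)

/-- Take `E` to be all of `K`: its product with nonzero subspaces is again `K`. -/
lemma linearBM_zero {k K : Type*} [Field k] [Field K] [Algebra k K] [FiniteDimensional k K] :
    LinearBM 0 k K := by
  refine ⟨⊤, inferInstance, fun V W _ _ hV hW => ?_⟩
  obtain ⟨v, hv, hv0⟩ := V.ne_bot_iff.mp hV
  obtain ⟨w, hw, hw0⟩ := W.ne_bot_iff.mp hW
  have htop : (⊤ * V * W : Submodule k K) = ⊤ := by
    refine eq_top_iff.mpr fun z _ => ?_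
    have : z = z / (v * w) * v * w := by field_simp
    rw [this]
    exact Submodule.mul_mem_mul (Submodule.mul_mem_mul trivial hv) hw
  rw [htop, finrank_top]
  exact max_le (by exact_mod_cast Submodule.finrank_le V) (by exact_mod_cast Submodule.finrank_le W)

/-- A finitely generated field extension of transcendence degree `t` has the linear
Brunn-Minkowski property of exponent `t`. -/
theorem linearBM_of_algebraicIndependent {k : Type*} [Field k] : ∀ (t : ℕ) {K : Type*} [Field K]
    [Algebra k K] (x : Fin t → K), AlgebraicIndependent k x →
    FiniteDimensional (IntermediateField.adjoin k (Set.range x)) K → LinearBM t k K := by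
  intro t
  induction t with
  | zero =>
    intro K _ _ x _ hfin
    have : FiniteDimensional k K :=
      finiteDimensional_of_forall_exists_algebraMap_eq
        (A := IntermediateField.adjoin k (Set.range x)) fun ⟨a, ha⟩ => by
          rw [Set.range_eq_empty, IntermediateField.adjoin_empty] at ha
          exact IntermediateField.mem_bot.mp ha
    exact linearBM_zero
  | succ t ih =>
    intro K _ _ x hx hfin
    -- All variables but the first go into the base `F`; the place is centred at `x 0 = 0` and its
    -- residue field is finite over `F`.
    let F := IntermediateField.adjoin k (Set.range (x ∘ Fin.succ))
    have hmem : ∀ i : Fin t, x i.succ ∈ F := fun i => IntermediateField.subset_adjoin _ _ ⟨i, rfl⟩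
    have hx0 : Transcendental F (x 0) := by
      rw [IntermediateField.transcendental_adjoin_iff, Set.range_comp]
      exact hx.transcendental_adjoin (by simp)
    have : FiniteDimensional (IntermediateField.adjoin F {x 0}) K :=
      finiteDimensional_of_forall_exists_algebraMap_eq
        (A := IntermediateField.adjoin k (Set.range x)) fun a => by
          suffices h : IntermediateField.adjoin k (Set.range x) ≤
              (IntermediateField.adjoin F {x 0}).restrictScalars k from ⟨⟨a, h a.2⟩, rfl⟩
          rw [IntermediateField.adjoin_le_iff]
          rintro _ ⟨i, rfl⟩
          change x i ∈ IntermediateField.adjoin F {x 0}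
          refine Fin.cases ?_ (fun i => ?_) i
          · exact IntermediateField.mem_adjoin_simple_self F (x 0)
          · exact (IntermediateField.adjoin F {x 0}).algebraMap_mem ⟨_, hmem i⟩
    obtain ⟨B, _, _, _, _, ⟨P⟩⟩ := exists_discretePlace (k := k) hx0
    let φ := IsScalarTower.toAlgHom k F (IsLocalRing.ResidueField B)
    -- The induction hypothesis applies to the residue field, with the remaining `t` variables
    -- transported along `F → κ`.
    refine P.linearBM_succ (ih (fun i => φ ⟨_, hmem i⟩) ?_ ?_)
    · have h1 : AlgebraicIndependent k (fun i : Fin t => (⟨_, hmem i⟩ : F)) := by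
        rw [← F.val.algebraicIndependent_iff F.val.injective]
        exact hx.comp _ (Fin.succ_injective t)
      exact h1.map' (f := φ) φ.injective
    · refine finiteDimensional_of_forall_exists_algebraMap_eq (A := F) fun a => ?_
      suffices h : φ a ∈ IntermediateField.adjoin k (Set.range fun i : Fin t => φ ⟨_, hmem i⟩) from
        ⟨⟨_, h⟩, rfl⟩
      obtain ⟨a, ha⟩ := a
      induction ha using IntermediateField.adjoin_induction with
      | mem z hz =>
        obtain ⟨i, rfl⟩ := hz
        exact IntermediateField.subset_adjoin _ _ ⟨i, rfl⟩
      | algebraMap c =>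
        have := (IntermediateField.adjoin k (Set.range fun i : Fin t => φ ⟨_, hmem i⟩)).algebraMap_mem c
        rwa [← φ.commutes] at this
      | add y z hy hz ihy ihz => exact map_add φ ⟨y, hy⟩ ⟨z, hz⟩ ▸ add_mem ihy ihz
      | inv y hy ihy => exact map_inv₀ φ ⟨y, hy⟩ ▸ inv_mem ihy
      | mul y z hy hz ihy ihz => exact map_mul φ ⟨y, hy⟩ ⟨z, hz⟩ ▸ mul_mem ihy ihz

end BigDivisor

end

/-! ### Transcendence bases of a subextension and of the extension above it. -/

section

open IntermediateField

namespace BigDivisor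

section FinitelyGenerated
variable {k K : Type*} [Field k] [Field K] [Algebra k K] {S : Set K}

lemma isAlgebraic_algebraAdjoin_of_adjoin_eq_top (hS : adjoin k S = ⊤) :
    Algebra.IsAlgebraic (Algebra.adjoin k S) K := by
  refine ⟨fun f => ?_⟩
  obtain ⟨a, ha, b, hb, rfl⟩ := mem_adjoin_iff_div.mp (hS ▸ mem_top : f ∈ adjoin k S)
  rw [div_eq_mul_inv]
  exact (isAlgebraic_algebraMap (⟨a, ha⟩ : Algebra.adjoin k S)).mul
    (isAlgebraic_algebraMap (⟨b, hb⟩ : Algebra.adjoin k S)).inv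

lemma adjoin_eq_top_of_tower (hS : adjoin k S = ⊤) (A : Type*) [Field A] [Algebra k A]
    [Algebra A K] [IsScalarTower k A K] : adjoin A S = ⊤ := by
  have h : adjoin k S ≤ (adjoin A S).restrictScalars k :=
    adjoin_le_iff.mpr (subset_adjoin A S)
  exact eq_top_iff.mpr fun z _ => h (hS ▸ mem_top)

lemma finiteDimensional_of_isAlgebraic [hfin : Finite S] (hS : adjoin k S = ⊤)
    [halg : Algebra.IsAlgebraic k K] : FiniteDimensional k K := by
  have := finiteDimensional_adjoin (S := S) fun x _ => (halg.isAlgebraic x).isIntegral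
  rw [hS] at this
  exact Module.Finite.equiv (topEquiv (F := k) (E := K)).toLinearEquiv

lemma finiteDimensional_of_isTranscendenceBasis [Finite S] (hS : adjoin k S = ⊤) {ι : Type*}
    {x : ι → K} (hx : IsTranscendenceBasis k x) : FiniteDimensional (adjoin k (Set.range x)) K :=
  have := hx.isAlgebraic_field
  finiteDimensional_of_isAlgebraic (adjoin_eq_top_of_tower hS _)

lemma exists_isTranscendenceBasis_fin [Finite S] (hS : adjoin k S = ⊤) :
    ∃ (s : ℕ) (z : Fin s → K), (∀ i, z i ∈ S) ∧ IsTranscendenceBasis k z := by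
  have := isAlgebraic_algebraAdjoin_of_adjoin_eq_top hS
  obtain ⟨T, hT, hbasis⟩ := exists_isTranscendenceBasis_subset (R := k) S
  have : Finite T := Finite.Set.subset S hT
  obtain ⟨s, ⟨e⟩⟩ := Finite.exists_equiv_fin T
  exact ⟨s, fun i => e.symm i, fun i => hT (e.symm i).2, hbasis.comp_equiv e.symm⟩

end FinitelyGenerated

open scoped algebraAdjoinAdjoin in
/-- Linear independence is preserved by a purely transcendental extension of the scalars. -/
lemma _root_.LinearIndependent.adjoin_of_algebraicIndependent {F L K : Type*} [Field F] [Field L]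
    [Field K] [Algebra F L] [Algebra F K] [Algebra L K] [IsScalarTower F L K] {σ ι : Type*}
    {z : σ → K} (hz : AlgebraicIndependent L z) [Finite ι] {w : ι → L}
    (hw : LinearIndependent F w) :
    LinearIndependent (adjoin F (Set.range z)) fun i => algebraMap L K (w i) := by
  classical
  have := Fintype.ofFinite ι
  -- Clearing denominators reduces to coefficients that are polynomials in `z` over `F`. Algebraic
  -- independence over `L` then lets the relation be compared monomial by monomial.
  rw [← LinearIndependent.iff_fractionRing (Algebra.adjoin F (Set.range z)),
    Fintype.linearIndependent_iff]
  intro c hc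
  have hp : ∀ i, ∃ p : MvPolynomial σ F, MvPolynomial.aeval z p = (c i : K) := fun i => by
    exact (Algebra.adjoin_range_eq_range_aeval F z).le (c i).2
  choose p hp using hp
  have hq : ∑ i, MvPolynomial.C (w i) * MvPolynomial.map (algebraMap F L) (p i) = 0 := by
    apply hz
    rw [map_zero, map_sum, ← hc]
    refine Finset.sum_congr rfl fun i _ => ?_
    rw [map_mul, MvPolynomial.aeval_C, MvPolynomial.aeval_map_algebraMap, hp, mul_comm]
    rfl
  have hp0 : ∀ i, p i = 0 := by
    intro i
    ext d
    have h1 := congrArg (MvPolynomial.coeff d) hq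
    simp only [MvPolynomial.coeff_sum, MvPolynomial.coeff_C_mul, MvPolynomial.coeff_map,
      MvPolynomial.coeff_zero] at h1
    exact Fintype.linearIndependent_iff.mp hw (fun i => (p i).coeff d)
      (by rw [← h1]; exact Finset.sum_congr rfl fun i _ => by rw [Algebra.smul_def, mul_comm]) i
  intro i
  refine Subtype.ext ?_
  rw [← hp i, hp0 i, map_zero]
  rfl

/-- Independent elements of `L` over `F` stay independent over `F(z)`, so `[L : F] ≤ [K : F(z)]`. -/
lemma finiteDimensional_of_finiteDimensional_adjoin {F L K : Type*} [Field F] [Field L]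
    [Field K] [Algebra F L] [Algebra F K] [Algebra L K] [IsScalarTower F L K] {σ : Type*}
    {z : σ → K} (hz : AlgebraicIndependent L z) [FiniteDimensional (adjoin F (Set.range z)) K] :
    FiniteDimensional F L := by
  refine Module.rank_lt_aleph0_iff.mp (lt_of_le_of_lt (rank_le
    (n := Module.finrank (adjoin F (Set.range z)) K) ?_) Cardinal.natCast_lt_aleph0)
  intro s hs
  simpa using (hs.adjoin_of_algebraicIndependent hz).fintype_card_le_finrank

lemma finiteDimensional_adjoin_of_forall_mem {k F K : Type*} [Field k] [Field F] [Field K]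
    [Algebra k F] [Algebra k K] [Algebra F K] [IsScalarTower k F K] {T Z : Set K}
    (h : ∀ t ∈ T, t ∈ adjoin F Z) (hK : FiniteDimensional (adjoin k T) K) :
    FiniteDimensional (adjoin F Z) K := by
  have hle : adjoin k T ≤ (adjoin F Z).restrictScalars k := adjoin_le_iff.mpr h
  exact finiteDimensional_of_forall_exists_algebraMap_eq (A := adjoin k T)
    fun a => ⟨⟨a, hle a.2⟩, rfl⟩

/-- Transcendence bases of a subextension `L` of a finitely generated extension `K / k` and
of `K / L`. -/
lemma exists_transcendenceBases {k L K : Type*} [Field k] [Field L] [Field K] [Algebra k L]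
    [Algebra k K] [Algebra L K] [IsScalarTower k L K] {S : Set K} [Finite S]
    (hS : adjoin k S = ⊤) :
    ∃ (r s : ℕ) (x : Fin r → L) (z : Fin s → K), (∀ i, z i ∈ S) ∧ AlgebraicIndependent L z ∧
      AlgebraicIndependent k x ∧ FiniteDimensional (adjoin k (Set.range x)) L ∧
      ∃ w : Fin (s + r) → K, AlgebraicIndependent k w ∧
        FiniteDimensional (adjoin k (Set.range w)) K := by
  obtain ⟨s, z, hzS, hz⟩ := exists_isTranscendenceBasis_fin (adjoin_eq_top_of_tower hS L)
  obtain ⟨ι, x, hx⟩ := exists_isTranscendenceBasis' k L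
  obtain ⟨t, y, -, hy⟩ := exists_isTranscendenceBasis_fin hS
  have hsum := hx.sumElim_comp hz
  -- The combined basis has the cardinality of the finite basis `y` of `K / k`, which bounds the
  -- basis of `L`.
  have hfin : Finite (Fin s ⊕ ι) := by
    have h := hsum.lift_cardinalMk_eq hy
    rw [← Cardinal.mk_lt_aleph0_iff, ← Cardinal.lift_lt_aleph0, h, Cardinal.lift_lt_aleph0]
    exact Cardinal.mk_lt_aleph0
  have hι : Finite ι := Finite.of_injective (Sum.inr : ι → Fin s ⊕ ι) Sum.inr_injective
  obtain ⟨r, ⟨e⟩⟩ := Finite.exists_equiv_fin ι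
  replace hx := hx.comp_equiv e.symm
  replace hsum := hx.sumElim_comp hz
  refine ⟨r, s, _, z, hzS, hz.1, hx.1, ?_, _, (hsum.comp_equiv finSumFinEquiv.symm).1,
    finiteDimensional_of_isTranscendenceBasis hS (hsum.comp_equiv finSumFinEquiv.symm)⟩
  have hK := finiteDimensional_of_isTranscendenceBasis hS hsum
  have : FiniteDimensional (adjoin (adjoin k (Set.range (x ∘ e.symm))) (Set.range z)) K := by
    refine finiteDimensional_adjoin_of_forall_mem ?_ hK
    rintro _ ⟨i | i, rfl⟩
    · exact subset_adjoin _ _ ⟨i, rfl⟩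
    · have hi : (x ∘ e.symm) i ∈ adjoin k (Set.range (x ∘ e.symm)) := subset_adjoin k _ ⟨i, rfl⟩
      exact IntermediateField.algebraMap_mem (adjoin (adjoin k (Set.range (x ∘ e.symm))) (Set.range z)) ⟨_, hi⟩
  exact finiteDimensional_of_finiteDimensional_adjoin (K := K) hz.1

end BigDivisor

end

/-! ### Polynomial growth of powers of a subspace. -/

section

open IntermediateField

namespace BigDivisor

/-- For `t > 0`, on `t`-th roots this is `1 + (j + 1) = j + 2`. It is the inductive step for
iterating the linear inequality with one fixed factor. -/
lemma succ_pow_mul_le_bmFun (t j : ℕ) {a b : ℝ} (ha : 0 ≤ a) (hb : ((j : ℝ) + 1) ^ t * a ≤ b) :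
    ((j : ℝ) + 2) ^ t * a ≤ bmFun t a b := by
  refine le_trans ?_ (bmFun_mono t ha (by positivity) le_rfl hb)
  cases t with
  | zero => simp [bmFun]
  | succ t =>
    have h1 : ((j + 1 : ℝ) ^ (t + 1) * a) ^ (1 / ((t : ℝ) + 1)) =
        (j + 1) * a ^ (1 / ((t : ℝ) + 1)) := by
      rw [Real.mul_rpow (by positivity) ha, ← Real.rpow_natCast, ← Real.rpow_mul (by positivity)]
      push_cast
      rw [mul_one_div_cancel (by positivity), Real.rpow_one]
    have h2 : (a ^ (1 / ((t : ℝ) + 1))) ^ (t + 1) = a := by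
      rw [← Real.rpow_natCast, ← Real.rpow_mul ha]
      push_cast
      rw [one_div_mul_cancel (by positivity), Real.rpow_one]
    refine le_of_eq ?_
    simp only [bmFun]
    rw [h1]
    nth_rewrite 1 [← h2]
    rw [← mul_pow]
    ring

section Growth
variable {k K : Type*} [Field k] [Field K] [Algebra k K] {Y : Submodule k K}

lemma isFractionGenerating_of_adjoin_eq_top {ι : Type*} {y : ι → K} (hy : ∀ j, y j ∈ Y)
    (h1 : (1 : K) ∈ Y) (h : adjoin k (Set.range y) = ⊤) : IsFractionGenerating Y := by
  intro f
  have key : ∀ a ∈ Algebra.adjoin k (Set.range y), ∃ M, a ∈ Y ^ M := fun a ha => by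
    simpa using exists_mul_pow_mem_of_mem_adjoin hy h1 one_ne_zero (f := a) (by simpa using ha)
  obtain ⟨a, ha, b, hb, rfl⟩ := mem_adjoin_iff_div.mp (h ▸ mem_top : f ∈ adjoin k (Set.range y))
  by_cases hb0 : b = 0
  · exact ⟨0, 0, zero_mem _, 1, by simp, one_ne_zero, by simp [hb0]⟩
  obtain ⟨M, hM⟩ := key a ha
  obtain ⟨N, hN⟩ := key b hb
  exact ⟨max M N, a, pow_le_pow_of_one_mem h1 (le_max_left _ _) hM, b,
    pow_le_pow_of_one_mem h1 (le_max_right _ _) hN, hb0, rfl⟩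

lemma IsFractionGenerating.adjoin_eq_top (hY : IsFractionGenerating Y) {S : Set K}
    (hS : Y ≤ Submodule.span k S) : adjoin k S = ⊤ := by
  have h1 : Y ≤ Subalgebra.toSubmodule (adjoin k S).toSubalgebra :=
    hS.trans (Submodule.span_le.mpr (subset_adjoin k S))
  have h2 : ∀ c, Y ^ c ≤ Subalgebra.toSubmodule (adjoin k S).toSubalgebra := by
    intro c
    induction c with
    | zero =>
      rw [pow_zero, Submodule.one_le]
      exact one_mem (adjoin k S)
    | succ c ih =>
      rw [pow_succ, Submodule.mul_le]
      exact fun a ha b hb => mul_mem (S := IntermediateField k K) (ih ha) (h1 hb)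
  refine eq_top_iff.mpr fun f _ => ?_
  obtain ⟨c, a, ha, b, hb, -, rfl⟩ := hY f
  exact div_mem (h2 c ha) (h2 c hb)

/-- Multiplication by a nonzero element does not change dimensions. -/
lemma finrank_le_finrank_of_mul_mem {V W : Submodule k K} [FiniteDimensional k W] {g : K}
    (hg : g ≠ 0) (h : ∀ v ∈ V, v * g ∈ W) : Module.finrank k V ≤ Module.finrank k W :=
  LinearMap.finrank_le_finrank_of_injective
    (f := (LinearMap.mulRight k g).restrict (p := V) (q := W) h) fun a b hab => by
      have := congrArg Subtype.val hab
      exact Subtype.ext (mul_right_cancel₀ hg this)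

/-- Generators of `V` act by matrices over `F`, and `h` is a common denominator of the entries in
`Y₀ ^ c`. Multiplication by `h * v` raises the degree of coordinate vectors by `c`, so `V ^ m`,
times `h ^ m` and a basis vector, has coordinates in `Y₀ ^ (c * m)`. -/
lemma finrank_pow_le_of_finiteDimensional {F : Type*} [Field F] [Algebra k F] [Algebra F K]
    [IsScalarTower k F K] [FiniteDimensional F K] {Y₀ : Submodule k F} [FiniteDimensional k Y₀]
    (hY₀ : IsFractionGenerating Y₀) (V : Submodule k K) [hV : FiniteDimensional k V] :
    ∃ c d : ℕ, ∀ m, Module.finrank k (V ^ m : Submodule k K) ≤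
      d * Module.finrank k (Y₀ ^ (c * m) : Submodule k F) := by
  classical
  obtain ⟨s, hs⟩ := Module.Finite.iff_fg.mp hV
  let b := Module.finBasis F K
  obtain ⟨c, h, -, h0, hc⟩ := hY₀.exists_common_denominator
    (s.biUnion fun v => Finset.univ.biUnion fun l => Finset.univ.image fun l' =>
      b.repr (v * b l) l')
  let M : ℕ → Submodule k K := fun j =>
    ⨅ l, (Y₀ ^ j).comap ((b.coord l).restrictScalars k)
  have hM : ∀ {j z}, z ∈ M j ↔ ∀ l, b.repr z l ∈ Y₀ ^ j := by
    intro j z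
    simp [M, Submodule.mem_iInf]
  have hstep : ∀ v ∈ V, ∀ j, ∀ z ∈ M j, algebraMap F K h * v * z ∈ M (c + j) := by
    intro v hv j z hz
    rw [← hs] at hv
    induction hv using Submodule.span_induction with
    | zero => simp
    | add u v _ _ hu hv => rw [mul_add, add_mul]; exact add_mem hu hv
    | smul a v _ hv =>
      rw [mul_smul_comm, smul_mul_assoc]
      exact Submodule.smul_mem _ _ hv
    | mem v hv =>
      rw [hM] at hz ⊢
      intro l'
      have : algebraMap F K h * v * z = ∑ l, (h * b.repr z l) • (v * b l) := by
        conv_lhs => rw [← b.sum_repr z, Finset.mul_sum]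
        refine Finset.sum_congr rfl fun l _ => ?_
        simp only [Algebra.smul_def, map_mul]
        ring
      rw [this, map_sum, Finsupp.finsetSum_apply]
      refine Submodule.sum_mem _ fun l _ => ?_
      rw [map_smul, Finsupp.smul_apply, smul_eq_mul, mul_right_comm, pow_add]
      refine Submodule.mul_mem_mul (hc _ ?_) (hz l)
      simp only [Finset.mem_biUnion, Finset.mem_image, Finset.mem_univ, true_and]
      exact ⟨v, hv, l, l', rfl⟩
  obtain ⟨l₀⟩ : Nonempty (Fin (Module.finrank F K)) := ⟨⟨0, Module.finrank_pos⟩⟩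
  have hpow : ∀ m, ∀ v ∈ V ^ m, v * (algebraMap F K h ^ m * b l₀) ∈ M (c * m) := by
    intro m
    induction m with
    | zero =>
      intro v hv
      rw [pow_zero, Submodule.mem_one] at hv
      obtain ⟨a, rfl⟩ := hv
      rw [hM]
      intro l
      rw [pow_zero, one_mul, mul_zero, pow_zero, ← Algebra.smul_def,
        ← algebraMap_smul F a (b l₀), map_smul, Finsupp.smul_apply, b.repr_self, smul_eq_mul,
        Finsupp.single_apply]
      split_ifs
      · rw [mul_one]; exact Submodule.mem_one.mpr ⟨a, rfl⟩
      · rw [mul_zero]; exact zero_mem _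
    | succ m ih =>
      intro v hv
      rw [pow_succ'] at hv
      induction hv using Submodule.mul_induction_on' with
      | mem_mul_mem u hu v hv =>
        have := hstep u hu _ _ (ih v hv)
        rw [mul_add_one, add_comm]
        convert this using 1
        ring
      | add u _ v _ hu hv => rw [add_mul]; exact add_mem hu hv
  refine ⟨c, Module.finrank F K, fun m => ?_⟩
  let φ : M (c * m) →ₗ[k] (Fin (Module.finrank F K) → (Y₀ ^ (c * m) : Submodule k F)) :=
    LinearMap.pi fun l => ((b.coord l).restrictScalars k).restrict fun z hz => hM.mp hz l
  have hφ : Function.Injective φ := by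
    intro u v huv
    refine Subtype.ext (b.repr.injective (Finsupp.ext fun l => ?_))
    exact congrArg Subtype.val (congrFun huv l)
  have := FiniteDimensional.of_injective φ hφ
  calc Module.finrank k (V ^ m : Submodule k K) ≤ Module.finrank k (M (c * m)) :=
        finrank_le_finrank_of_mul_mem (mul_ne_zero (pow_ne_zero _ (by simpa using h0))
          (b.ne_zero l₀)) (hpow m)
    _ ≤ _ := LinearMap.finrank_le_finrank_of_injective hφ
    _ = _ := by rw [Module.finrank_pi_fintype]; simp

lemma finrank_span_option_pow_le {t : ℕ} (x : Fin t → K) (m : ℕ) :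
    Module.finrank k (Submodule.span k (Set.range fun o : Option (Fin t) => o.elim 1 x) ^ m :
      Submodule k K) ≤ (m + 1) ^ t := by
  let f : (Fin t → Fin (m + 1)) → K := fun α => ∏ i, x i ^ (α i : ℕ)
  have hle : Submodule.span k (Set.range fun o : Option (Fin t) => o.elim 1 x) ^ m ≤
      Submodule.span k (Set.range f) := by
    refine (span_range_pow_le _ m).trans (Submodule.span_mono ?_)
    rintro _ ⟨d, hd, rfl⟩
    rw [Fintype.sum_option] at hd
    refine ⟨fun i => ⟨d (some i), ?_⟩, ?_⟩
    · have := Finset.single_le_sum (f := fun i => d (some i)) (fun _ _ => Nat.zero_le _)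
        (Finset.mem_univ i)
      omega
    · simp [f, Fintype.prod_option]
  have := FiniteDimensional.span_of_finite k (Set.finite_range f)
  calc _ ≤ Module.finrank k (Submodule.span k (Set.range f)) := Submodule.finrank_mono hle
    _ ≤ Fintype.card (Fin t → Fin (m + 1)) := finrank_range_le_card f
    _ = _ := by simp

/-- The powers of a finite dimensional subspace of a finitely generated extension of
transcendence degree `t` grow at most like a polynomial of degree `t`. -/
lemma exists_finrank_pow_le {t : ℕ} (x : Fin t → K)
    [FiniteDimensional (adjoin k (Set.range x)) K] (V : Submodule k K) [FiniteDimensional k V] :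
    ∃ C : ℕ, ∀ m, Module.finrank k (V ^ m : Submodule k K) ≤ C * (m + 1) ^ t := by
  let x' : Fin t → adjoin k (Set.range x) := fun i => ⟨x i, subset_adjoin k _ ⟨i, rfl⟩⟩
  have hx' : adjoin k (Set.range x') = ⊤ := by
    apply lift_injective
    rw [lift_adjoin, lift_top, ← Set.range_comp]
    rfl
  let y : Option (Fin t) → adjoin k (Set.range x) := fun o => o.elim 1 x'
  have : FiniteDimensional k (Submodule.span k (Set.range y)) :=
    FiniteDimensional.span_of_finite k (Set.finite_range y)
  obtain ⟨c, d, h⟩ := finrank_pow_le_of_finiteDimensional (Y₀ := Submodule.span k (Set.range y))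
    (isFractionGenerating_of_adjoin_eq_top (y := x')
      (fun i => Submodule.subset_span ⟨some i, rfl⟩) (Submodule.subset_span ⟨none, rfl⟩) hx') V
  refine ⟨d * (c + 1) ^ t, fun m => (h m).trans ?_⟩
  rw [mul_assoc, ← mul_pow]
  refine Nat.mul_le_mul_left _ ((finrank_span_option_pow_le x' _).trans
    (Nat.pow_le_pow_left ?_ t))
  nlinarith

end Growth

end BigDivisor

end

/-! ### Growth of saturated powers and of graded linear series. -/

section

open IntermediateField

namespace BigDivisor

section Saturation
variable {k K : Type*} [Field k] [Field K] [Algebra k K] {Y : Submodule k K}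

lemma IsFractionGenerating.exists_mul_le (hY : IsFractionGenerating Y) (E : Submodule k K)
    [hE : FiniteDimensional k E] : ∃ c, ∃ h ≠ 0, ∀ x ∈ E, h * x ∈ Y ^ c := by
  obtain ⟨s, hs⟩ := Module.Finite.iff_fg.mp hE
  obtain ⟨c, h, -, h0, hc⟩ := hY.exists_common_denominator s
  refine ⟨c, h, h0, fun x hx => ?_⟩
  have : E ≤ (Y ^ c).comap (LinearMap.mulLeft k h) := by
    rw [← hs, Submodule.span_le]
    exact hc
  exact this hx

lemma exists_forall_mul_mem_of_le_satPow {m : ℕ} (V : Submodule k K) [hV : FiniteDimensional k V]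
    (h : V ≤ satPow Y m) : ∃ M₀, ∀ v ∈ V, ∀ M ≥ M₀, ∀ g ∈ Y ^ M, v * g ∈ Y ^ (m + M) := by
  classical
  obtain ⟨s, hs⟩ := Module.Finite.iff_fg.mp hV
  have hs' : ∀ v ∈ s, v ∈ satPow Y m := fun v hv => h (hs ▸ Submodule.subset_span hv)
  choose! M hM using hs'
  refine ⟨s.sup M, fun v hv N hN g hg => ?_⟩
  have : V ≤ (Y ^ (m + N)).comap (LinearMap.mulRight k g) := by
    rw [← hs, Submodule.span_le]
    exact fun w hw => hM w hw N ((Finset.le_sup hw).trans hN) g hg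
  exact this hv

/-- The dimension of the saturated powers of `Y` grows at most like that of the powers. -/
lemma exists_finrank_le_of_le_satPow (hY : IsFractionGenerating Y) (h1 : (1 : K) ∈ Y)
    [FiniteDimensional k Y] {t C : ℕ} (hBM : LinearBM t k K)
    (hC : ∀ m, Module.finrank k (Y ^ m : Submodule k K) ≤ C * (m + 1) ^ t) :
    ∃ C' : ℕ, ∀ m (V : Submodule k K), FiniteDimensional k V → V ≤ satPow Y m →
      Module.finrank k V ≤ C' * (m + 1) ^ t := by
  obtain ⟨E, hE, hEBM⟩ := hBM
  obtain ⟨e, h, h0, he⟩ := hY.exists_mul_le E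
  refine ⟨C * (e + 1) ^ t, fun m V _ hVm => ?_⟩
  by_cases hV : V = ⊥
  · rw [hV, finrank_bot]
    exact Nat.zero_le _
  have hVpos : 0 < Module.finrank k V :=
    Nat.pos_of_ne_zero fun h => hV (Submodule.finrank_eq_zero.mp h)
  -- The threshold `j` beyond which `V` multiplies powers of `Y` correctly depends on `V`. It is
  -- also used as the number of iterations, so that its contribution cancels below.
  obtain ⟨j, hj⟩ := exists_forall_mul_mem_of_le_satPow V hVm
  -- Lower bound from iterating the linear inequality.
  have hlow : ∀ i : ℕ, ((i : ℝ) + 1) ^ t * Module.finrank k V ≤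
      Module.finrank k ((E * V) ^ i * V : Submodule k K) := by
    intro i
    induction i with
    | zero =>
      rw [pow_zero, one_mul]
      simp
    | succ i ih =>
      have hne : ((E * V) ^ i * V : Submodule k K) ≠ ⊥ := by
        intro h
        rw [h, finrank_bot] at ih
        have : 0 < ((i : ℝ) + 1) ^ t * Module.finrank k V := by positivity
        norm_num at ih
        linarith
      have := (succ_pow_mul_le_bmFun t i (Nat.cast_nonneg _) ih).trans
        (hEBM V ((E * V) ^ i * V) inferInstance inferInstance hV hne)
      rw [← mul_assoc, ← pow_succ'] at this
      push_cast
      rwa [add_assoc, one_add_one_eq_two]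
  -- Upper bound: `h` pushes `E` into `Y ^ e`, and each factor `V` costs `m` degrees because the
  -- power to its right is already at least `j`.
  have hup : ∀ i : ℕ, ∀ w ∈ ((E * V) ^ i * V : Submodule k K),
      w * h ^ i ∈ Y ^ ((i + 1) * m + i * e + j) := by
    intro i
    induction i with
    | zero =>
      intro w hw
      rw [pow_zero, one_mul] at hw
      simpa using hj w hw j le_rfl 1 (by
        simpa using Submodule.pow_mem_pow _ h1 j)
    | succ i ih =>
      intro w hw
      rw [pow_succ', mul_assoc, mul_assoc] at hw
      induction hw using Submodule.mul_induction_on' with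
      | add u _ v _ hu hv => rw [add_mul u v]; exact add_mem hu hv
      | mem_mul_mem ε hε w hw =>
        induction hw using Submodule.mul_induction_on' with
        | add u _ v _ hu hv => rw [mul_add ε, add_mul (ε * u)]; exact add_mem hu hv
        | mem_mul_mem v hv w hw =>
          have h3 := Submodule.mul_mem_mul (he ε hε)
            (hj v hv _ (Nat.le_add_left j _) _ (ih w hw))
          rw [← pow_add] at h3
          have e1 : ε * (v * w) * h ^ (i + 1) = h * ε * (v * (w * h ^ i)) := by ring
          have e2 : (i + 1 + 1) * m + (i + 1) * e + j = e + (m + ((i + 1) * m + i * e + j)) := by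
            ring
          rw [e1, e2]
          exact h3
  have h3 : Module.finrank k ((E * V) ^ j * V : Submodule k K) ≤
      C * ((j + 1) * (m + e + 1)) ^ t := by
    refine (finrank_le_finrank_of_mul_mem (pow_ne_zero j h0) (hup j)).trans ((hC _).trans ?_)
    refine Nat.mul_le_mul_left _ (Nat.pow_le_pow_left ?_ t)
    nlinarith
  -- At `i = j` both bounds carry the factor `(j + 1) ^ t`; cancelling it leaves a bound uniform in
  -- `V`.
  have h4 : (j + 1) ^ t * Module.finrank k V ≤ C * ((j + 1) * (m + e + 1)) ^ t := by
    have := (hlow j).trans (Nat.cast_le.mpr h3)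
    exact_mod_cast this
  have h5 : Module.finrank k V ≤ C * (m + e + 1) ^ t := by
    rw [mul_pow, mul_left_comm] at h4
    exact Nat.le_of_mul_le_mul_left h4 (by positivity)
  refine h5.trans ?_
  rw [mul_assoc, ← mul_pow]
  refine Nat.mul_le_mul_left _ (Nat.pow_le_pow_left ?_ t)
  nlinarith

end Saturation

/-- A graded linear series: a graded subalgebra of `K[T]`. -/
structure LinearSeries (k K : Type*) [Field k] [Field K] [Algebra k K] where
  /-- the graded pieces -/
  L : ℕ → Submodule k K
  one_mem : (1 : K) ∈ L 0
  mul_mem : ∀ {a b : ℕ} {f g : K}, f ∈ L a → g ∈ L b → f * g ∈ L (a + b)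

namespace LinearSeries
variable {k K : Type*} [Field k] [Field K] [Algebra k K] (Λ : LinearSeries k K)

lemma pow_mem {a : ℕ} {f : K} (hf : f ∈ Λ.L a) (n : ℕ) : f ^ n ∈ Λ.L (n * a) := by
  induction n with
  | zero => simpa using Λ.one_mem
  | succ n ih =>
    rw [pow_succ, add_one_mul]
    exact Λ.mul_mem ih hf

/-- The field of ratios of elements of the same degree. -/
def ratioField : IntermediateField k K where
  carrier := {z | ∃ a, ∃ f ∈ Λ.L a, ∃ g ∈ Λ.L a, g ≠ 0 ∧ z = f / g}
  mul_mem' := by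
    rintro _ _ ⟨a, f, hf, g, hg, hg0, rfl⟩ ⟨a', f', hf', g', hg', hg0', rfl⟩
    exact ⟨a + a', f * f', Λ.mul_mem hf hf', g * g', Λ.mul_mem hg hg', mul_ne_zero hg0 hg0',
      div_mul_div_comm _ _ _ _⟩
  add_mem' := by
    rintro _ _ ⟨a, f, hf, g, hg, hg0, rfl⟩ ⟨a', f', hf', g', hg', hg0', rfl⟩
    exact ⟨a + a', f * g' + g * f', add_mem (Λ.mul_mem hf hg') (Λ.mul_mem hg hf'), g * g',
      Λ.mul_mem hg hg', mul_ne_zero hg0 hg0', div_add_div _ _ hg0 hg0'⟩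
  algebraMap_mem' := fun c => ⟨0, algebraMap k K c, by
    rw [Algebra.algebraMap_eq_smul_one]; exact Submodule.smul_mem _ _ Λ.one_mem, 1, Λ.one_mem,
    one_ne_zero, (div_one _).symm⟩
  inv_mem' := by
    rintro _ ⟨a, f, hf, g, hg, hg0, rfl⟩
    by_cases hf0 : f = 0
    · exact ⟨0, 0, zero_mem _, 1, Λ.one_mem, one_ne_zero, by simp [hf0]⟩
    · exact ⟨a, g, hg, f, hf, hf0, inv_div _ _⟩

lemma div_mem_ratioField {a : ℕ} {f g : K} (hf : f ∈ Λ.L a) (hg : g ∈ Λ.L a) :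
    f / g ∈ Λ.ratioField := by
  by_cases hg0 : g = 0
  · rw [hg0, div_zero]
    exact zero_mem _
  · exact ⟨a, f, hf, g, hg, hg0, rfl⟩

lemma exists_common_denominator (s : Finset K) (hs : ∀ z ∈ s, z ∈ Λ.ratioField) :
    ∃ a, ∃ h ∈ Λ.L a, h ≠ 0 ∧ ∀ z ∈ s, h * z ∈ Λ.L a := by
  classical
  induction s using Finset.induction_on with
  | empty => exact ⟨0, 1, Λ.one_mem, one_ne_zero, by simp⟩
  | insert e s _ ih =>
    obtain ⟨a, h, ha, h0, hs'⟩ := ih fun z hz => hs z (Finset.mem_insert_of_mem hz)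
    obtain ⟨c, f, hf, g, hg, hg0, he⟩ := hs e (Finset.mem_insert_self _ _)
    refine ⟨a + c, h * g, Λ.mul_mem ha hg, mul_ne_zero h0 hg0, fun z hz => ?_⟩
    obtain rfl | hz := Finset.mem_insert.mp hz
    · rw [he, mul_assoc, mul_div_cancel₀ _ hg0]
      exact Λ.mul_mem ha hf
    · rw [mul_right_comm]
      exact Λ.mul_mem (hs' z hz) hg

/-- Monomials in algebraically independent elements are linearly independent. -/
lemma _root_.AlgebraicIndependent.linearIndependent_prod_pow {F K : Type*} [Field F] [Field K]
    [Algebra F K] {s : ℕ} {z : Fin s → K} (hz : AlgebraicIndependent F z) (m : ℕ) :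
    LinearIndependent F fun α : Fin s → Fin m => ∏ i, z i ^ (α i : ℕ) := by
  have h1 := (MvPolynomial.basisMonomials (Fin s) F).linearIndependent.map'
    (MvPolynomial.aeval (R := F) z).toLinearMap (LinearMap.ker_eq_bot.mpr hz)
  have h2 := h1.comp (fun α : Fin s → Fin m => Finsupp.equivFunOnFinite.symm fun i => (α i : ℕ))
    fun α β h => by
      funext i
      exact Fin.ext (congrFun (Finsupp.equivFunOnFinite.symm.injective h) i)
  have heq : ((MvPolynomial.aeval (R := F) z).toLinearMap ∘ MvPolynomial.basisMonomials (Fin s) F) ∘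
      (fun α : Fin s → Fin m => Finsupp.equivFunOnFinite.symm fun i => (α i : ℕ)) =
      fun α : Fin s → Fin m => ∏ i, z i ^ (α i : ℕ) := by
    funext α
    simp [MvPolynomial.aeval_monomial, Finsupp.prod_fintype]
  exact heq ▸ h2

/-- After division by one `g`, `V` lies in the field of ratios, so its products with the `(m + 1) ^
s` monomials in `z` are independent over `k`. Multiplied by `g * h ^ m` they fit into `satPow Y ((e
+ s) * m)`; cancelling `(m + 1) ^ s` from the bound of degree `s + r` leaves degree `r`. -/
lemma exists_finrank_le_of_algebraicIndependent {Y : Submodule k K} (h1 : (1 : K) ∈ Y)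
    {s r C : ℕ}
    (hC : ∀ m (V : Submodule k K), FiniteDimensional k V → V ≤ satPow Y m →
      Module.finrank k V ≤ C * (m + 1) ^ (s + r))
    {z : Fin s → K} (hzY : ∀ i, z i ∈ Y) (hz : AlgebraicIndependent Λ.ratioField z)
    {e : ℕ} {h : K} (h0 : h ≠ 0) (he : ∀ m, ∀ f ∈ Λ.L m, f * h ^ m ∈ satPow Y (e * m)) :
    ∃ C' : ℕ, ∀ m (V : Submodule k K), FiniteDimensional k V → V ≤ Λ.L m →
      Module.finrank k V ≤ C' * (m + 1) ^ r := by
  refine ⟨C * (e + s + 1) ^ (s + r), fun m V _ hV => ?_⟩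
  by_cases hbot : V = ⊥
  · rw [hbot, finrank_bot]
    exact Nat.zero_le _
  obtain ⟨g, hg, hg0⟩ := V.ne_bot_iff.mp hbot
  let b := Module.finBasis k V
  let w : Fin (Module.finrank k V) → Λ.ratioField := fun i =>
    ⟨(b i : K) / g, Λ.div_mem_ratioField (hV (b i).2) (hV hg)⟩
  have hw : LinearIndependent k w := by
    have hb : LinearIndependent k fun i => (b i : K) :=
      b.linearIndependent.map' V.subtype (Submodule.ker_subtype V)
    refine LinearIndependent.of_comp (LinearMap.mulRight k g ∘ₗ Λ.ratioField.val.toLinearMap) ?_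
    have heq : (LinearMap.mulRight k g ∘ₗ Λ.ratioField.val.toLinearMap) ∘ w = fun i => (b i : K) :=
      funext fun i => div_mul_cancel₀ _ hg0
    exact heq ▸ hb
  have hli := linearIndependent_smul hw (hz.linearIndependent_prod_pow (m + 1))
  have hinj : LinearMap.ker (LinearMap.mulRight k (g * h ^ m)) = ⊥ :=
    LinearMap.ker_eq_bot.mpr fun x y hxy => mul_right_cancel₀ (mul_ne_zero hg0 (pow_ne_zero _ h0)) hxy
  replace hli := hli.map' _ hinj
  have hmem : ∀ p, (LinearMap.mulRight k (g * h ^ m) ∘ fun p : Fin (Module.finrank k V) ×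
      (Fin s → Fin (m + 1)) => w p.1 • ∏ i, z i ^ (p.2 i : ℕ)) p ∈ satPow Y ((e + s) * m) := by
    rintro ⟨i, α⟩
    have h2 : (∏ i, z i ^ (α i : ℕ)) ∈ satPow Y (s * m) := by
      refine pow_le_satPow _ (pow_le_pow_of_one_mem h1 ?_ (prod_pow_mem_pow_sum hzY Finset.univ _))
      calc ∑ i, (α i : ℕ) ≤ ∑ _i : Fin s, m := Finset.sum_le_sum fun i _ => Nat.lt_succ_iff.mp (α i).2
        _ = s * m := by simp
    have h3 := mul_mem_satPow (he m _ (hV (b i).2)) h2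
    rw [← add_mul] at h3
    convert h3 using 1
    change (b i : K) / g * (∏ i, z i ^ (α i : ℕ)) * (g * h ^ m) = _
    field_simp
  have hspan := Submodule.span_le.mpr (Set.range_subset_iff.mpr hmem)
  have hfin := FiniteDimensional.span_of_finite k (Set.finite_range
    (LinearMap.mulRight k (g * h ^ m) ∘ fun p : Fin (Module.finrank k V) ×
      (Fin s → Fin (m + 1)) => w p.1 • ∏ i, z i ^ (p.2 i : ℕ)))
  have hle := hC _ _ hfin hspan
  rw [finrank_span_eq_card hli] at hle
  simp only [Fintype.card_prod, Fintype.card_fin, Fintype.card_fun] at hle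
  have h4 : C * ((e + s) * m + 1) ^ (s + r) ≤
      C * ((e + s + 1) ^ (s + r) * ((m + 1) ^ s * (m + 1) ^ r)) := by
    rw [← pow_add, ← mul_pow]
    refine Nat.mul_le_mul_left _ (Nat.pow_le_pow_left ?_ _)
    nlinarith
  refine Nat.le_of_mul_le_mul_right (c := (m + 1) ^ s) ((hle.trans h4).trans (le_of_eq ?_))
    (by positivity)
  ring

end LinearSeries

end BigDivisor

end

/-! ### The Brunn-Minkowski inequality inside a graded linear series. -/

section

open IntermediateField

namespace BigDivisor

/-- Superadditivity of `t ↦ t ^ (r / n)` for `r / n ≥ 1` weakens the inequality for `r`-th roots to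
the one for `n`-th roots. -/
lemma rpow_add_rpow_le_of_bmFun_le {n r : ℕ} (hn : 0 < n) (hr : n ≤ r) {a b c : ℝ} (ha : 0 ≤ a)
    (hb : 0 ≤ b) (h : bmFun r a b ≤ c) :
    a ^ (1 / (n : ℝ)) + b ^ (1 / (n : ℝ)) ≤ c ^ (1 / (n : ℝ)) := by
  obtain ⟨r, rfl⟩ := Nat.exists_eq_succ_of_ne_zero (by omega : r ≠ 0)
  have hn' : (0 : ℝ) < n := by exact_mod_cast hn
  have hr' : (0 : ℝ) < (r : ℝ) + 1 := by positivity
  have hp : 1 ≤ ((r : ℝ) + 1) * (1 / n) := by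
    rw [mul_one_div, one_le_div hn']
    exact_mod_cast hr
  have hroot : ∀ {a : ℝ}, 0 ≤ a →
      (a ^ (1 / ((r : ℝ) + 1))) ^ (((r : ℝ) + 1) * (1 / n)) = a ^ (1 / (n : ℝ)) := by
    intro a ha
    rw [← Real.rpow_mul ha, ← mul_assoc, one_div_mul_cancel hr'.ne', one_mul]
  rw [← hroot ha, ← hroot hb]
  refine (Real.add_rpow_le_rpow_add (by positivity) (by positivity) hp).trans ?_
  rw [Real.rpow_mul (by positivity)]
  refine Real.rpow_le_rpow (by positivity) (le_trans (le_of_eq ?_) h) (by positivity)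
  simp only [bmFun]
  rw [← Real.rpow_natCast]
  push_cast
  rfl

namespace LinearSeries
variable {k K : Type*} [Field k] [Field K] [Algebra k K] (Λ : LinearSeries k K)

/-- The graded pieces of `Λ` grow at most like a polynomial of degree `r`. -/
def HasGrowth (r C : ℕ) : Prop :=
  ∀ m, FiniteDimensional k (Λ.L m) ∧ Module.finrank k (Λ.L m) ≤ C * (m + 1) ^ r

lemma hasGrowth_of_forall_finrank_le {r C : ℕ} (h : ∀ m (V : Submodule k K),
    FiniteDimensional k V → V ≤ Λ.L m → Module.finrank k V ≤ C * (m + 1) ^ r) :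
    Λ.HasGrowth r C := by
  intro m
  have hfin : FiniteDimensional k (Λ.L m) := by
    refine Module.rank_lt_aleph0_iff.mp (lt_of_le_of_lt (rank_le (n := C * (m + 1) ^ r) ?_)
      Cardinal.natCast_lt_aleph0)
    intro s hs
    have hli : LinearIndependent k fun i : s => ((i : Λ.L m) : K) :=
      hs.map' (Λ.L m).subtype (Submodule.ker_subtype _)
    have := h m _ (FiniteDimensional.span_of_finite k (Set.finite_range fun i : s => ((i : Λ.L m) : K)))
      (Submodule.span_le.mpr (Set.range_subset_iff.mpr fun i => (i : Λ.L m).2))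
    rw [finrank_span_eq_card hli] at this
    simpa using this
  exact ⟨hfin, h m _ hfin le_rfl⟩

/-- A graded linear series dominated by the powers of `Y` grows at most like a polynomial of
degree the transcendence degree of its field of ratios. -/
theorem exists_hasGrowth_and_linearBM {ι : Type*} [Finite ι] {y : ι → K}
    (hY : IsFractionGenerating (Submodule.span k (Set.range y)))
    (h1 : (1 : K) ∈ Submodule.span k (Set.range y)) {e : ℕ} {h : K} (h0 : h ≠ 0)
    (he : ∀ m, ∀ f ∈ Λ.L m, f * h ^ m ∈ satPow (Submodule.span k (Set.range y)) (e * m)) :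
    ∃ r C, Λ.HasGrowth r C ∧ LinearBM r k Λ.ratioField := by
  -- Here `K` has transcendence degree `s + r` over `k` and the field of ratios has `r`. The `s`
  -- complementary elements `z` are chosen among the coordinates, so they lie in `Y`.
  obtain ⟨r, s, x, z, hzS, hz, hx, hxfin, w, hw, hwfin⟩ :=
    exists_transcendenceBases (L := Λ.ratioField) (hY.adjoin_eq_top le_rfl)
  have := FiniteDimensional.span_of_finite k (Set.finite_range y)
  obtain ⟨C, hC⟩ := exists_finrank_pow_le w (Submodule.span k (Set.range y))
  obtain ⟨C', hC'⟩ := exists_finrank_le_of_le_satPow hY h1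
    (linearBM_of_algebraicIndependent _ w hw hwfin) hC
  obtain ⟨C'', hC''⟩ := Λ.exists_finrank_le_of_algebraicIndependent h1 hC'
    (fun i => Submodule.subset_span (hzS i)) hz h0 he
  exact ⟨r, C'', Λ.hasGrowth_of_forall_finrank_le hC'',
    linearBM_of_algebraicIndependent _ x hx hxfin⟩

lemma exists_comap_of_div_mem (L : IntermediateField k K) {V : Submodule k K}
    (hVL : ∀ v ∈ V, ∀ w ∈ V, v / w ∈ L) (hV : V ≠ ⊥) :
    ∃ (V' : Submodule k L) (g : K), g ≠ 0 ∧ (∀ v ∈ V', (v : K) * g ∈ V) ∧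
      V.map (LinearMap.mulRight k g⁻¹) = V'.map L.val.toLinearMap := by
  obtain ⟨g, hg, hg0⟩ := V.ne_bot_iff.mp hV
  refine ⟨(V.map (LinearMap.mulRight k g⁻¹)).comap L.val.toLinearMap, g, hg0, ?_, ?_⟩
  · rintro v ⟨u, hu, huv⟩
    change u * g⁻¹ = (v : K) at huv
    rwa [← huv, inv_mul_cancel_right₀ hg0]
  · rw [Submodule.map_comap_eq_self]
    rintro _ ⟨v, hv, rfl⟩
    exact ⟨⟨_, hVL v hv g hg⟩, div_eq_mul_inv v g⟩

/-- The Brunn-Minkowski inequality for subspaces whose ratios lie in the field of ratios of `Λ`. -/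
theorem exists_rpow_add_rpow_le {n r : ℕ} (hn : 0 < n) (hr : n ≤ r)
    (hBM : LinearBM r k Λ.ratioField) :
    ∃ a, Λ.L a ≠ ⊥ ∧ ∃ S ≤ Λ.L a, FiniteDimensional k S ∧ ∀ V W : Submodule k K,
      FiniteDimensional k V → FiniteDimensional k W → V ≠ ⊥ → W ≠ ⊥ →
      (∀ v ∈ V, ∀ w ∈ V, v / w ∈ Λ.ratioField) → (∀ v ∈ W, ∀ w ∈ W, v / w ∈ Λ.ratioField) →
      (Module.finrank k V : ℝ) ^ (1 / (n : ℝ)) + (Module.finrank k W : ℝ) ^ (1 / (n : ℝ)) ≤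
        (Module.finrank k (S * V * W : Submodule k K) : ℝ) ^ (1 / (n : ℝ)) := by
  classical
  obtain ⟨E, hE, hEBM⟩ := hBM
  let ι := Λ.ratioField.val
  obtain ⟨s, hs⟩ := Module.Finite.iff_fg.mp hE
  -- Multiplying by a common denominator `h` of generators moves `E` into degree `a`; `S` is `h *
  -- E`.
  obtain ⟨a, h, ha, h0, hmem⟩ := Λ.exists_common_denominator (s.image ι) (by
    intro z hz
    obtain ⟨w, -, rfl⟩ := Finset.mem_image.mp hz
    exact w.2)
  refine ⟨a, (Submodule.ne_bot_iff _).mpr ⟨h, ha, h0⟩,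
    (E.map ι.toLinearMap).map (LinearMap.mulLeft k h), ?_, inferInstance, ?_⟩
  · rw [← hs, Submodule.map_span, Submodule.map_span, Submodule.span_le]
    rintro _ ⟨_, ⟨w, hw, rfl⟩, rfl⟩
    exact hmem _ (Finset.mem_image_of_mem _ hw)
  intro V W _ _ hV hW hVL hWL
  obtain ⟨V', g, hg0, hV', hVmap⟩ := exists_comap_of_div_mem _ hVL hV
  obtain ⟨W', g', hg0', hW', hWmap⟩ := exists_comap_of_div_mem _ hWL hW
  have hinj : Function.Injective ι.toLinearMap := ι.injective
  have hfin : ∀ {V : Submodule k K} {V' : Submodule k Λ.ratioField} {g : K}, g ≠ 0 →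
      FiniteDimensional k V →
      V.map (LinearMap.mulRight k g⁻¹) = V'.map ι.toLinearMap →
      FiniteDimensional k V' ∧ Module.finrank k V' = Module.finrank k V := by
    intro V V' g hg0 _ hmap
    have e1 := Submodule.equivMapOfInjective ι.toLinearMap hinj V'
    have e2 := Submodule.equivMapOfInjective (LinearMap.mulRight k g⁻¹)
      (fun x y hxy => mul_right_cancel₀ (inv_ne_zero hg0) hxy) V
    rw [hmap] at e2
    exact ⟨Module.Finite.equiv (e2.trans e1.symm), (e1.trans e2.symm).finrank_eq⟩
  obtain ⟨hfV, hrV⟩ := hfin hg0 inferInstance hVmap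
  obtain ⟨hfW, hrW⟩ := hfin hg0' inferInstance hWmap
  have hpos : ∀ {V : Submodule k K}, FiniteDimensional k V → V ≠ ⊥ → Module.finrank k V ≠ 0 :=
    fun _ hV h => hV (Submodule.finrank_eq_zero.mp h)
  have hne : ∀ {V' : Submodule k Λ.ratioField}, Module.finrank k V' ≠ 0 → V' ≠ ⊥ := by
    rintro _ h rfl
    exact h (finrank_bot _ _)
  have key := hEBM V' W' hfV hfW (hne (hrV ▸ hpos inferInstance hV))
    (hne (hrW ▸ hpos inferInstance hW))
  rw [hrV, hrW] at key
  refine rpow_add_rpow_le_of_bmFun_le hn hr (Nat.cast_nonneg _) (Nat.cast_nonneg _) (key.trans ?_)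
  norm_cast
  rw [(Submodule.equivMapOfInjective ι.toLinearMap hinj (E * V' * W')).finrank_eq]
  refine finrank_le_finrank_of_mul_mem (mul_ne_zero h0 (mul_ne_zero hg0 hg0')) ?_
  rintro _ ⟨x, hx, rfl⟩
  change (x : K) * (h * (g * g')) ∈ _
  induction hx using Submodule.mul_induction_on' with
  | add u _ v _ hu hv => push_cast; rw [add_mul]; exact add_mem hu hv
  | mem_mul_mem u hu w hw =>
    induction hu using Submodule.mul_induction_on' with
    | add u _ v _ hu hv => rw [add_mul]; push_cast at *; rw [add_mul]; exact add_mem hu hv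
    | mem_mul_mem ε hε v hv =>
      have h3 := Submodule.mul_mem_mul (Submodule.mul_mem_mul
        (Submodule.mem_map_of_mem (f := LinearMap.mulLeft k h)
          (Submodule.mem_map_of_mem (f := ι.toLinearMap) hε)) (hV' v hv)) (hW' w hw)
      convert h3 using 1
      change (ε : K) * v * w * (h * (g * g')) = h * ε * (v * g) * (w * g')
      ring

end LinearSeries

end BigDivisor

end

/-! ### Limits of sequences superadditive up to a shift. -/

section

open Filter Topology
open scoped ENNReal

namespace BigDivisor

lemma tendsto_ofReal_one_div_sub {g M b : ℕ} (hg : 0 < g) (hM : 0 < M) :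
    Tendsto (fun j : ℕ => ENNReal.ofReal (1 / M - (g * M + b) / M * ((g * j + b : ℕ) : ℝ)⁻¹)) atTop
      (𝓝 (M : ℝ≥0∞)⁻¹) := by
  have h1 : Tendsto (fun j : ℕ => g * j + b) atTop atTop :=
    tendsto_atTop_mono (fun j => by dsimp only [id]; nlinarith) tendsto_id
  have h2 : Tendsto (fun j : ℕ => ((g * j + b : ℕ) : ℝ)⁻¹) atTop (𝓝 0) :=
    tendsto_inv_atTop_zero.comp (tendsto_natCast_atTop_atTop.comp h1)
  have h3 := ((h2.const_mul (((g : ℝ) * M + b) / M)).const_sub (1 / (M : ℝ)))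
  rw [mul_zero, sub_zero] at h3
  have h4 : ENNReal.ofReal (1 / (M : ℝ)) = (M : ℝ≥0∞)⁻¹ := by
    rw [one_div, ENNReal.ofReal_inv_of_pos (by exact_mod_cast hM), ENNReal.ofReal_natCast]
  rw [← h4]
  exact (ENNReal.continuous_ofReal.tendsto _).comp h3

lemma limsup_div_le_of_forall_div_add_le {u : ℕ → ℝ≥0∞} {a : ℕ} {S : ℝ≥0∞}
    (h : ∀ m, 0 < m → u m / (m + a : ℕ) ≤ S) :
    limsup (fun m : ℕ => u m / m) atTop ≤ S := by
  by_cases hS : S = ⊤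
  · rw [hS]; exact le_top
  have hlim : Tendsto (fun m : ℕ => S * ENNReal.ofReal (1 + a * ((m : ℝ))⁻¹)) atTop (𝓝 S) := by
    have h2 : Tendsto (fun m : ℕ => ((m : ℕ) : ℝ)⁻¹) atTop (𝓝 0) :=
      tendsto_inv_atTop_zero.comp tendsto_natCast_atTop_atTop
    have h3 := (h2.const_mul (a : ℝ)).const_add 1
    rw [mul_zero, add_zero] at h3
    have h4 := ENNReal.Tendsto.const_mul (a := S) ((ENNReal.continuous_ofReal.tendsto _).comp h3)
      (Or.inr hS)
    rwa [ENNReal.ofReal_one, mul_one] at h4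
  rw [← hlim.limsup_eq]
  refine limsup_le_limsup ?_
  filter_upwards [eventually_gt_atTop 0] with m hm
  have hm' : (m : ℝ≥0∞) ≠ 0 := by exact_mod_cast hm.ne'
  have hma : ((m + a : ℕ) : ℝ≥0∞) ≠ 0 := by exact_mod_cast (by omega : m + a ≠ 0)
  have h5 : ENNReal.ofReal (1 + a * ((m : ℝ))⁻¹) = ((m + a : ℕ) : ℝ≥0∞) / m := by
    have : (1 : ℝ) + a * (m : ℝ)⁻¹ = ((m + a : ℕ) : ℝ) / m := by
      have : (m : ℝ) ≠ 0 := by exact_mod_cast hm.ne'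
      push_cast
      field_simp
    rw [this, ENNReal.ofReal_div_of_pos (by exact_mod_cast hm), ENNReal.ofReal_natCast,
      ENNReal.ofReal_natCast]
  rw [h5]
  calc u m / m = u m / (m + a : ℕ) * (((m + a : ℕ) : ℝ≥0∞) / m) := by
        rw [← mul_div_assoc, ENNReal.div_mul_cancel hma (ENNReal.natCast_ne_top _)]
    _ ≤ _ := by gcongr; exact h m hm

/-- A superadditive sequence, up to a shift of the argument, on a subsemigroup of `ℕ`
has a limit after division by the argument. -/
theorem limsup_div_le_liminf_div {u : ℕ → ℝ≥0∞} {N : ℕ → Prop} {a g : ℕ}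
    (hN : ∀ i j, N i → N j → N (i + j)) (hNa : N a) (hu : ∀ m, ¬ N m → u m = 0)
    (hsup : ∀ i j, N i → N j → u i + u j ≤ u (i + j + a))
    (hmono : ∀ i j, N i → N j → u i ≤ u (i + j)) (hNg : N g) (hg : 0 < g) (b : ℕ) :
    limsup (fun m : ℕ => u m / m) atTop ≤
      liminf (fun j : ℕ => u (g * j) / (g * j + b : ℕ)) atTop := by
  refine limsup_div_le_of_forall_div_add_le (a := a) fun m hm => ?_
  by_cases hNm : N m
  swap
  · rw [hu m hNm, ENNReal.zero_div]; exact zero_le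
  -- Gluing `q + 1` blocks of degree `m` uses `q` shifts by `a`.
  have hmul : ∀ q : ℕ, N (q * (m + a) + m) ∧ ((q + 1 : ℕ) : ℝ≥0∞) * u m ≤ u (q * (m + a) + m) := by
    intro q
    induction q with
    | zero => simpa using hNm
    | succ q ih =>
      have e : (q + 1) * (m + a) + m = q * (m + a) + m + m + a := by ring
      rw [e]
      refine ⟨hN _ _ (hN _ _ ih.1 hNm) hNa, le_trans ?_ (hsup _ _ ih.1 hNm)⟩
      push_cast at ih ⊢
      rw [add_mul _ _ (u m), one_mul]
      gcongr
      exact ih.2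
  have hga : ∀ r : ℕ, N (a + g * r) := by
    intro r
    induction r with
    | zero => simpa using hNa
    | succ r ih =>
      rw [mul_add_one, ← add_assoc]
      exact hN _ _ ih hNg
  have hlow : ∀ j : ℕ, ((g * (j / (m + a)) : ℕ) : ℝ≥0∞) * u m ≤ u (g * j) := by
    intro j
    by_cases hq : j / (m + a) = 0
    · simp [hq]
    obtain ⟨q, hq'⟩ := Nat.exists_eq_succ_of_ne_zero (mul_ne_zero hg.ne' hq)
    rw [hq']
    refine (hmul q).2.trans ?_
    -- There are `q + 1 = g * (j / (m + a))` blocks. The last one needs no shift, and its unused `a`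
    -- joins the remainder; `a + g * r` lies in the semigroup for every `r`, so monotonicity
    -- applies.
    have e : g * j = q * (m + a) + m + (a + g * (j % (m + a))) := by
      calc g * j = g * ((m + a) * (j / (m + a)) + j % (m + a)) := by rw [Nat.div_add_mod]
        _ = g * (j / (m + a)) * (m + a) + g * (j % (m + a)) := by ring
        _ = _ := by rw [hq', Nat.succ_eq_add_one]; ring
    rw [e]
    exact hmono _ _ (hmul q).1 (hga _)
  have hlim := ENNReal.Tendsto.mul_const (b := u m)
    (tendsto_ofReal_one_div_sub (b := b) hg (by omega : 0 < m + a)) (Or.inl (by simp))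
  rw [div_eq_mul_inv, mul_comm, ← hlim.liminf_eq]
  refine liminf_le_liminf ?_
  filter_upwards [eventually_gt_atTop 0] with j hj
  have hpos : 0 < g * j + b := by positivity
  have hle : ENNReal.ofReal (1 / (m + a : ℕ) - (g * (m + a : ℕ) + b) / (m + a : ℕ) *
      ((g * j + b : ℕ) : ℝ)⁻¹) ≤ ((g * (j / (m + a)) : ℕ) : ℝ≥0∞) / (g * j + b : ℕ) := by
    rw [← ENNReal.ofReal_natCast, ← ENNReal.ofReal_natCast (g * j + b),
      ← ENNReal.ofReal_div_of_pos (by exact_mod_cast hpos)]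
    refine ENNReal.ofReal_le_ofReal ?_
    have hM : (0 : ℝ) < (m + a : ℕ) := by exact_mod_cast (by omega : 0 < m + a)
    have hP : (0 : ℝ) < (g * j + b : ℕ) := by exact_mod_cast hpos
    have hdiv : (j : ℝ) ≤ (m + a : ℕ) * ((j / (m + a) : ℕ) : ℝ) + (m + a : ℕ) := by
      have h1 := Nat.div_add_mod j (m + a)
      have h2 := Nat.mod_lt j (by omega : 0 < m + a)
      exact_mod_cast (by omega : j ≤ (m + a) * (j / (m + a)) + (m + a))
    have hg' : (0 : ℝ) < g := by exact_mod_cast hg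
    generalize ((m + a : ℕ) : ℝ) = M at *
    rw [le_div_iff₀ hP, sub_mul, mul_assoc, inv_mul_cancel₀ hP.ne', mul_one, ← sub_nonneg]
    have e : ((g * (j / (m + a)) : ℕ) : ℝ) - (1 / M * ((g * j + b : ℕ) : ℝ) - (g * M + b) / M) =
        g * (M * ((j / (m + a) : ℕ) : ℝ) + M - j) / M := by
      push_cast
      field_simp
      ring
    rw [e]
    exact div_nonneg (mul_nonneg hg'.le (by linarith)) hM.le
  calc _ ≤ ((g * (j / (m + a)) : ℕ) : ℝ≥0∞) / (g * j + b : ℕ) * u m := by gcongr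
    _ = ((g * (j / (m + a)) : ℕ) : ℝ≥0∞) * u m / (g * j + b : ℕ) := by
      rw [div_eq_mul_inv, div_eq_mul_inv, mul_right_comm]
    _ ≤ _ := by gcongr; exact hlow j

end BigDivisor

end

/-! ### Comparison of the asymptotics of several linear series. -/

noncomputable section

open Filter Topology
open scoped ENNReal

namespace BigDivisor

lemma liminf_add_liminf_le (f g : ℕ → ℝ≥0∞) :
    liminf f atTop + liminf g atTop ≤ liminf (fun j => f j + g j) atTop := by
  have hmono : ∀ f : ℕ → ℝ≥0∞, Monotone fun n => ⨅ i ≥ n, f i := fun f n m hnm =>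
    le_iInf₂ fun i hi => iInf₂_le i (le_trans hnm hi)
  rw [liminf_eq_iSup_iInf_of_nat, liminf_eq_iSup_iInf_of_nat, liminf_eq_iSup_iInf_of_nat,
    ENNReal.iSup_add_iSup_of_monotone (hmono f) (hmono g)]
  exact iSup_mono fun n => le_iInf₂ fun i hi => add_le_add (iInf₂_le i hi) (iInf₂_le i hi)

lemma natCast_rpow_add_rpow_le {a b c : ℕ} {x : ℝ} (hx : 0 ≤ x)
    (h : (a : ℝ) ^ x + (b : ℝ) ^ x ≤ (c : ℝ) ^ x) : (a : ℝ≥0∞) ^ x + (b : ℝ≥0∞) ^ x ≤ (c : ℝ≥0∞) ^ x := by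
  have hcast : ∀ a : ℕ, (a : ℝ≥0∞) ^ x = ENNReal.ofReal ((a : ℝ) ^ x) := fun a => by
    rw [← ENNReal.ofReal_natCast, ENNReal.ofReal_rpow_of_nonneg (Nat.cast_nonneg _) hx]
  rw [hcast, hcast, hcast, ← ENNReal.ofReal_add (by positivity) (by positivity)]
  exact ENNReal.ofReal_le_ofReal h

lemma limsup_div_pow_rpow {n : ℕ} (hn : 0 < n) (f : ℕ → ℝ≥0∞) :
    limsup (fun m : ℕ => f m / (m : ℝ≥0∞) ^ n) atTop ^ (1 / (n : ℝ)) =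
      limsup (fun m : ℕ => f m ^ (1 / (n : ℝ)) / m) atTop := by
  have hn' : (0 : ℝ) < n := by exact_mod_cast hn
  have h := (ENNReal.orderIsoRpow (1 / (n : ℝ)) (by positivity)).limsup_apply (f := atTop)
    (u := fun m : ℕ => f m / (m : ℝ≥0∞) ^ n)
  simp only [ENNReal.orderIsoRpow_apply] at h
  rw [h]
  congr 1
  funext m
  rw [ENNReal.div_rpow_of_nonneg _ _ (by positivity), ← ENNReal.rpow_natCast, ← ENNReal.rpow_mul,
    mul_one_div_cancel hn'.ne', ENNReal.rpow_one]

/-- A sequence with positive limsup after division by `m ^ n` does not grow slower than `m ^ n`. -/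
lemma le_of_limsup_div_pow_pos {n r C : ℕ} {f : ℕ → ℕ} (hf : ∀ m, f m ≤ C * (m + 1) ^ r)
    (h : 0 < limsup (fun m : ℕ => (f m : ℝ≥0∞) / (m : ℝ≥0∞) ^ n) atTop) : n ≤ r := by
  by_contra! hlt
  refine h.ne' (le_antisymm ?_ zero_le)
  have hlim : Tendsto (fun m : ℕ => ((C * 2 ^ r : ℕ) : ℝ≥0∞) * (m : ℝ≥0∞)⁻¹) atTop (𝓝 0) := by
    have := ENNReal.Tendsto.const_mul (a := ((C * 2 ^ r : ℕ) : ℝ≥0∞))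
      ENNReal.tendsto_inv_nat_nhds_zero (Or.inr (ENNReal.natCast_ne_top _))
    rwa [mul_zero] at this
  rw [← hlim.limsup_eq]
  refine limsup_le_limsup ?_
  filter_upwards [eventually_gt_atTop 0] with m hm
  have hm0 : (m : ℝ≥0∞) ≠ 0 := by exact_mod_cast hm.ne'
  rw [ENNReal.div_le_iff (pow_ne_zero _ hm0) (ENNReal.pow_ne_top (ENNReal.natCast_ne_top _)),
    mul_assoc]
  obtain ⟨c, rfl⟩ := Nat.exists_eq_add_of_lt hlt
  rw [pow_succ', ← mul_assoc _ (m : ℝ≥0∞), ENNReal.inv_mul_cancel hm0 (ENNReal.natCast_ne_top _),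
    one_mul]
  norm_cast
  refine (hf m).trans ?_
  rw [mul_assoc, pow_add m, ← mul_assoc (2 ^ r), ← mul_pow]
  refine Nat.mul_le_mul_left _ ((Nat.pow_le_pow_left (by omega) r).trans
    (Nat.le_mul_of_pos_right _ (by positivity)))

namespace LinearSeries
variable {k K : Type*} [Field k] [Field K] [Algebra k K] (Λ : LinearSeries k K)

/-- The `n`-th root of the dimension of the graded pieces. -/
noncomputable def dimRoot (n m : ℕ) : ℝ≥0∞ :=
  (Module.finrank k (Λ.L m) : ℝ≥0∞) ^ (1 / (n : ℝ))

lemma ne_bot_add {a b : ℕ} (ha : Λ.L a ≠ ⊥) (hb : Λ.L b ≠ ⊥) : Λ.L (a + b) ≠ ⊥ := by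
  obtain ⟨f, hf, hf0⟩ := (Submodule.ne_bot_iff _).mp ha
  obtain ⟨g, hg, hg0⟩ := (Submodule.ne_bot_iff _).mp hb
  exact (Submodule.ne_bot_iff _).mpr ⟨_, Λ.mul_mem hf hg, mul_ne_zero hf0 hg0⟩

lemma ne_bot_mul {a : ℕ} (ha : Λ.L a ≠ ⊥) (n : ℕ) : Λ.L (n * a) ≠ ⊥ := by
  obtain ⟨f, hf, hf0⟩ := (Submodule.ne_bot_iff _).mp ha
  exact (Submodule.ne_bot_iff _).mpr ⟨_, Λ.pow_mem hf n, pow_ne_zero n hf0⟩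

lemma exists_pos_ne_bot {n : ℕ}
    (h : 0 < limsup (fun m : ℕ => (Module.finrank k (Λ.L m) : ℝ≥0∞) / (m : ℝ≥0∞) ^ n) atTop) :
    ∃ m, 0 < m ∧ Λ.L m ≠ ⊥ := by
  by_contra! hcon
  refine h.ne' ?_
  rw [limsup_congr (v := fun _ => (0 : ℝ≥0∞)), limsup_const]
  filter_upwards [eventually_gt_atTop 0] with m hm
  rw [hcon m hm, finrank_bot, Nat.cast_zero, ENNReal.zero_div]

/-- The fixed space `S` of degree `a` gives superadditivity up to the shift `a`; multiplication by a
nonzero element gives monotonicity. -/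
lemma limsup_dimRoot_le_liminf {n r C : ℕ} (hn : 0 < n) (hr : n ≤ r) (hΛ : Λ.HasGrowth r C)
    (hBM : LinearBM r k Λ.ratioField) {g : ℕ} (hg : 0 < g) (hLg : Λ.L g ≠ ⊥) (b : ℕ) :
    limsup (fun m : ℕ => Λ.dimRoot n m / m) atTop ≤
      liminf (fun j : ℕ => Λ.dimRoot n (g * j) / (g * j + b : ℕ)) atTop := by
  have hn' : (0 : ℝ) < n := by exact_mod_cast hn
  obtain ⟨a, ha, S, hS, _, h⟩ := Λ.exists_rpow_add_rpow_le hn hr hBM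
  have hfin := fun m => (hΛ m).1
  refine limsup_div_le_liminf_div (N := fun m => Λ.L m ≠ ⊥) (a := a) (fun i j => Λ.ne_bot_add) ha
    (fun m hm => ?_) (fun i j hi hj => ?_) (fun i j hi hj => ?_) hLg hg b
  · rw [not_not] at hm
    rw [dimRoot, hm, finrank_bot, Nat.cast_zero, ENNReal.zero_rpow_of_pos (by positivity)]
  · refine (natCast_rpow_add_rpow_le (by positivity) (h _ _ (hfin i) (hfin j) hi hj
      (fun _ hv _ hw => Λ.div_mem_ratioField hv hw)
      (fun _ hv _ hw => Λ.div_mem_ratioField hv hw))).trans ?_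
    refine ENNReal.rpow_le_rpow (Nat.cast_le.mpr (Submodule.finrank_mono ?_)) (by positivity)
    rw [mul_assoc, add_comm, Submodule.mul_le]
    intro s hs w hw
    refine Λ.mul_mem (hS hs) ?_
    exact (Submodule.mul_le.mpr fun u hu v hv => Λ.mul_mem hu hv : Λ.L i * Λ.L j ≤ _) hw
  · obtain ⟨f, hf, hf0⟩ := (Submodule.ne_bot_iff _).mp hj
    exact ENNReal.rpow_le_rpow (Nat.cast_le.mpr (finrank_le_finrank_of_mul_mem hf0
      fun v hv => Λ.mul_mem hv hf)) (by positivity)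

variable {Λ} {Λ₁ Λ₂ : LinearSeries k K} {p q : ℕ}
  (hmul : ∀ m, ∀ f ∈ Λ₁.L (p * m), ∀ g ∈ Λ₂.L (q * m), f * g ∈ Λ.L m)

include hmul

/-- Multiplying numerator and denominator by a nonzero element of the other series puts the ratios
of `Λ₁` and of `Λ₂` in the field of ratios of `Λ`, where the linear inequality applies. -/
lemma exists_dimRoot_add_le {n r C : ℕ} (hn : 0 < n) (hr : n ≤ r) (hΛ : Λ.HasGrowth r C)
    (hBM : LinearBM r k Λ.ratioField) (h₁ : ∀ m, FiniteDimensional k (Λ₁.L m))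
    (h₂ : ∀ m, FiniteDimensional k (Λ₂.L m)) :
    ∃ a, ∀ m, Λ₁.L (p * m) ≠ ⊥ → Λ₂.L (q * m) ≠ ⊥ →
      Λ₁.dimRoot n (p * m) + Λ₂.dimRoot n (q * m) ≤ Λ.dimRoot n (m + a) := by
  have hn' : (0 : ℝ) < n := by exact_mod_cast hn
  obtain ⟨a, ha, S, hS, _, h⟩ := Λ.exists_rpow_add_rpow_le hn hr hBM
  have hfin := fun m => (hΛ m).1
  refine ⟨a, fun m hi hj => ?_⟩
  obtain ⟨f, hf, hf0⟩ := (Submodule.ne_bot_iff _).mp hi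
  obtain ⟨g, hg, hg0⟩ := (Submodule.ne_bot_iff _).mp hj
  refine (natCast_rpow_add_rpow_le (by positivity) (h _ _ (h₁ (p * m)) (h₂ (q * m)) hi hj
      (fun v hv w hw => ?_) (fun v hv w hw => ?_))).trans ?_
  · rw [← mul_div_mul_right v w hg0]
    exact Λ.div_mem_ratioField (hmul m v hv g hg) (hmul m w hw g hg)
  · rw [← mul_div_mul_left v w hf0]
    exact Λ.div_mem_ratioField (hmul m f hf v hv) (hmul m f hf w hw)
  refine ENNReal.rpow_le_rpow (Nat.cast_le.mpr (Submodule.finrank_mono ?_)) (by positivity)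
  rw [mul_assoc, add_comm, Submodule.mul_le]
  intro s hs w hw
  refine Λ.mul_mem (hS hs) ?_
  exact (Submodule.mul_le.mpr fun u hu v hv => hmul m u hu v hv :
    Λ₁.L (p * m) * Λ₂.L (q * m) ≤ _) hw

/-- Transfers the growth exponent of `Λ` to `Λ₁`, so that positivity of the limsup for `Λ₁` forces
`n ≤ r` for `Λ` as well. -/
lemma finrank_le_of_hasGrowth {r C m₀ : ℕ} (hp : 0 < p) (hΛ : Λ.HasGrowth r C)
    (hm₀ : 0 < m₀) (h₂ : Λ₂.L m₀ ≠ ⊥) (m : ℕ) :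
    Module.finrank k (Λ₁.L m) ≤ C * (m₀ + 1) ^ r * (m + 1) ^ r := by
  by_cases hbot : Λ₁.L m = ⊥
  · rw [hbot, finrank_bot]
    exact Nat.zero_le _
  obtain ⟨f, hf, hf0⟩ := (Submodule.ne_bot_iff _).mp hbot
  obtain ⟨w, hw, hw0⟩ := (Submodule.ne_bot_iff _).mp h₂
  have hfin := fun m => (hΛ m).1
  have hle : Module.finrank k (Λ₁.L m) ≤ Module.finrank k (Λ.L (m₀ * m)) := by
    -- The exponents bring the `Λ₁` factor to degree `p * (m₀ * m)` and the `Λ₂` factor to degree `q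
    -- * (m₀ * m)`; positivity of `p * m₀` leaves room for `v`.
    refine finrank_le_finrank_of_mul_mem (g := f ^ (p * m₀ - 1) * w ^ (q * m))
      (mul_ne_zero (pow_ne_zero _ hf0) (pow_ne_zero _ hw0)) fun v hv => ?_
    rw [← mul_assoc]
    refine hmul _ _ ?_ _ ?_
    · have := Λ₁.mul_mem hv (Λ₁.pow_mem hf (p * m₀ - 1))
      have e : m + (p * m₀ - 1) * m = p * (m₀ * m) := by
        obtain ⟨c, hc⟩ := Nat.exists_eq_succ_of_ne_zero (mul_pos hp hm₀).ne'
        rw [← mul_assoc, hc, Nat.succ_sub_one, Nat.succ_mul, add_comm]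
      rwa [e] at this
    · have := Λ₂.pow_mem hw (q * m)
      rwa [mul_assoc, mul_comm m] at this
  refine hle.trans ((hΛ _).2.trans ?_)
  rw [mul_assoc, ← mul_pow]
  refine Nat.mul_le_mul_left _ (Nat.pow_le_pow_left ?_ r)
  nlinarith

omit hmul in
lemma mul_limsup_dimRoot_le_liminf {n r C : ℕ} (hn : 0 < n) (hr : n ≤ r) (hΛ : Λ.HasGrowth r C)
    (hBM : LinearBM r k Λ.ratioField) {g : ℕ} (hg : 0 < g) (hLg : Λ.L g ≠ ⊥) (p a : ℕ) :
    p * limsup (fun m : ℕ => Λ.dimRoot n m / m) atTop ≤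
      liminf (fun j : ℕ => Λ.dimRoot n (p * (g * j)) / (g * j + a : ℕ)) atTop := by
  rcases Nat.eq_zero_or_pos p with rfl | hp
  · simp
  have hp0 : (p : ℝ≥0∞) ≠ 0 := by exact_mod_cast hp.ne'
  have hpt : (p : ℝ≥0∞) ≠ ⊤ := ENNReal.natCast_ne_top _
  -- Step `p * g` and shift `p * a` make the denominator `p * (g * j + a)`, from which `p` factors
  -- out.
  have h := Λ.limsup_dimRoot_le_liminf hn hr hΛ hBM (mul_pos hp hg) (Λ.ne_bot_mul hLg p) (p * a)
  rw [mul_comm, ← ENNReal.le_div_iff_mul_le (Or.inl hp0) (Or.inl hpt)]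
  refine h.trans ?_
  rw [ENNReal.le_div_iff_mul_le (Or.inl hp0) (Or.inl hpt), mul_comm,
    ← ENNReal.liminf_const_mul_of_ne_top hpt]
  refine le_of_eq (congrArg (fun f => liminf f atTop) (funext fun j => ?_))
  rw [mul_assoc p g j, ← mul_add p, Nat.cast_mul p (g * j + a), ← mul_div_assoc,
    ENNReal.mul_div_mul_left _ _ hp0 hpt]

/-- The Brunn-Minkowski inequality for graded linear series. -/
theorem mul_limsup_add_mul_limsup_le {n : ℕ} (hn : 0 < n) (hp : 0 < p)
    (hΛ : ∃ r C, Λ.HasGrowth r C ∧ LinearBM r k Λ.ratioField)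
    (hΛ₁ : ∃ r C, Λ₁.HasGrowth r C ∧ LinearBM r k Λ₁.ratioField)
    (hΛ₂ : ∃ r C, Λ₂.HasGrowth r C ∧ LinearBM r k Λ₂.ratioField)
    (h₁ : 0 < limsup (fun m : ℕ => (Module.finrank k (Λ₁.L m) : ℝ≥0∞) / (m : ℝ≥0∞) ^ n) atTop)
    (h₂ : 0 < limsup (fun m : ℕ => (Module.finrank k (Λ₂.L m) : ℝ≥0∞) / (m : ℝ≥0∞) ^ n) atTop) :
    p * limsup (fun m : ℕ => Λ₁.dimRoot n m / m) atTop +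
        q * limsup (fun m : ℕ => Λ₂.dimRoot n m / m) atTop ≤
      limsup (fun m : ℕ => Λ.dimRoot n m / m) atTop := by
  obtain ⟨r, C, hg, hBM⟩ := hΛ
  obtain ⟨r₁, C₁, hg₁, hBM₁⟩ := hΛ₁
  obtain ⟨r₂, C₂, hg₂, hBM₂⟩ := hΛ₂
  obtain ⟨m₁, hm₁, hL₁⟩ := Λ₁.exists_pos_ne_bot h₁
  obtain ⟨m₂, hm₂, hL₂⟩ := Λ₂.exists_pos_ne_bot h₂
  have hr₁ : n ≤ r₁ := le_of_limsup_div_pow_pos (fun m => (hg₁ m).2) h₁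
  have hr₂ : n ≤ r₂ := le_of_limsup_div_pow_pos (fun m => (hg₂ m).2) h₂
  have hr : n ≤ r := le_of_limsup_div_pow_pos
    (finrank_le_of_hasGrowth hmul hp hg hm₂ hL₂) h₁
  obtain ⟨a, ha⟩ := exists_dimRoot_add_le hmul hn hr hg hBM (fun m => (hg₁ m).1)
    fun m => (hg₂ m).1
  -- Both series are nonzero in degree `m₁ * m₂`, so both limsups can be bounded by liminfs along
  -- the same progression, where the two sequences may be added termwise.
  have hpos : 0 < m₁ * m₂ := mul_pos hm₁ hm₂
  have hL₁' : Λ₁.L (m₁ * m₂) ≠ ⊥ := mul_comm m₁ m₂ ▸ Λ₁.ne_bot_mul hL₁ m₂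
  have hL₂' : Λ₂.L (m₁ * m₂) ≠ ⊥ := Λ₂.ne_bot_mul hL₂ m₁
  calc _ ≤ _ := add_le_add (mul_limsup_dimRoot_le_liminf hn hr₁ hg₁ hBM₁ hpos hL₁' p a)
        (mul_limsup_dimRoot_le_liminf hn hr₂ hg₂ hBM₂ hpos hL₂' q a)
    _ ≤ _ := liminf_add_liminf_le _ _
    _ ≤ liminf (fun j : ℕ => Λ.dimRoot n (m₁ * m₂ * j + a) / (m₁ * m₂ * j + a : ℕ)) atTop := by
      refine liminf_le_liminf (Eventually.of_forall fun j => ?_)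
      rw [ENNReal.div_add_div_same]
      refine ENNReal.div_le_div_right (ha _ ?_ ?_) _
      · rw [mul_comm (m₁ * m₂) j, ← mul_assoc]
        exact Λ₁.ne_bot_mul hL₁' _
      · rw [mul_comm (m₁ * m₂) j, ← mul_assoc]
        exact Λ₂.ne_bot_mul hL₂' _
    _ ≤ _ := liminf_le_limsup
    _ ≤ _ := Tendsto.limsup_comp_le_limsup (u := fun m : ℕ => Λ.dimRoot n m / m)
      (v := fun j => m₁ * m₂ * j + a)
      (tendsto_atTop_mono (fun j => by dsimp only [id]; nlinarith) tendsto_id)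

end LinearSeries

end BigDivisor

end

/-! ### Volumes of Cartier divisors. -/

noncomputable section

open AlgebraicGeometry CategoryTheory

namespace BigDivisor

section SectionRing
variable {k : Type u} [Field k] {X : Scheme.{u}} [IsIntegral X] (π : X ⟶ Spec (CommRingCat.of k))

/-- The graded linear series `⨁ L(X, mD)`. -/
def sectionSeries (D : CartierDivisor X) :
    @LinearSeries k X.functionField _ _ (functionFieldAlgebra π) :=
  letI := functionFieldAlgebra π
  { L := fun m => sections π (m • D)
    one_mem := by rw [zero_nsmul]; exact one_mem_sections_zero π
    mul_mem := fun {a b f g} hf hg => by rw [add_nsmul]; exact mul_mem_sections π hf hg }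

variable {π}

lemma exists_hasGrowth_sectionSeries (hπ : IsProjectiveOver π) (D : CartierDivisor X) :
    letI := functionFieldAlgebra π
    ∃ r C, (sectionSeries π D).HasGrowth r C ∧ LinearBM r k (sectionSeries π D).ratioField := by
  let _ := functionFieldAlgebra π
  obtain ⟨N, ⟨c⟩⟩ := exists_coordinates hπ
  obtain ⟨e, h, h0, he⟩ := c.exists_mul_pow_mem_satPow D
  exact (sectionSeries π D).exists_hasGrowth_and_linearBM (y := c.y) c.isFractionGenerating
    c.one_mem h0 he

/-- The growth bound makes every `L(X, mD)` finite-dimensional, so the extended dimension is the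
`finrank`. -/
lemma vol_eq (hπ : IsProjectiveOver π) (n : ℕ) (D : CartierDivisor X) :
    letI := functionFieldAlgebra π
    vol π n D = n.factorial * Filter.limsup (fun m : ℕ =>
      (Module.finrank k ((sectionSeries π D).L m) : ENNReal) / (m : ENNReal) ^ n) Filter.atTop := by
  let _ := functionFieldAlgebra π
  obtain ⟨r, C, hg, -⟩ := exists_hasGrowth_sectionSeries hπ D
  unfold vol
  congr 2
  funext m
  congr 1
  have := (hg m).1
  have h : dimSections π (m • D) = (Module.finrank k ((sectionSeries π D).L m) : ℕ∞) := by
    change Cardinal.toENat (Module.rank k ((sectionSeries π D).L m)) = _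
    rw [← Module.finrank_eq_rank, Cardinal.toENat_nat]
  rw [h]
  rfl

/-- The Brunn-Minkowski inequality for volumes. -/
theorem mul_vol_rpow_add_le (hπ : IsProjectiveOver π) {n : ℕ} (hn : 0 < n)
    {D₁ D₂ : CartierDivisor X} (h₁ : 0 < vol π n D₁) (h₂ : 0 < vol π n D₂) {p : ℕ} (hp : 0 < p)
    (q : ℕ) :
    (p : ENNReal) * vol π n D₁ ^ (1 / (n : ℝ)) + (q : ENNReal) * vol π n D₂ ^ (1 / (n : ℝ)) ≤
      vol π n (p • D₁ + q • D₂) ^ (1 / (n : ℝ)) := by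
  let _ := functionFieldAlgebra π
  rw [vol_eq hπ, CanonicallyOrderedAdd.mul_pos] at h₁ h₂
  rw [vol_eq hπ, vol_eq hπ, vol_eq hπ, ENNReal.mul_rpow_of_nonneg _ _ (by positivity),
    ENNReal.mul_rpow_of_nonneg _ _ (by positivity), ENNReal.mul_rpow_of_nonneg _ _ (by positivity),
    limsup_div_pow_rpow hn, limsup_div_pow_rpow hn, limsup_div_pow_rpow hn, mul_left_comm,
    mul_left_comm (q : ENNReal), ← mul_add]
  refine mul_le_mul_right (LinearSeries.mul_limsup_add_mul_limsup_le ?_ hn hp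
    (exists_hasGrowth_sectionSeries hπ _) (exists_hasGrowth_sectionSeries hπ D₁)
    (exists_hasGrowth_sectionSeries hπ D₂) h₁.2 h₂.2) _
  intro m f hf g hg
  change f * g ∈ sections π (m • (p • D₁ + q • D₂))
  have hsum : m • (p • D₁ + q • D₂) = (p * m) • D₁ + (q * m) • D₂ :=
    (nsmul_add (p • D₁) (q • D₂) m).trans
      (congrArg₂ (· + ·) (mul_nsmul D₁ p m).symm (mul_nsmul D₂ q m).symm)
  rw [hsum]
  exact mul_mem_sections π hf hg

end SectionRing

end BigDivisor

end

theorem mainTheorem12 {k : Type u} [Field k] {X : AlgebraicGeometry.Scheme.{u}}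
    [AlgebraicGeometry.IsIntegral X]
    (π : X ⟶ AlgebraicGeometry.Spec (CommRingCat.of k))
    (hπ : BigDivisor.IsProjectiveOver π)
    (n : ℕ) (hn : 0 < n) (hdim : topologicalKrullDim X = n)
    (D₁ D₂ : BigDivisor.CartierDivisor X)
    (h₁ : 0 < BigDivisor.vol π n D₁) (h₂ : 0 < BigDivisor.vol π n D₂) :
    BigDivisor.vol π n D₁ ^ (1 / (n : ℝ)) + BigDivisor.vol π n D₂ ^ (1 / (n : ℝ)) ≤
        BigDivisor.vol π n (D₁ + D₂) ^ (1 / (n : ℝ)) ∧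
      ∀ p q : ℕ,
        (p : ENNReal) * BigDivisor.vol π n D₁ ^ (1 / (n : ℝ)) +
            (q : ENNReal) * BigDivisor.vol π n D₂ ^ (1 / (n : ℝ)) ≤
          BigDivisor.vol π n (p • D₁ + q • D₂) ^ (1 / (n : ℝ)) := by
  refine ⟨?_, fun p q => ?_⟩
  · simpa using BigDivisor.mul_vol_rpow_add_le hπ hn h₁ h₂ one_pos 1
  -- The asymptotic comparison needs a positive first coefficient; for `p = 0 < q` the two divisors
  -- are exchanged.
  rcases Nat.eq_zero_or_pos p with rfl | hp
  · rcases Nat.eq_zero_or_pos q with rfl | hq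
    · simp
    · rw [add_comm, add_comm (0 • D₁)]
      exact BigDivisor.mul_vol_rpow_add_le hπ hn h₂ h₁ hq 0
  · exact BigDivisor.mul_vol_rpow_add_le hπ hn h₁ h₂ hp q
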